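/- **Setting.** An incidence structure consists of a set of (finite) points, a set of lines and an incidence relation between them. Two lines *intersect* (meet) if they share a finite point. *Order.* For three distinct collinear points $A,B,C$, the point $B$ is *between* $A$ and $C$ if every line through $B$ intersects at least one line of each pair of intersecting lines which pass through $A$ and $C$ respectively. The segment $\overline{AB}$ consists of $A$, $B$ and the points between them; the ray with endpoint $R$ through $X\neq R$ consists of $R$, $X$, the points between $R$ and $X$, and the points $Y$ such that $X$ is between $R$ and $Y$. *Parallels.* Rays $r,s$ with endpoints $R,S$ are *parallel* if they are not on a common line and every line that meets one of them meets the other or the segment $\overline{RS}$. Two lines, or a ray and a line, are parallel if they contain parallel rays. *Rimpoints.* Write $T(a,b,\ell)$ if some line intersects all of $a,b,\ell$. A pair $(a,b)$ of parallel lines is a *rimpoint* if there is a line $\ell$ parallel to both $a$ and $b$ with $T(a,b,\ell)$. The rimpoint $(a,b)$ is incident with $\ell$ if $\ell=a$, or $\ell=b$, or $\ell$ is parallel to both $a$ and $b$ and $T(a,b,\ell)$. Two rimpoints are equal if they are incident with the same lines. For points or rimpoints $A\ne B$, $AB$ denotes the line incident with both. If $X$ is a rimpoint and $A$ a finite point,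 $X^A$ is the other rimpoint on the line $XA$, and $X^{AB}=(X^A)^B$. **Axioms.** - (A1) Any two distinct points are incident with a unique line. - (A2) Each line is on at least one point. - (A3) There exist three non-collinear points, and three distinct collinear points. - (A4) Of three distinct collinear points, at least one has the property that every line through it intersects at least one of each pair of intersecting lines through the other two. - (A5) If $P$ is not on $\ell$, there exist two distinct lines on $P$ not meeting $\ell$ such that each line other than $\ell$ that meets $\ell$ meets at least one of those two lines. - (A6) For any two non-collinear rays $r,s$ there is a line $\ell$ such that $\ell$ is parallel to $r$ or contains $r$, and $\ell$ is parallel to $s$ or contains $s$. - (A7) If $A,B,C,D,E,F$ are distinct rimpoints such that $AB\cap DE$, $BC\cap EF$, $CD\cap FA$ exist as finite points, then these three points are collinear. - (A10) Given distinct finite points $P,Q$ there exist lines $\ell$ on $P$ and $m$ on $Q$ such that two common parallels to $\ell$ and $m$ meet in a finite point on $PQ$. - (A11) If $X$ is a rimpoint not on a line $\ell$, there is a unique finite point $R$ on $\ell$ such that for every finite point $S\neq R$ on $\ell$, two common parallels to $\ell$ and $X^{SR}X^{RS}$ meet in a finite point on $XR$. **Perpendicularity.** For rimpoints, $AB//CD$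 means that $AB$ and $CD$ are distinct lines meeting in a finite point. A cyclic order $\mathcal C$ on the rimpoints (a ternary relation such that: $\mathcal C(x,y,z)$ implies $x,y,z$ distinct; for distinct $x,y,z$ exactly one of $\mathcal C(x,y,z)$, $\mathcal C(x,z,y)$ holds; $\mathcal C(x,y,z)$ implies $\mathcal C(y,z,x)$; $\mathcal C(x,y,z)$ and $\mathcal C(x,z,t)$ imply $\mathcal C(x,y,t)$) is *compatible* if $AC//BD$ is equivalent to $(\mathcal C(A,B,C)\wedge\mathcal C(C,D,A))\vee(\mathcal C(A,D,C)\wedge\mathcal C(C,B,A))$. Two rimpoints $X,Y$ not on $\ell$ are on opposite sides of $\ell$ if $X\neq Y$ and $XY$ meets $\ell$ in a finite point. A nonidentity permutation $\alpha$ of the rimpoints that preserves a compatible cyclic order is *order-preserving axial with axis $\ell$* if, for all rimpoints $X,Y$, the lines $XY^\alpha$ and $YX^\alpha$, whenever they are distinct and meet in a finite point, meet on $\ell$, and they do so whenever $X$ and $Y$ are on opposite sides of $\ell$. For lines $\ell,m$ with rimpoints $L_1,L_2$ and $M_1,M_2$, labelled so that $L_1M_2//L_2M_1$, put $\ell\bowtie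 m:=L_1M_2\cap L_2M_1$. The *reflection* $\sigma_\ell$ is the map on rimpoints that fixes the rimpoints of $\ell$ and sends every other rimpoint $A$ to $A^O$, where $O=\ell\bowtie A^{\alpha}A^{\alpha^{-1}}$, for every order-preserving axial $\alpha$ with axis $\ell$. Lines $\ell,m$ are *perpendicular*, $\ell\perp m$, if they meet in a finite point and $\sigma_\ell$ interchanges the rimpoints of $m$. **Theorem.** Let $\mathcal I$ be an incidence structure satisfying (A1)–(A7), (A10) and (A11). Then every line $\ell$ is the axis of some order-preserving axial permutation and the map $\sigma_\ell$ exists and is unique (so that $\perp$ is well defined), and $\mathcal I$ equipped with $\perp$ is a metric plane in the sense of Bachmann. That is, $\perp$ is symmetric and the following hold, where a *reflection in a line $a$* is a nonidentity collineation of $\mathcal I$ that preserves $\perp$ and fixes every point of $a$: - (I1) Any two distinct points are incident with a unique line. - (I2) Every line is incident with at least three points. - (I3) There are three points that are not incident with a common line. - (P1) For any point $P$ and line $a$ there is a line $b$ incident with $P$ and perpendicular to $a$; if $P$ is incident with $a$, then $b$ is unique. - (P2) If $a\perp b$, there is a unique point incident with both $a$ and $b$. - (M1) For every line $a$ there is a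 reflection in $a$. - (M2) Every reflection is an involution on the points. - (M3) If $a,b,c$ are concurrent lines, then every composition of reflections in $a$, $b$ and $c$ is a reflection in some line $d$. - (M4) If $a,b,c$ are lines with a common perpendicular, then every composition of reflections in $a$, $b$ and $c$ is a reflection in some line $d$. -/

import Mathlib

/-! Incidence structures are given by a type `P` of (finite) points, a type `L` of lines and an
incidence relation `Inc : P → L → Prop`. -/

namespace HypInc

section Basic

variable {P L : Type*} (Inc : P → L → Prop)

/-- Two lines intersect: they have a (finite) point in common. -/
def Meets (a b : L) : Prop := ∃ X, Inc X a ∧ Inc X b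

/-- Three points are on a common line. -/
def Collinear (A B C : P) : Prop := ∃ l, Inc A l ∧ Inc B l ∧ Inc C l

/-- Every line through `B` intersects at least one line of each pair of intersecting lines
which pass through `A` and `C`, respectively. -/
def Pierces (A B C : P) : Prop :=
  ∀ a c g, Inc A a → Inc C c → Meets Inc a c → Inc B g → Meets Inc g a ∨ Meets Inc g c

/-- `B` is between `A` and `C`. -/
def Between (A B C : P) : Prop :=
  A ≠ B ∧ B ≠ C ∧ A ≠ C ∧ Collinear Inc A B C ∧ Pierces Inc A B C

/-- The segment with endpoints `A` and `B`. -/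
def segment (A B : P) : Set P := {X | X = A ∨ X = B ∨ Between Inc A X B}

/-- The ray with endpoint `R` through a point `X ≠ R`. -/
def ray (R X : P) : Set P := {Y | Y = R ∨ Y = X ∨ Between Inc R Y X ∨ Between Inc R X Y}

/-- The line `g` has a point in common with the point set `s`. -/
def MeetsSet (g : L) (s : Set P) : Prop := ∃ X ∈ s, Inc X g

/-- The rays from `R` through `X` and from `S` through `Y` lie on a common line. -/
def CollinearRays (R X S Y : P) : Prop := ∃ l, Inc R l ∧ Inc X l ∧ Inc S l ∧ Inc Y l

/-- The rays from `R` through `X` and from `S` through `Y` are (strictly) parallel. -/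
def ParRays (R X S Y : P) : Prop :=
  R ≠ X ∧ S ≠ Y ∧ ¬ CollinearRays Inc R X S Y ∧
  ∀ g, (MeetsSet Inc g (ray Inc R X) →
          MeetsSet Inc g (ray Inc S Y) ∨ MeetsSet Inc g (segment Inc R S)) ∧
       (MeetsSet Inc g (ray Inc S Y) →
          MeetsSet Inc g (ray Inc R X) ∨ MeetsSet Inc g (segment Inc R S))

/-- Two lines are parallel: they contain parallel rays. -/
def Par (a b : L) : Prop :=
  ∃ R X S Y, Inc R a ∧ Inc X a ∧ Inc S b ∧ Inc Y b ∧ ParRays Inc R X S Y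

/-- The ray from `R` through `X` and the line `l` are parallel: they contain parallel rays. -/
def RayPar (R X : P) (l : L) : Prop :=
  ∃ R' X' S Y, ray Inc R' X' ⊆ ray Inc R X ∧ Inc S l ∧ Inc Y l ∧ ParRays Inc R' X' S Y

/-- Parallelism of a ray and a line in the wide sense: a line is also counted as parallel to
the rays that it contains. -/
def RayParWide (R X : P) (l : L) : Prop :=
  (Inc R l ∧ Inc X l) ∨ RayPar Inc R X l

/-- Some line intersects all of `a`, `b` and `l`. -/
def HasTransversal (a b l : L) : Prop := ∃ t, Meets Inc t a ∧ Meets Inc t b ∧ Meets Inc t l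

/-- The pair `(a, b)` of parallel lines determines a rimpoint. -/
def IsRimPair (a b : L) : Prop :=
  Par Inc a b ∧ ∃ l, Par Inc l a ∧ Par Inc l b ∧ HasTransversal Inc a b l

/-- The line `l` is incident with the rimpoint determined by `(a, b)`. -/
def PairOn (a b l : L) : Prop :=
  l = a ∨ l = b ∨ (Par Inc l a ∧ Par Inc l b ∧ HasTransversal Inc a b l)

/-- Rimpoints. A rimpoint is recorded by its set of incident lines, so that two pairs of parallel
lines determine the same rimpoint iff they are incident with the same lines. -/
def Rim : Type _ := {s : Set L // ∃ a b, IsRimPair Inc a b ∧ s = {l | PairOn Inc a b l}}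

variable {Inc}

/-- The rimpoint `A` is incident with the line `l`. -/
def Rim.On (A : Rim Inc) (l : L) : Prop := l ∈ A.val

/-- `c` is the line `AB` joining the distinct rimpoints `A` and `B`. -/
def Joins (A B : Rim Inc) (c : L) : Prop := A ≠ B ∧ A.On c ∧ B.On c

/-- The finite point `Z` is the intersection of the distinct lines `AB` and `CD`. -/
def IsMeet (A B C D : Rim Inc) (Z : P) : Prop :=
  ∃ c d, Joins A B c ∧ Joins C D d ∧ c ≠ d ∧ Inc Z c ∧ Inc Z d

/-- `Y = X ^ A`: the rimpoint `Y` is the other rimpoint on the line joining the rimpoint `X` and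
the finite point `A`; it is the image of `X` under the half-turn about `A`. -/
def IsHalfTurnImage (A : P) (X Y : Rim Inc) : Prop :=
  Y ≠ X ∧ ∃ k, Inc A k ∧ X.On k ∧ Y.On k

variable (Inc)

/-- Two (distinct) common parallels to `l` and `m` meet in the finite point `O`. -/
def CommonParallelsMeetAt (l m : L) (O : P) : Prop :=
  ∃ c d, c ≠ d ∧ Par Inc c l ∧ Par Inc c m ∧ Par Inc d l ∧ Par Inc d m ∧ Inc O c ∧ Inc O d

/-- The axioms (A1)-(A7), (A10) and (A11). -/
structure Axioms : Prop where
  /-- Any two distinct points are incident with a unique line. -/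
  A1 : ∀ A B : P, A ≠ B → ∃! l, Inc A l ∧ Inc B l
  /-- Each line is on at least one point. -/
  A2 : ∀ l, ∃ A, Inc A l
  /-- There are three non-collinear points. -/
  A3_noncollinear : ∃ A B C, A ≠ B ∧ B ≠ C ∧ A ≠ C ∧ ¬ Collinear Inc A B C
  /-- There are three collinear points. -/
  A3_collinear : ∃ A B C, A ≠ B ∧ B ≠ C ∧ A ≠ C ∧ Collinear Inc A B C
  /-- Betweenness. -/
  A4 : ∀ A B C, A ≠ B → B ≠ C → A ≠ C → Collinear Inc A B C →
    Pierces Inc B A C ∨ Pierces Inc A B C ∨ Pierces Inc A C B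
  /-- Hyperbolicity. -/
  A5 : ∀ X l, ¬ Inc X l → ∃ p q, p ≠ q ∧ Inc X p ∧ Inc X q ∧ ¬ Meets Inc p l ∧ ¬ Meets Inc q l ∧
    ∀ m, m ≠ l → Meets Inc m l → Meets Inc m p ∨ Meets Inc m q
  /-- Parallelism. -/
  A6 : ∀ R X S Y, R ≠ X → S ≠ Y → ¬ CollinearRays Inc R X S Y →
    ∃ l, RayParWide Inc R X l ∧ RayParWide Inc S Y l
  /-- Pascal on rimpoints. -/
  A7 : ∀ A B C D E F : Rim Inc, [A, B, C, D, E, F].Nodup → ∀ X Y Z : P,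
    IsMeet A B D E X → IsMeet B C E F Y → IsMeet C D F A Z → Collinear Inc X Y Z
  /-- Existence of midpoints. -/
  A10 : ∀ A B : P, A ≠ B → ∃ l m k O, Inc A l ∧ Inc B m ∧ Inc A k ∧ Inc B k ∧
    CommonParallelsMeetAt Inc l m O ∧ Inc O k
  /-- For a rimpoint `X` not on `l` there is a unique `R` on `l` such that for every other `S` on
  `l` two common parallels to `l` and to the line joining `U = X ^ (S R)` and `V = X ^ (R S)` meet
  on the line `X R`. -/
  A11 : ∀ (X : Rim Inc) (l : L), ¬ X.On l → ∃! R : P, Inc R l ∧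
    ∀ S, Inc S l → S ≠ R → ∃ (XS XR U V : Rim Inc) (n k : L) (O : P),
      IsHalfTurnImage S X XS ∧ IsHalfTurnImage R XS U ∧
      IsHalfTurnImage R X XR ∧ IsHalfTurnImage S XR V ∧
      Joins U V n ∧ CommonParallelsMeetAt Inc l n O ∧ X.On k ∧ Inc R k ∧ Inc O k

end Basic

section Perpendicularity

/-- Cyclic orders. -/
structure IsCyclicOrder {Ω : Type*} (C : Ω → Ω → Ω → Prop) : Prop where
  C1 : ∀ x y z, C x y z → x ≠ y ∧ y ≠ z ∧ z ≠ x
  C2 : ∀ x y z, x ≠ y → y ≠ z → z ≠ x → Xor (C x y z) (C x z y)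
  C3 : ∀ x y z, C x y z → C y z x
  C4 : ∀ x y z t, C x y z → C x z t → C x y t

variable {P L : Type*} {Inc : P → L → Prop}

/-- The separation relation `AB // CD` on rimpoints. -/
def Sep (A B C D : Rim Inc) : Prop := ∃ Z, IsMeet A B C D Z

/-- The cyclic order `C` on the rimpoints is compatible with separation. -/
def CompatibleOrder (C : Rim Inc → Rim Inc → Rim Inc → Prop) : Prop :=
  IsCyclicOrder C ∧ ∀ X Y Z W, Sep X Z Y W ↔ (C X Y Z ∧ C Z W X) ∨ (C X W Z ∧ C Z Y X)

/-- The rimpoints `X` and `Y` are on different sides of `l`. -/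
def OppositeSides (l : L) (X Y : Rim Inc) : Prop :=
  ¬ X.On l ∧ ¬ Y.On l ∧ ∃ c, Joins X Y c ∧ Meets Inc c l

/-- `α` is an order-preserving axial permutation of the rimpoints with axis `l`. -/
structure IsAxial (α : Equiv.Perm (Rim Inc)) (l : L) : Prop where
  ne_one : α ≠ 1
  order : ∃ C : Rim Inc → Rim Inc → Rim Inc → Prop, CompatibleOrder C ∧
    ∀ X Y Z, C X Y Z ↔ C (α X) (α Y) (α Z)
  on_axis : ∀ X Y Z, IsMeet X (α Y) Y (α X) Z → Inc Z l
  meets : ∀ X Y, OppositeSides l X Y → ∃ Z, IsMeet X (α Y) Y (α X) Z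

variable (Inc) in
/-- `O = l ⋈ m`: with a suitable labelling `L₁, L₂` and `M₁, M₂` of the rimpoints of `l` and `m`,
the lines `L₁M₂` and `L₂M₁` meet in the finite point `O`. -/
def IsBowtie (l m : L) (O : P) : Prop :=
  ∃ L₁ L₂ M₁ M₂ : Rim Inc, Joins L₁ L₂ l ∧ Joins M₁ M₂ m ∧ IsMeet L₁ M₂ L₂ M₁ O

/-- `σ` is the reflection in the line `l`, as a map on rimpoints: it fixes the rimpoints of `l`,
and it maps every other rimpoint `A` to `A ^ O`, where `O = l ⋈ (A ^ α)(A ^ α⁻¹)`, for every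
order-preserving axial `α` with axis `l`. -/
def IsLineReflection (l : L) (σ : Rim Inc → Rim Inc) : Prop :=
  (∀ A, A.On l → σ A = A) ∧
  ∀ A, ¬ A.On l → ∀ α : Equiv.Perm (Rim Inc), IsAxial α l →
    ∃ n O, Joins (α A) (α⁻¹ A) n ∧ IsBowtie Inc l n O ∧ IsHalfTurnImage O A (σ A)

variable (Inc) in
/-- Perpendicularity: `l` and `m` intersect, and the reflection in `l` interchanges the rimpoints
of `m`. -/
def Perp (l m : L) : Prop :=
  Meets Inc l m ∧ ∃ σ : Rim Inc → Rim Inc, IsLineReflection l σ ∧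
    ∃ M N, Joins M N m ∧ σ M = N ∧ σ N = M

end Perpendicularity

section MetricPlane

variable {P L : Type*} (Inc : P → L → Prop) (perp : L → L → Prop)

/-- `φ` is (the action on points of) a reflection in the line `a`: a nonidentity collineation which
preserves perpendicularity and fixes every point of `a`. -/
def IsReflection (a : L) (φ : Equiv.Perm P) : Prop :=
  φ ≠ 1 ∧ (∀ X, Inc X a → φ X = X) ∧
  ∃ ψ : Equiv.Perm L, (∀ X l, Inc X l ↔ Inc (φ X) (ψ l)) ∧ ∀ l m, perp l m ↔ perp (ψ l) (ψ m)

/-- Metric planes in the sense of Bachmann. -/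
structure IsMetricPlane : Prop where
  perp_symm : ∀ a b, perp a b → perp b a
  I1 : ∀ A B : P, A ≠ B → ∃! l, Inc A l ∧ Inc B l
  I2 : ∀ l, ∃ A B C, A ≠ B ∧ B ≠ C ∧ A ≠ C ∧ Inc A l ∧ Inc B l ∧ Inc C l
  I3 : ∃ A B C : P, ¬ Collinear Inc A B C
  P1_exists : ∀ X a, ∃ b, Inc X b ∧ perp b a
  P1_unique : ∀ X a, Inc X a → ∃! b, Inc X b ∧ perp b a
  P2 : ∀ a b, perp a b → ∃! X, Inc X a ∧ Inc X b
  M1 : ∀ a, ∃ φ, IsReflection Inc perp a φ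
  M2 : ∀ a φ, IsReflection Inc perp a φ → φ ≠ 1 ∧ φ * φ = 1
  M3 : ∀ a b c, (∃ X, Inc X a ∧ Inc X b ∧ Inc X c) → ∀ ρ₁ ρ₂ ρ₃,
    IsReflection Inc perp a ρ₁ → IsReflection Inc perp b ρ₂ → IsReflection Inc perp c ρ₃ →
    ∃ d, IsReflection Inc perp d (ρ₁ * ρ₂ * ρ₃)
  M4 : ∀ a b c, (∃ m, perp a m ∧ perp b m ∧ perp c m) → ∀ ρ₁ ρ₂ ρ₃,
    IsReflection Inc perp a ρ₁ → IsReflection Inc perp b ρ₂ → IsReflection Inc perp c ρ₃ →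
    ∃ d, IsReflection Inc perp d (ρ₁ * ρ₂ * ρ₃)

end MetricPlane

end HypInc

namespace HypInc

/-! ### Pasch's laws, derived from betweenness defined by incidence. -/

section Order

variable {P L : Type*} {Inc : P → L → Prop}

/-! The theorem is proved by letting the plane act on its rimpoints. The order axioms give Pasch's
laws and the two sides of a line, (A5) gives limiting parallels, and with (A6) the rimpoints behave
like the points of a circle whose chords are the lines: a line has exactly two of them, two of them
lie on exactly one line, and a rimpoint and a finite point lie on exactly one line. Each finite
point `X` thus becomes an involution `ht h X` of the rimpoints, its half-turn, and the geometry
turns into computation with half-turns.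

Pascal's axiom (A7), applied to a hexagon obtained from one rimpoint by applying half-turns about
collinear points cyclically, gives `three_ht`: PQR = RQP. Hence the products PQ with P, Q on a line
form a commutative group of translations, inverted by conjugation with every half-turn about a point
of the line, and a product of three half-turns about collinear points is again one
(`exists_three_ht`). Separation of chords yields a compatible cyclic order, preserved by half-turns;
with it, the order-preserving axial permutations with axis l turn out to be exactly the nontrivial
translations along l (`translation_isAxial`, `IsAxial.exists_eq`). The definition of σ_l therefore
speaks of all translations along l. Axiom (A11) provides the image for translations RS with one
fixed point R, and every translation along l has that form, so σ_l exists and is unique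
(`isLineReflection_iff`).

In the relation that defines σ_l the axis and the line joining a rimpoint to its image play
interchangeable roles; this is `perp_core`, which makes perpendicularity symmetric and shows that
the reflections in two perpendicular lines differ by the half-turn about their intersection
(`Perp.refl_eq`). Axiom (A10) gives midpoints, hence square roots of translations, and these produce
perpendiculars through every point (`exists_perp`). It follows that σ_l permutes the half-turns by
conjugation, so it acts on the points, and `isReflection_iff` identifies this action with the
reflections of a metric plane.

For lines with a common perpendicular m, three reflections reduce to three half-turns about points
of m times σ_m. For lines concurrent in O, common perpendiculars with a suitable auxiliary line turn
the product into a glide reflection σ_t(TC'). It commutes with the half-turn about O, hence so does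
its square, the translation (TC')². No nontrivial translation of this kind does, so T = C'
(`three_refl_concurrent`). -/

theorem Meets.symm {a b : L} (hm : Meets Inc a b) : Meets Inc b a :=
  let ⟨X, h1, h2⟩ := hm; ⟨X, h2, h1⟩

theorem Axioms.exists_line (h : Axioms Inc) {A B : P} (hAB : A ≠ B) :
    ∃ l, Inc A l ∧ Inc B l := (h.A1 A B hAB).exists

theorem Axioms.unq (h : Axioms Inc) {A B : P} {l m : L} (h1 : Inc A l) (h2 : Inc B l)
    (h3 : Inc A m) (h4 : Inc B m) : A = B ∨ l = m := by
  by_cases hAB : A = B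
  · exact .inl hAB
  · exact .inr ((h.A1 A B hAB).unique ⟨h1, h2⟩ ⟨h3, h4⟩)

theorem Axioms.line_eq (h : Axioms Inc) {A B : P} {l m : L} (hAB : A ≠ B) (h1 : Inc A l)
    (h2 : Inc B l) (h3 : Inc A m) (h4 : Inc B m) : l = m := (h.unq h1 h2 h3 h4).resolve_left hAB

theorem Axioms.pt_eq (h : Axioms Inc) {A B : P} {l m : L} (hlm : l ≠ m) (h1 : Inc A l)
    (h3 : Inc A m) (h2 : Inc B l) (h4 : Inc B m) : A = B := (h.unq h1 h2 h3 h4).resolve_right hlm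

theorem Between.symm {A B C : P} (hb : Between Inc A B C) : Between Inc C B A := by
  obtain ⟨h1, h2, h3, ⟨l, h4, h5, h6⟩, h7⟩ := hb
  exact ⟨h2.symm, h1.symm, h3.symm, ⟨l, h6, h5, h4⟩, fun a c g ha hc hac hg =>
    (h7 c a g hc ha hac.symm hg).symm⟩

/-- The middle point is on the line of the outer ones. -/
theorem Between.on_mid (h : Axioms Inc) {A B C : P} {l : L} (hb : Between Inc A B C)
    (hA : Inc A l) (hC : Inc C l) : Inc B l := by
  obtain ⟨h1, h2, h3, ⟨k, h4, h5, h6⟩, h7⟩ := hb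
  rwa [← h.line_eq h3 h4 h6 hA hC]

theorem Between.on_right (h : Axioms Inc) {A B C : P} {l : L} (hb : Between Inc A B C)
    (hA : Inc A l) (hB : Inc B l) : Inc C l := by
  obtain ⟨h1, h2, h3, ⟨k, h4, h5, h6⟩, h7⟩ := hb
  rwa [← h.line_eq h1 h4 h5 hA hB]

theorem Between.on_left (h : Axioms Inc) {A B C : P} {l : L} (hb : Between Inc A B C)
    (hB : Inc B l) (hC : Inc C l) : Inc A l := hb.symm.on_right h hC hB

theorem Between.pierce {A B C Y : P} {a c g : L} (hb : Between Inc A B C) (ha : Inc A a)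
    (hc : Inc C c) (hYa : Inc Y a) (hYc : Inc Y c) (hg : Inc B g) (hga : ¬ Meets Inc g a) :
    Meets Inc g c :=
  (hb.2.2.2.2 a c g ha hc ⟨Y, hYa, hYc⟩ hg).resolve_left hga

theorem Axioms.btw_cases (h : Axioms Inc) {A B C : P} {l : L} (hAB : A ≠ B) (hBC : B ≠ C)
    (hAC : A ≠ C) (hA : Inc A l) (hB : Inc B l) (hC : Inc C l) :
    Between Inc B A C ∨ Between Inc A B C ∨ Between Inc A C B := by
  rcases h.A4 A B C hAB hBC hAC ⟨l, hA, hB, hC⟩ with h1 | h1 | h1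
  · exact .inl ⟨hAB.symm, hAC, hBC, ⟨l, hB, hA, hC⟩, h1⟩
  · exact .inr (.inl ⟨hAB, hBC, hAC, ⟨l, hA, hB, hC⟩, h1⟩)
  · exact .inr (.inr ⟨hAC, hBC.symm, hAB, ⟨l, hA, hC, hB⟩, h1⟩)

theorem Axioms.exists_not_on (h : Axioms Inc) (l : L) : ∃ X, ¬ Inc X l := by
  obtain ⟨A, B, C, -, -, -, hn⟩ := h.A3_noncollinear
  by_contra! hl
  exact hn ⟨l, hl A, hl B, hl C⟩

/-- There is a further line through a point off `l` which misses `l`. -/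
theorem Axioms.exists_ne_miss (h : Axioms Inc) {X : P} {l : L} (hX : ¬ Inc X l) (m : L) :
    ∃ p, p ≠ m ∧ Inc X p ∧ ¬ Meets Inc p l := by
  obtain ⟨p, q, hpq, hp, hq, hpl, hql, -⟩ := h.A5 X l hX
  by_cases hpm : p = m
  · exact ⟨q, fun e => hpq (hpm.trans e.symm), hq, hql⟩
  · exact ⟨p, hpm, hp, hpl⟩

/-- At most one of three points is between the other two. -/
theorem Between.unique (h : Axioms Inc) {A B C : P} (h1 : Between Inc A B C) :
    ¬ Between Inc B A C := by
  intro h2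
  obtain ⟨n, hAn, hBn, hCn⟩ := h1.2.2.2.1
  have hAB := h1.1
  have hBC := h1.2.1
  have hAC := h1.2.2.1
  obtain ⟨X, hX⟩ := h.exists_not_on n
  have hXA : X ≠ A := by rintro rfl; exact hX hAn
  obtain ⟨a, hXa, hAa⟩ := h.exists_line hXA
  have han : a ≠ n := by rintro rfl; exact hX hXa
  have hBa : ¬ Inc B a := fun hB => hAB (h.pt_eq han hAa hAn hB hBn)
  obtain ⟨r, s, hrs, hBr, hBs, hra, hsa, hK⟩ := h.A5 B a hBa
  have hCr : ¬ Inc C r := fun hC => hra ⟨A, by rwa [h.line_eq hBC hBr hC hBn hCn], hAa⟩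
  obtain ⟨c1, c2, hcc, hC1, hC2, hc1r, hc2r, hK2⟩ := h.A5 C r hCr
  -- If `c` misses `r` but meets `s`, then `a` is forced to meet `c` because it misses `s`, and then
  -- `r` is forced to meet `c` because it misses `a`. By (A5) at `C`, such a line `c` exists.
  have key : ∀ c, Inc C c → ¬ Meets Inc c r → Meets Inc c s → False := by
    intro c hCc hcr hcs
    obtain ⟨Y, hYc, hYs⟩ := hcs
    have hca : Meets Inc a c := h2.pierce hBs hCc hYs hYc hAa (fun hm => hsa hm.symm)
    obtain ⟨Z, hZa, hZc⟩ := hca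
    exact hcr (h1.pierce hAa hCc hZa hZc hBr hra).symm
  rcases hK2 s (fun e => hrs e.symm) ⟨B, hBs, hBr⟩ with hm | hm
  · exact key c1 hC1 hc1r hm.symm
  · exact key c2 hC2 hc2r hm.symm

theorem Between.unique' (h : Axioms Inc) {A B C : P} (h1 : Between Inc A B C) :
    ¬ Between Inc A C B := fun h2 => h1.symm.unique h h2.symm

/-- A line joining two inner points of sides of a triangle meets the third side. -/
theorem inner_pasch (h : Axioms Inc) {A Q R S T : P} {l m : L} (h1 : Between Inc A Q R)
    (h2 : Between Inc A S T) (hQS : ∀ n, Inc A n → Inc Q n → ¬ Inc S n) (hQl : Inc Q l)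
    (hTl : Inc T l) (hRm : Inc R m) (hSm : Inc S m) : Meets Inc l m := by
  by_contra hlm
  have hml : ¬ Meets Inc m l := fun hm => hlm hm.symm
  obtain ⟨n, hAn, hQn, hRn⟩ := h1.2.2.2.1
  obtain ⟨k, hAk, hSk, hTk⟩ := h2.2.2.2.1
  have hkn : k ≠ n := by rintro rfl; exact hQS k hAn hQn hSk
  have hAm : ¬ Inc A m := fun hA =>
    h2.1 (h.pt_eq hkn hAk hAn hSk (by rwa [← h.line_eq h1.2.2.1 hA hRm hAn hRn]))
  have hAl : ¬ Inc A l := fun hA =>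
    h1.1 (h.pt_eq hkn.symm hAn hAk hQn (by rwa [← h.line_eq h2.2.2.1 hA hTl hAk hTk]))
  have hRl : ¬ Inc R l := fun hR => hlm ⟨R, hR, hRm⟩
  obtain ⟨p, q, hpq, hAp, hAq, hpm, hqm, hK⟩ := h.A5 A m hAm
  -- Both lines through `A` from (A5) miss `m`, hence also `l`; a further line `c` through `R`
  -- missing `l` must meet one of them, and `Q` between `A` and `R` makes `l` meet one of the two.
  have miss : ∀ a, Inc A a → ¬ Meets Inc a m → ¬ Meets Inc a l := fun a ha ham hal =>
    let ⟨Y, hYa, hYl⟩ := hal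
    (fun e => e.elim (fun e => ham e.symm) hml) (h2.2.2.2.2 a l m ha hTl ⟨Y, hYa, hYl⟩ hSm)
  obtain ⟨c, hcm, hRc, hcl⟩ := h.exists_ne_miss hRl m
  have key : ∀ p, Inc A p → ¬ Meets Inc p m → Meets Inc c p → False := fun p hAp hpm hcp =>
    let ⟨Y, hYc, hYp⟩ := hcp
    hcl (h1.pierce hAp hRc hYp hYc hQl fun e => miss p hAp hpm e.symm).symm
  rcases hK c hcm ⟨R, hRc, hRm⟩ with hm | hm
  · exact key p hAp hpm hm
  · exact key q hAq hqm hm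

theorem inner_pasch' (h : Axioms Inc) {A Q R S T : P} {l m n : L} (h1 : Between Inc A Q R)
    (h2 : Between Inc A S T) (hAn : Inc A n) (hQn : Inc Q n) (hS : ¬ Inc S n) (hQl : Inc Q l)
    (hTl : Inc T l) (hRm : Inc R m) (hSm : Inc S m) : Meets Inc l m :=
  inner_pasch h h1 h2 (fun k hA hQ => by rwa [h.line_eq h1.1 hA hQ hAn hQn]) hQl hTl hRm hSm

/-- If `B` is between `A` and `C` and `A` is between `U` and `Z`, on different lines, then
the lines `UB` and `CZ` meet. -/
theorem outer_pasch (h : Axioms Inc) {A B C U Z : P} {l m n : L} (h1 : Between Inc A B C)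
    (h2 : Between Inc U A Z) (hAn : Inc A n) (hBn : Inc B n) (hUn : ¬ Inc U n)
    (hUl : Inc U l) (hBl : Inc B l) (hCm : Inc C m) (hZm : Inc Z m) : Meets Inc l m := by
  by_contra hlm
  have hCn : Inc C n := h1.on_right h hAn hBn
  obtain ⟨k, hUk, hAk, hZk⟩ := h2.2.2.2.1
  have hkn : k ≠ n := by rintro rfl; exact hUn hUk
  have hZn : ¬ Inc Z n := fun hZ => h2.2.1 (h.pt_eq hkn hAk hAn hZk hZ)
  have hAl : ¬ Inc A l := fun hA => hUn (by rwa [← h.line_eq h1.1 hA hBl hAn hBn])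
  obtain ⟨x, -, hAx, hxl⟩ := h.exists_ne_miss hAl l
  have hxm : ¬ Meets Inc x m := fun ⟨Y, hYx, hYm⟩ =>
    hlm (h1.pierce hAx hCm hYx hYm hBl fun e => hxl e.symm)
  have hUC : U ≠ C := by rintro rfl; exact hUn hCn
  obtain ⟨g, hUg, hCg⟩ := h.exists_line hUC
  have hAg : ¬ Inc A g := fun hA => hUn (by rwa [← h.line_eq h1.2.2.1 hA hCg hAn hCn])
  have hBg : ¬ Inc B g := fun hB => hUn (by rwa [← h.line_eq h1.2.1 hB hCg hBn hCn])
  obtain ⟨H, hHx, hHg⟩ := h2.symm.pierce hZm hUg hCm hCg hAx hxm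
  have hHU : H ≠ U := by rintro rfl; exact hxl ⟨H, hHx, hUl⟩
  have hHC : H ≠ C := by rintro rfl; exact hxm ⟨H, hHx, hCm⟩
  -- For the other two orders, inner Pasch would make `x` meet `l` or `m`.
  have h3 : Between Inc H U C := by
    rcases h.btw_cases hHU hUC hHC hHg hUg hCg with h3 | h3 | h3
    · exact absurd (inner_pasch' h h3.symm h1.symm hCg hHg hBg hHx hAx hUl hBl) hxl
    · exact h3
    · exact absurd (inner_pasch' h h3.symm h2 hUg hCg hAg hCm hZm hHx hAx).symm hxm
  have miss_m : ∀ y, Inc U y → ¬ Meets Inc y x → ¬ Meets Inc y m := fun y hUy hyx ⟨Y, hYy, hYm⟩ =>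
    hxm (h2.pierce hUy hZm hYy hYm hAx fun e => hyx e.symm)
  -- The line `y` meets `n` in a point `D`. If `C` is between `A` and `D`, then `Y = D` works; `A`
  -- between `D` and `C` contradicts inner Pasch. If `D` is between `A` and `C` and no `Y` works,
  -- then each line through `C` meeting `y` would meet `x`, which (A5) at `C` refutes.
  have claim : ∀ y, Inc U y → ¬ Meets Inc y x →
      ∃ Y V, Inc Y y ∧ Inc V x ∧ Between Inc V Z Y := by
    intro y hUy hyx
    have hym := miss_m y hUy hyx
    have hxy : ¬ Meets Inc x y := fun e => hyx e.symm
    obtain ⟨D, hDy, hDn⟩ := h3.pierce hHx hCn hAx hAn hUy hyx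
    have hDA : D ≠ A := by rintro rfl; exact hyx ⟨D, hDy, hAx⟩
    have hDC : D ≠ C := by rintro rfl; exact hym ⟨D, hDy, hCm⟩
    rcases h.btw_cases hDA h1.2.2.1 hDC hDn hAn hCn with h4 | h4 | h4
    · by_contra hno
      have meet_x : ∀ c, Inc C c → Meets Inc c y → Meets Inc c x := by
        rintro c hCc ⟨Y, hYc, hYy⟩
        have hYZ : Y ≠ Z := by rintro rfl; exact hym ⟨Y, hYy, hZm⟩
        have hYm : ¬ Inc Y m := fun hY => hym ⟨Y, hYy, hY⟩
        obtain ⟨t, hYt, hZt⟩ := h.exists_line hYZ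
        obtain ⟨V, hVx, hVt⟩ : Meets Inc x t := h2.pierce hUy hZt hYy hYt hAx hxy
        have hVY : V ≠ Y := by rintro rfl; exact hxy ⟨V, hVx, hYy⟩
        have hVZ : V ≠ Z := by rintro rfl; exact hxm ⟨V, hVx, hZm⟩
        have h5 : Between Inc Y V Z := by
          rcases h.btw_cases hVY hYZ hVZ hVt hYt hZt with h5 | h5 | h5
          · exact h5
          · have hAt : ¬ Inc A t := by
              intro hA
              have htk : t = k := h.line_eq h2.2.1 hA hZt hAk hZk
              subst htk
              have hYU : Y = U := h.pt_eq (l := y) (m := t)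
                (by rintro rfl; exact hyx ⟨A, hAk, hAx⟩) hYy hYt hUy hUk
              have hVA : V = A := h.pt_eq (l := x) (m := t)
                (by rintro rfl; exact hyx ⟨U, hUy, hUk⟩) hVx hVt hAx hA
              subst hYU hVA
              exact h2.unique h h5
            exact absurd (inner_pasch' h h5.symm h2.symm hZt hYt hAt hYy hUy hVx hAx) hyx
          · exact absurd ⟨Y, V, hYy, hVx, h5⟩ hno
        exact (h5.symm.pierce hZm hYc hCm hCc hVx hxm).symm
      have hCx : ¬ Inc C x := fun hC => hxm ⟨C, hC, hCm⟩
      have hAy : ¬ Inc A y := fun hA => hyx ⟨A, hA, hAx⟩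
      obtain ⟨r, s, -, hCr, hCs, hrx, hsx, hK⟩ := h.A5 C x hCx
      obtain ⟨a, hax, hAa, hay⟩ := h.exists_ne_miss hAy x
      have key : ∀ r, Inc C r → ¬ Meets Inc r x → ¬ Meets Inc a r := fun r hCr hrx ⟨Y, hYa, hYr⟩ =>
        hrx (meet_x r hCr (h4.pierce hAa hCr hYa hYr hDy fun e => hay e.symm).symm)
      exact (hK a hax ⟨A, hAa, hAx⟩).elim (key r hCr hrx) (key s hCs hsx)
    · exact absurd (inner_pasch' h h4.symm h3.symm hCn hAn hUn hAx hHx hDy hUy) hxy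
    · have hDZ : D ≠ Z := by rintro rfl; exact hZn hDn
      obtain ⟨t, hDt, hZt⟩ := h.exists_line hDZ
      have htn : t ≠ n := by rintro rfl; exact hZn hZt
      obtain ⟨V, hVx, hVt⟩ : Meets Inc x t := h2.pierce hUy hZt hDy hDt hAx hxy
      have hVD : V ≠ D := by rintro rfl; exact hxy ⟨V, hVx, hDy⟩
      have hVZ : V ≠ Z := by rintro rfl; exact hxm ⟨V, hVx, hZm⟩
      rcases h.btw_cases hVD hDZ hVZ hVt hDt hZt with h5 | h5 | h5
      · exact absurd (inner_pasch' h h5 h4 hDt hVt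
          (fun hC => hDC (h.pt_eq htn hDt hDn hC hCn)) hVx hAx hZm hCm) hxm
      · refine absurd (inner_pasch' h h5.symm h2.symm hZt hDt (fun hA => hDA ?_) hDy hUy hVx hAx) hyx
        exact h.pt_eq htn hDt hDn hA hAn
      · exact ⟨D, V, hDy, hVx, h5⟩
  -- The lines through `A` that meet `y` and those that meet `z` are nested: the order of `A`, `Y`
  -- and the point `W` of `z` on `AY` decides which family is contained in the other.
  have comparable : ∀ y z, Inc U y → ¬ Meets Inc y x → Inc Z z → ¬ Meets Inc z x →
      (∀ a, Inc A a → Meets Inc a y → Meets Inc a z) ∨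
      (∀ a, Inc A a → Meets Inc a z → Meets Inc a y) := by
    intro y z hUy hyx hZz hzx
    have hzy : ¬ Meets Inc z y := fun ⟨Y, hYz, hYy⟩ =>
      (h2.2.2.2.2 y z x hUy hZz ⟨Y, hYy, hYz⟩ hAx).elim (fun e => hyx e.symm) fun e => hzx e.symm
    obtain ⟨Y, V, hYy, hVx, h5⟩ := claim y hUy hyx
    have hAY : A ≠ Y := by rintro rfl; exact hyx ⟨A, hYy, hAx⟩
    obtain ⟨t, hAt, hYt⟩ := h.exists_line hAY
    obtain ⟨W, hWz, hWt⟩ := h5.pierce hVx hYt hAx hAt hZz hzx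
    have hWY : W ≠ Y := by rintro rfl; exact hzy ⟨W, hWz, hYy⟩
    have hWA : W ≠ A := by rintro rfl; exact hzx ⟨W, hWz, hAx⟩
    rcases h.btw_cases hWA hAY hWY hWt hAt hYt with h6 | h6 | h6
    · left
      rintro a hAa ⟨X, hXa, hXy⟩
      exact (h6.symm.pierce hYy hAa hXy hXa hWz hzy).symm
    · have hZt : ¬ Inc Z t := by
        intro hZ
        have htk : t = k := h.line_eq h2.2.1 hAt hZ hAk hZk
        subst htk
        have hYU : Y = U := h.pt_eq (l := y) (m := t)
          (by rintro rfl; exact hyx ⟨A, hAk, hAx⟩) hYy hYt hUy hUk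
        have hVA : V = A := h.pt_eq (l := x) (m := t)
          (by rintro rfl; exact hyx ⟨U, hUy, hUk⟩) hVx (h5.on_left h hZ hYt) hAx hAt
        subst hYU hVA
        exact h2.symm.unique h h5
      exact absurd (inner_pasch' h h6.symm h5.symm hYt hAt hZt hAx hVx hWz hZz).symm hzx
    · right
      rintro a hAa ⟨X, hXa, hXz⟩
      exact (h6.pierce hWz hAa hXz hXa hYy fun e => hzy e.symm).symm
  have hUx : ¬ Inc U x := fun hU => hxl ⟨U, hU, hUl⟩
  have hZx : ¬ Inc Z x := fun hZ => hxm ⟨Z, hZ, hZm⟩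
  obtain ⟨y₁, y₂, -, hU1, hU2, hy1, hy2, hKy⟩ := h.A5 U x hUx
  obtain ⟨z₁, z₂, -, hZ1, hZ2, hz1, hz2, hKz⟩ := h.A5 Z x hZx
  have miss : ∀ y, ¬ Meets Inc y x → ∃ a, a ≠ x ∧ Inc A a ∧ ¬ Meets Inc a y := fun y hy =>
    h.exists_ne_miss (fun hA => hy ⟨A, hA, hAx⟩) x
  have Ky : ∀ a, a ≠ x → Inc A a → Meets Inc a y₁ ∨ Meets Inc a y₂ := fun a hax hAa =>
    hKy a hax ⟨A, hAa, hAx⟩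
  have Kz : ∀ a, a ≠ x → Inc A a → Meets Inc a z₁ ∨ Meets Inc a z₂ := fun a hax hAa =>
    hKz a hax ⟨A, hAa, hAx⟩
  obtain ⟨a₁, ha1, hA1, hm1⟩ := miss y₁ hy1
  obtain ⟨a₂, ha2, hA2, hm2⟩ := miss y₂ hy2
  obtain ⟨a₃, ha3, hA3, hm3⟩ := miss z₁ hz1
  obtain ⟨a₄, ha4, hA4, hm4⟩ := miss z₂ hz2
  have c11 := comparable y₁ z₁ hU1 hy1 hZ1 hz1
  have c12 := comparable y₁ z₂ hU1 hy1 hZ2 hz2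
  have c21 := comparable y₂ z₁ hU2 hy2 hZ1 hz1
  have c22 := comparable y₂ z₂ hU2 hy2 hZ2 hz2
  clear claim miss_m comparable
  have k1 := Ky a₁ ha1 hA1
  have k2 := Ky a₂ ha2 hA2
  have k3 := Ky a₃ ha3 hA3
  have k4 := Ky a₄ ha4 hA4
  have j1 := Kz a₁ ha1 hA1
  have j2 := Kz a₂ ha2 hA2
  have j3 := Kz a₃ ha3 hA3
  have j4 := Kz a₄ ha4 hA4
  -- Write Y₁, Y₂, Z₁, Z₂ for the sets of lines through `A`, other than `x`, meeting the respective
  -- lines. Y₁ ∪ Y₂ and Z₁ ∪ Z₂ are everything, none of the four sets is, and each Yᵢ is comparable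
  -- with each Zⱼ. If Y₁ ⊆ Z₁, then Y₂ ∪ Z₁ is everything although its members are comparable; if Z₁
  -- ⊆ Y₁, the same holds for Z₂ ∪ Y₁.
  grind

end Order
end HypInc


namespace HypInc

/-! ### The two sides of a line. -/

section Sides

variable {P L : Type*} {Inc : P → L → Prop}

variable (Inc) in
/-- The line `l` separates the points `A` and `B`. -/
def Opp (l : L) (A B : P) : Prop :=
  ¬ Inc A l ∧ ¬ Inc B l ∧ ∃ N, Inc N l ∧ Between Inc A N B

theorem Opp.symm {l : L} {A B : P} (ho : Opp Inc l A B) : Opp Inc l B A :=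
  let ⟨h1, h2, N, h3, h4⟩ := ho; ⟨h2, h1, N, h3, h4.symm⟩

/-- Points on a line missing `l` are on the same side of `l`. -/
theorem Opp.congr (h : Axioms Inc) {l m : L} {A C Z : P} (ho : Opp Inc l A C)
    (hml : ¬ Meets Inc m l) (hC : Inc C m) (hZ : Inc Z m) : Opp Inc l A Z := by
  obtain ⟨hAl, hCl, N, hN, hb⟩ := ho
  have hZl : ¬ Inc Z l := fun e => hml ⟨Z, hZ, e⟩
  have hlm : ¬ Meets Inc l m := fun e => hml e.symm
  refine ⟨hAl, hZl, ?_⟩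
  by_cases hCZ : C = Z
  · exact ⟨N, hN, hCZ ▸ hb⟩
  obtain ⟨n, hAn, hNn, hCn⟩ := hb.2.2.2.1
  have hZn : ¬ Inc Z n := fun e =>
    hml ⟨N, by rwa [h.line_eq hCZ hC hZ hCn e], hN⟩
  have hAZ : A ≠ Z := by rintro rfl; exact hZn hAn
  obtain ⟨k, hAk, hZk⟩ := h.exists_line hAZ
  obtain ⟨U, hUl, hUk⟩ := hb.symm.pierce hC hAk hZ hZk hN hlm
  have hUA : U ≠ A := by rintro rfl; exact hAl hUl
  have hUZ : U ≠ Z := by rintro rfl; exact hZl hUl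
  have hUn : ¬ Inc U n := fun e =>
    hZn (by rwa [h.line_eq hUA e hAn hUk hAk])
  -- In the two unwanted orders outer or inner Pasch makes `l` meet `m`.
  rcases h.btw_cases hUA hAZ hUZ hUk hAk hZk with h3 | h3 | h3
  · exact ⟨U, hUl, h3⟩
  · exact absurd (outer_pasch h hb h3 hAn hNn hUn hUl hN hC hZ) hlm
  · exact absurd (inner_pasch' h hb h3.symm hAn hNn hZn hN hUl hC hZ) hlm

theorem Opp.ne {l : L} {A B : P} (ho : Opp Inc l A B) : A ≠ B :=
  let ⟨_, _, _, _, h4⟩ := ho; h4.2.2.1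

/-- Points not separated by a line are linked by lines missing it. -/
theorem linked_of_not_opp (h : Axioms Inc) {l : L} {A C : P} (hA : ¬ Inc A l) (hC : ¬ Inc C l)
    (ho : ¬ Opp Inc l A C) : ∃ Y a c, Inc A a ∧ Inc C c ∧ Inc Y a ∧ Inc Y c ∧
      ¬ Meets Inc a l ∧ ¬ Meets Inc c l := by
  have key : ∀ A C N, ¬ Inc A l → ¬ Inc C l → Inc N l → Between Inc N A C →
      ∃ Y a c, Inc A a ∧ Inc C c ∧ Inc Y a ∧ Inc Y c ∧ ¬ Meets Inc a l ∧ ¬ Meets Inc c l := by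
    intro A C N hA hC hN hb
    obtain ⟨a, -, hAa, hal⟩ := h.exists_ne_miss hA l
    obtain ⟨p, q, -, hCp, hCq, hpl, hql, hK⟩ := h.A5 C l hC
    by_cases h1 : Meets Inc a p
    · obtain ⟨Y, hY1, hY2⟩ := h1
      exact ⟨Y, a, p, hAa, hCp, hY1, hY2, hal, hpl⟩
    by_cases h2 : Meets Inc a q
    · obtain ⟨Y, hY1, hY2⟩ := h2
      exact ⟨Y, a, q, hAa, hCq, hY1, hY2, hal, hql⟩
    exfalso
    -- A line `g` through `N` missing `a` meets `p` or `q`; since `A` is between `N` and `C`, the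
    -- line `a` then meets that line as well.
    obtain ⟨g, hgl, hNg, hga⟩ := h.exists_ne_miss (fun hNa => hal ⟨N, hNa, hN⟩ : ¬ Inc N a) l
    rcases hK g hgl ⟨N, hNg, hN⟩ with ⟨Y, hY1, hY2⟩ | ⟨Y, hY1, hY2⟩
    · exact h1 (hb.pierce hNg hCp hY1 hY2 hAa fun e => hga e.symm)
    · exact h2 (hb.pierce hNg hCq hY1 hY2 hAa fun e => hga e.symm)
  by_cases hAC : A = C
  · subst hAC
    obtain ⟨a, -, hAa, hal⟩ := h.exists_ne_miss hA l
    exact ⟨A, a, a, hAa, hAa, hAa, hAa, hal, hal⟩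
  obtain ⟨n, hAn, hCn⟩ := h.exists_line hAC
  by_cases hnl : Meets Inc n l
  · obtain ⟨N, hNn, hNl⟩ := hnl
    have hNA : N ≠ A := by rintro rfl; exact hA hNl
    have hNC : N ≠ C := by rintro rfl; exact hC hNl
    rcases h.btw_cases hNA hAC hNC hNn hAn hCn with h3 | h3 | h3
    · exact absurd ⟨hA, hC, N, hNl, h3⟩ ho
    · exact key A C N hA hC hNl h3
    · obtain ⟨Y, a, c, h1, h2, h3, h4, h5, h6⟩ := key C A N hC hA hNl h3
      exact ⟨Y, c, a, h2, h1, h4, h3, h6, h5⟩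
  · exact ⟨A, n, n, hAn, hCn, hAn, hAn, hnl, hnl⟩

/-- Moving a point along a line that misses `l` does not change which points it is opposite to
(`Opp.congr`), and two such moves lead from `C` to `B`. -/
theorem not_opp_trans (h : Axioms Inc) {l : L} {A B C : P} (hB : ¬ Inc B l)
    (h1 : ¬ Opp Inc l A B) (h2 : ¬ Opp Inc l B C) : ¬ Opp Inc l A C := by
  intro ho
  obtain ⟨Y, b, c, hBb, hCc, hYb, hYc, hbl, hcl⟩ := linked_of_not_opp h hB ho.2.1 h2
  exact h1 ((ho.congr h hcl hCc hYc).congr h hbl hYb hBb)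

/-- A line not through the vertices of a triangle does not separate all pairs of vertices. -/
theorem not_three_opp (h : Axioms Inc) {l : L} {A C D : P} (h1 : Opp Inc l A C)
    (h2 : Opp Inc l C D) (h3 : Opp Inc l A D) (hn : ∀ n, Inc A n → Inc C n → ¬ Inc D n) :
    False := by
  -- The point `Q` of side `CD` cannot be the middle one of the three points of `l`: the line `CD`
  -- would separate `S` from `R`, although it separates neither of them from `A`.
  have step : ∀ A C D S Q R : P, (∀ n, Inc A n → Inc C n → ¬ Inc D n) → Inc S l → Inc Q l →
      Inc R l → Between Inc A S C → Between Inc C Q D → Between Inc A R D →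
      ¬ Between Inc S Q R := by
    intro A C D S Q R hn hS hQ hR bS bQ bR bb
    obtain ⟨m, hCm, hQm, hDm⟩ := bQ.2.2.2.1
    have hAm : ¬ Inc A m := fun hA => hn m hA hCm hDm
    have hSm : ¬ Inc S m := fun e => hAm (bS.on_left h e hCm)
    have hRm : ¬ Inc R m := fun e => hAm (bR.on_left h e hDm)
    have n1 : ¬ Opp Inc m A S := fun ⟨_, _, N, hN, hb⟩ => by
      have : N = C := by
        obtain ⟨k, hAk, hSk, hCk⟩ := bS.2.2.2.1
        exact h.pt_eq (l := m) (m := k) (by rintro rfl; exact hAm hAk) hN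
          (hb.on_mid h hAk hSk) hCm hCk
      subst this
      exact bS.unique' h hb
    have n2 : ¬ Opp Inc m A R := fun ⟨_, _, N, hN, hb⟩ => by
      have : N = D := by
        obtain ⟨k, hAk, hSk, hDk⟩ := bR.2.2.2.1
        exact h.pt_eq (l := m) (m := k) (by rintro rfl; exact hAm hAk) hN
          (hb.on_mid h hAk hSk) hDm hDk
      subst this
      exact bR.unique' h hb
    exact not_opp_trans h hAm (fun e => n1 e.symm) n2 ⟨hSm, hRm, Q, hQm, bb⟩
  obtain ⟨hA, hC, S, hS, bS⟩ := h1
  obtain ⟨-, hD, Q, hQ, bQ⟩ := h2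
  obtain ⟨-, -, R, hR, bR⟩ := h3
  obtain ⟨n1, hA1, hS1, hC1⟩ := bS.2.2.2.1
  obtain ⟨n2, hC2, hQ2, hD2⟩ := bQ.2.2.2.1
  obtain ⟨n3, hA3, hR3, hD3⟩ := bR.2.2.2.1
  have e12 : n1 ≠ n2 := by rintro rfl; exact hn n1 hA1 hC1 hD2
  have e13 : n1 ≠ n3 := by rintro rfl; exact hn n1 hA1 hC1 hD3
  have e23 : n2 ≠ n3 := by rintro rfl; exact hn n2 hA3 hC2 hD2
  have hSQ : S ≠ Q := by rintro rfl; exact hC ((h.pt_eq e12 hS1 hQ2 hC1 hC2) ▸ hS)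
  have hQR : Q ≠ R := by rintro rfl; exact hD ((h.pt_eq e23 hQ2 hR3 hD2 hD3) ▸ hQ)
  have hSR : S ≠ R := by rintro rfl; exact hA ((h.pt_eq e13 hS1 hR3 hA1 hA3) ▸ hS)
  rcases h.btw_cases hSQ hQR hSR hS hQ hR with h4 | h4 | h4
  · exact step D A C R S Q (fun n a b c => hn n b c a) hR hS hQ bR.symm bS bQ.symm h4.symm
  · exact step A C D S Q R hn hS hQ hR bS bQ bR h4
  · exact step C A D S R Q (fun n a b c => hn n b a c) hS hR hQ bS.symm bR bQ h4

/-- Every line has a point different from a given one. -/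
theorem Axioms.exists_ne_on (h : Axioms Inc) (n : L) (A : P) : ∃ B, B ≠ A ∧ Inc B n := by
  obtain ⟨B, hB⟩ := h.A2 n
  by_cases hBA : B = A
  swap
  · exact ⟨B, hBA, hB⟩
  subst hBA
  obtain ⟨X, hX⟩ := h.exists_not_on n
  have hXB : X ≠ B := by rintro rfl; exact hX hB
  obtain ⟨m, hXm, hBm⟩ := h.exists_line hXB
  have hnm : n ≠ m := by rintro rfl; exact hX hXm
  obtain ⟨Y, hY⟩ := h.exists_not_on m
  obtain ⟨p, q, -, -, -, hpm, hqm, hK⟩ := h.A5 Y m hY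
  rcases hK n hnm ⟨B, hB, hBm⟩ with ⟨Z, hZn, hZp⟩ | ⟨Z, hZn, hZp⟩
  · exact ⟨Z, by rintro rfl; exact hpm ⟨Z, hZp, hBm⟩, hZn⟩
  · exact ⟨Z, by rintro rfl; exact hqm ⟨Z, hZp, hBm⟩, hZn⟩

theorem Axioms.exists_not_on_two (h : Axioms Inc) {A : P} {g l : L} (hg : Inc A g)
    (hl : ¬ Inc A l) : ∃ X, ¬ Inc X g ∧ ¬ Inc X l := by
  obtain ⟨p, hpg, hAp, hpl⟩ := h.exists_ne_miss hl g
  obtain ⟨X, hXA, hXp⟩ := h.exists_ne_on p A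
  exact ⟨X, fun hX => hXA (h.pt_eq hpg hXp hX hAp hg), fun hX => hpl ⟨X, hXp, hX⟩⟩

/-- A line separates the remaining points into two sides. -/
theorem opp_trans (h : Axioms Inc) {l : L} {A C D : P} (h1 : Opp Inc l A C)
    (h2 : Opp Inc l C D) : ¬ Opp Inc l A D := by
  intro h3
  by_cases hn : ∀ n, Inc A n → Inc C n → ¬ Inc D n
  · exact not_three_opp h h1 h2 h3 hn
  push Not at hn
  obtain ⟨g, hA, hC, hD⟩ := hn
  -- For collinear vertices an auxiliary point off their line reduces the claim to three genuine
  -- triangles.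
  obtain ⟨X, hXg, hXl⟩ := h.exists_not_on_two hA h1.1
  have nc : ∀ A C, A ≠ C → Inc A g → Inc C g → ∀ n, Inc X n → Inc A n → ¬ Inc C n :=
    fun A C hAC hA hC n h1 h2 h3 => hXg (by rwa [h.line_eq hAC hA hC h2 h3])
  have tri : ∀ A C, Inc A g → Inc C g → Opp Inc l A C → Opp Inc l X A → ¬ Opp Inc l X C :=
    fun A C hA hC o1 o2 o3 => not_three_opp h o2 o1 o3 (nc A C o1.ne hA hC)
  have tri' : ∀ A C, Inc A g → Inc C g → Opp Inc l A C → ¬ Opp Inc l X A → Opp Inc l X C :=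
    fun A C hA hC o1 o2 => by
      by_contra o3
      exact not_opp_trans h hXl (fun e => o2 e.symm) o3 o1
  by_cases a1 : Opp Inc l X A
  · exact tri C D hC hD h2 (tri' D C hD hC h2.symm (tri A D hA hD h3 a1)) |>.elim
      (tri' C D hC hD h2 (tri A C hA hC h1 a1))
  · exact tri C D hC hD h2 (tri' A C hA hC h1 a1) (tri' A D hA hD h3 a1)

variable (Inc) in
/-- A choice of one of the two sides of `l`. -/
def side (l : L) (X : P) : Prop := ∃ hl : ∃ Y, ¬ Inc Y l, Opp Inc l hl.choose X

theorem opp_iff (h : Axioms Inc) {l : L} {A B : P} (hA : ¬ Inc A l) (hB : ¬ Inc B l) :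
    Opp Inc l A B ↔ ¬ (side Inc l A ↔ side Inc l B) := by
  have hl := h.exists_not_on l
  have hs : ∀ X, side Inc l X ↔ Opp Inc l hl.choose X := fun X =>
    ⟨fun ⟨_, ho⟩ => ho, fun ho => ⟨hl, ho⟩⟩
  have h0 := hl.choose_spec
  rw [hs, hs]
  have t1 := @opp_trans P L Inc h l A hl.choose B
  have t2 := @not_opp_trans P L Inc h l A hl.choose B h0
  have t3 := @not_opp_trans P L Inc h l hl.choose A B hA
  have t4 := @not_opp_trans P L Inc h l hl.choose B A hB
  have s1 : ∀ X Y, Opp Inc l X Y ↔ Opp Inc l Y X := fun X Y => ⟨Opp.symm, Opp.symm⟩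
  have := s1 A hl.choose
  have := s1 B A
  tauto

/-- Betweenness in terms of sides. -/
theorem btw_iff (h : Axioms Inc) {l n : L} {A N B : P} (hA : ¬ Inc A l) (hB : ¬ Inc B l)
    (hN : Inc N l) (hAn : Inc A n) (hNn : Inc N n) (hBn : Inc B n) :
    Between Inc A N B ↔ ¬ (side Inc l A ↔ side Inc l B) := by
  rw [← opp_iff h hA hB]
  constructor
  · exact fun hb => ⟨hA, hB, N, hN, hb⟩
  · rintro ⟨-, -, M, hM, hb⟩
    have : M = N := h.pt_eq (l := l) (m := n) (by rintro rfl; exact hA hAn) hM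
      (hb.on_mid h hAn hBn) hN hNn
    exact this ▸ hb

theorem side_of_miss (h : Axioms Inc) {l m : L} {A B : P} (hml : ¬ Meets Inc m l) (hA : Inc A m)
    (hB : Inc B m) : side Inc l A ↔ side Inc l B := by
  have hAl : ¬ Inc A l := fun e => hml ⟨A, hA, e⟩
  have hBl : ¬ Inc B l := fun e => hml ⟨B, hB, e⟩
  by_contra hc
  obtain ⟨-, -, N, hN, hb⟩ := (opp_iff h hAl hBl).2 hc
  exact hml ⟨N, hb.on_mid h hA hB, hN⟩

theorem meets_of_side (h : Axioms Inc) {l m : L} {A B : P} (hA : Inc A m)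
    (hB : Inc B m) (hAl : ¬ Inc A l) (hBl : ¬ Inc B l) (hs : ¬ (side Inc l A ↔ side Inc l B)) :
    ∃ N, Inc N l ∧ Inc N m ∧ Between Inc A N B := by
  obtain ⟨-, -, N, hN, hb⟩ := (opp_iff h hAl hBl).2 hs
  exact ⟨N, hN, hb.on_mid h hA hB, hb⟩

/-- Points between a point of `l` and a point off `l`, and beyond the latter. -/
theorem Between.side (h : Axioms Inc) {l : L} {N A B : P} (hb : Between Inc N A B)
    (hN : Inc N l) (hA : ¬ Inc A l) : ¬ Inc B l ∧ (HypInc.side Inc l A ↔ HypInc.side Inc l B) := by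
  obtain ⟨n, hNn, hAn, hBn⟩ := hb.2.2.2.1
  have hB : ¬ Inc B l := fun hB => hA (hb.on_mid h hN hB)
  refine ⟨hB, ?_⟩
  by_contra hc
  exact hb.unique h ((btw_iff h hA hB hN hAn hNn hBn).2 hc)

end Sides
end HypInc


namespace HypInc

/-! ### Existence of points on both sides, extension and density. -/

section Existence

variable {P L : Type*} {Inc : P → L → Prop}

/-- A line crossing `m` has points on the side of any given point. -/
theorem Axioms.exists_same_side (h : Axioms Inc) {m n : L} {N Y : P} (hNn : Inc N n)
    (hNm : Inc N m) (hnm : n ≠ m) (hY : ¬ Inc Y m) :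
    ∃ Z, Inc Z n ∧ ¬ Inc Z m ∧ (side Inc m Z ↔ side Inc m Y) := by
  obtain ⟨p, q, -, hYp, hYq, hpm, hqm, hK⟩ := h.A5 Y m hY
  rcases hK n hnm ⟨N, hNn, hNm⟩ with ⟨Z, hZn, hZp⟩ | ⟨Z, hZn, hZp⟩
  · exact ⟨Z, hZn, fun e => hpm ⟨Z, hZp, e⟩, side_of_miss h hpm hZp hYp⟩
  · exact ⟨Z, hZn, fun e => hqm ⟨Z, hZp, e⟩, side_of_miss h hqm hZp hYq⟩

theorem Axioms.exists_line_not_on (h : Axioms Inc) (N : P) : ∃ l, ¬ Inc N l := by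
  obtain ⟨A, B, C, h1, h2, h3, hn⟩ := h.A3_noncollinear
  obtain ⟨c, hAc, hBc⟩ := h.exists_line h1
  obtain ⟨a, hBa, hCa⟩ := h.exists_line h2
  obtain ⟨b, hAb, hCb⟩ := h.exists_line h3
  by_contra! hN
  have hab : a ≠ b := by rintro rfl; exact hn ⟨a, hAb, hBa, hCa⟩
  have hac : a ≠ c := by rintro rfl; exact hn ⟨a, hAc, hBa, hCa⟩
  have e1 := h.pt_eq hab (hN a) (hN b) hCa hCb
  have e2 := h.pt_eq hac (hN a) (hN c) hBa hBc
  exact h2 (e2.symm.trans e1)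

theorem Axioms.exists_third_line (h : Axioms Inc) (N : P) (m n : L) :
    ∃ k, Inc N k ∧ k ≠ m ∧ k ≠ n := by
  obtain ⟨l, hl⟩ := h.exists_line_not_on N
  obtain ⟨p, q, hpq, hp, hq, hpl, hql, -⟩ := h.A5 N l hl
  obtain ⟨X, hX⟩ := h.A2 l
  have hNX : N ≠ X := by rintro rfl; exact hl hX
  obtain ⟨r, hNr, hXr⟩ := h.exists_line hNX
  have h1 : r ≠ p := by rintro rfl; exact hpl ⟨X, hXr, hX⟩
  have h2 : r ≠ q := by rintro rfl; exact hql ⟨X, hXr, hX⟩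
  grind

/-- One betweenness triple, from the three collinear points of (A3), gives one line with points on
both sides. The property spreads to any line meeting it, by way of a third line through the common
point, and two such passages reach every line. -/
theorem Axioms.exists_two_sides (h : Axioms Inc) (m : L) :
    ∃ U V, ¬ Inc U m ∧ ¬ Inc V m ∧ ¬ (side Inc m U ↔ side Inc m V) := by
  let T : L → Prop := fun m => ∃ U V, ¬ Inc U m ∧ ¬ Inc V m ∧ ¬ (side Inc m U ↔ side Inc m V)
  have spread : ∀ m m', T m → Meets Inc m m' → T m' := by
    rintro m m' ⟨U, V, hU, hV, hs⟩ ⟨N, hN, hN'⟩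
    obtain ⟨n, hNn, hnm, hnm'⟩ := h.exists_third_line N m m'
    obtain ⟨U', h1, h2, h3⟩ := h.exists_same_side hNn hN hnm hU
    obtain ⟨V', h4, h5, h6⟩ := h.exists_same_side hNn hN hnm hV
    have hb : Between Inc U' N V' := (btw_iff h h2 h5 hN h1 hNn h4).2 (by tauto)
    have hU' : ¬ Inc U' m' := fun e => hb.1 (h.pt_eq hnm' h1 e hNn hN')
    have hV' : ¬ Inc V' m' := fun e => hb.2.1 (h.pt_eq hnm' hNn hN' h4 e)
    exact ⟨U', V', hU', hV', (btw_iff h hU' hV' hN' h1 hNn h4).1 hb⟩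
  obtain ⟨A, B, C, h1, h2, h3, l, hA, hB, hC⟩ := h.A3_collinear
  have hb : ∃ A B C, Between Inc A B C := by
    rcases h.btw_cases h1 h2 h3 hA hB hC with h4 | h4 | h4 <;> exact ⟨_, _, _, h4⟩
  obtain ⟨A, B, C, hb⟩ := hb
  obtain ⟨l, hA, hB, hC⟩ := hb.2.2.2.1
  obtain ⟨m₀, hm₀, hml, -⟩ := h.exists_third_line B l l
  have hAm : ¬ Inc A m₀ := fun e => hb.1 (h.pt_eq hml e hA hm₀ hB)
  have hCm : ¬ Inc C m₀ := fun e => hb.2.1 (h.pt_eq hml hm₀ hB e hC)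
  have T0 : T m₀ := ⟨A, C, hAm, hCm, (btw_iff h hAm hCm hm₀ hA hB hC).1 hb⟩
  obtain ⟨X, hX⟩ := h.A2 m
  obtain ⟨Y, hYX, hY⟩ := h.exists_ne_on m₀ X
  obtain ⟨k, hYk, hXk⟩ := h.exists_line hYX
  exact spread k m (spread m₀ k T0 ⟨Y, hY, hYk⟩) ⟨X, hXk, hX⟩

/-- A line crossing `m` has points on the side opposite to any given point. -/
theorem Axioms.exists_opp_side (h : Axioms Inc) {m n : L} {N : P} (hNn : Inc N n)
    (hNm : Inc N m) (hnm : n ≠ m) (Y : P) :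
    ∃ Z, Inc Z n ∧ ¬ Inc Z m ∧ ¬ (side Inc m Z ↔ side Inc m Y) := by
  obtain ⟨U, V, hU, hV, hs⟩ := h.exists_two_sides m
  by_cases hUY : side Inc m U ↔ side Inc m Y
  · obtain ⟨Z, h1, h2, h3⟩ := h.exists_same_side hNn hNm hnm hV
    exact ⟨Z, h1, h2, by tauto⟩
  · obtain ⟨Z, h1, h2, h3⟩ := h.exists_same_side hNn hNm hnm hU
    exact ⟨Z, h1, h2, by tauto⟩

theorem Axioms.extend (h : Axioms Inc) {A B : P} (hAB : A ≠ B) : ∃ C, Between Inc A B C := by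
  obtain ⟨n, hA, hB⟩ := h.exists_line hAB
  obtain ⟨m, hBm, hmn, -⟩ := h.exists_third_line B n n
  have hAm : ¬ Inc A m := fun e => hAB (h.pt_eq hmn e hA hBm hB)
  obtain ⟨C, h1, h2, h3⟩ := h.exists_opp_side hB hBm hmn.symm A
  exact ⟨C, (btw_iff h hAm h2 hBm hA hB h1).2 (by tauto)⟩

/-- With `C` between `A` and `D`, and `B` between `D` and `E`, the line `CE` separates `D` from `A`
but not from `B`, so it crosses `AB` between `A` and `B`. -/
theorem Axioms.dense (h : Axioms Inc) {A B : P} (hAB : A ≠ B) : ∃ C, Between Inc A C B := by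
  obtain ⟨n, hA, hB⟩ := h.exists_line hAB
  obtain ⟨C, hC⟩ := h.exists_not_on n
  have hAC : A ≠ C := by rintro rfl; exact hC hA
  obtain ⟨D, hD⟩ := h.extend hAC
  have hDn : ¬ Inc D n := fun e => hC (hD.on_mid h hA e)
  have hDB : D ≠ B := by rintro rfl; exact hDn hB
  obtain ⟨E, hE⟩ := h.extend hDB
  have hEn : ¬ Inc E n := fun e => hDn (hE.on_left h hB e)
  have hCE : C ≠ E := by
    rintro rfl
    obtain ⟨k, h1, h2, h3⟩ := hE.2.2.2.1
    have hAk := hD.on_left h h3 h1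
    exact hC (by rwa [h.line_eq hAB hA hB hAk h2])
  obtain ⟨m, hCm, hEm⟩ := h.exists_line hCE
  obtain ⟨k, hDk, hBk, hEk⟩ := hE.2.2.2.1
  obtain ⟨g, hAg, hCg, hDg⟩ := hD.2.2.2.1
  have hkg : k ≠ g := by rintro rfl; exact hDn (by rwa [h.line_eq hAB hA hB hAg hBk])
  have hDm : ¬ Inc D m := by
    intro e
    have e1 := h.line_eq hD.2.1 hCm e hCg hDg
    have e2 := h.line_eq hE.2.2.1 e hEm hDk hEk
    exact hkg (e2.symm.trans e1)
  have hBm : ¬ Inc B m := fun e => hDm (hE.on_left h e hEm)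
  have hAm : ¬ Inc A m := fun e => hDm (hD.on_right h e hCm)
  have s1 := (btw_iff h hAm hDm hCm hAg hCg hDg).1 hD
  have s2 := (hE.symm.side h hEm hBm).2
  obtain ⟨N, -, -, hb⟩ := meets_of_side h hA hB hAm hBm (by tauto)
  exact ⟨N, hb⟩

/-- For distinct points, rays from `R` are determined by sides. -/
theorem btw_of_side (h : Axioms Inc) {l n : L} {R X Y : P} (hR : Inc R l) (hRn : Inc R n)
    (hX : Inc X n) (hY : Inc Y n) (hXl : ¬ Inc X l) (hYl : ¬ Inc Y l)
    (hs : side Inc l X ↔ side Inc l Y) (hXY : X ≠ Y) :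
    Between Inc R X Y ∨ Between Inc R Y X := by
  have hRX : R ≠ X := by rintro rfl; exact hXl hR
  have hRY : R ≠ Y := by rintro rfl; exact hYl hR
  rcases h.btw_cases hRX hXY hRY hRn hX hY with h1 | h1 | h1
  · exact absurd hs ((btw_iff h hXl hYl hR hX hRn hY).1 h1)
  · exact .inl h1
  · exact .inr h1

theorem mem_ray_iff (h : Axioms Inc) {l n : L} {R X Y : P} (hR : Inc R l) (hRn : Inc R n)
    (hX : Inc X n) (hXl : ¬ Inc X l) :
    Y ∈ ray Inc R X ↔ Inc Y n ∧ (Y = R ∨ (¬ Inc Y l ∧ (side Inc l X ↔ side Inc l Y))) := by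
  have hRX : R ≠ X := by rintro rfl; exact hXl hR
  constructor
  · rintro (rfl | rfl | hb | hb)
    · exact ⟨hRn, .inl rfl⟩
    · exact ⟨hX, .inr ⟨hXl, Iff.rfl⟩⟩
    · have hY : Inc Y n := hb.on_mid h hRn hX
      have hYl : ¬ Inc Y l := fun e => hXl (hb.on_right h hR e)
      exact ⟨hY, .inr ⟨hYl, (hb.side h hR hYl).2.symm⟩⟩
    · exact ⟨hb.on_right h hRn hX, .inr (hb.side h hR hXl)⟩
  · rintro ⟨hY, rfl | ⟨hYl, hs⟩⟩
    · exact .inl rfl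
    · by_cases hXY : X = Y
      · exact .inr (.inl hXY.symm)
      · rcases btw_of_side h hR hRn hX hY hXl hYl hs hXY with h1 | h1
        · exact .inr (.inr (.inr h1))
        · exact .inr (.inr (.inl h1))

/-- Whether two points of a line are on the same side of a point does not depend on the line
used to separate them. -/
theorem side_indep (h : Axioms Inc) {l l' n : L} {R X Y : P} (hR : Inc R l) (hR' : Inc R l')
    (hRn : Inc R n) (hX : Inc X n) (hY : Inc Y n) (hXR : X ≠ R) (hYR : Y ≠ R) (hl : l ≠ n)
    (hl' : l' ≠ n) : (side Inc l X ↔ side Inc l Y) ↔ (side Inc l' X ↔ side Inc l' Y) := by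
  have a1 : ¬ Inc X l := fun e => hXR (h.pt_eq hl e hX hR hRn)
  have a2 : ¬ Inc Y l := fun e => hYR (h.pt_eq hl e hY hR hRn)
  have a3 : ¬ Inc X l' := fun e => hXR (h.pt_eq hl' e hX hR' hRn)
  have a4 : ¬ Inc Y l' := fun e => hYR (h.pt_eq hl' e hY hR' hRn)
  have b1 := btw_iff h a1 a2 hR hX hRn hY
  have b2 := btw_iff h a3 a4 hR' hX hRn hY
  tauto

end Existence
end HypInc


namespace HypInc

/-! ### Concurrent lines and orientation of lines. -/

section Angles

variable {P L : Type*} {Inc : P → L → Prop}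

theorem Axioms.exists_reflected (h : Axioms Inc) {p : L} {R X : P} (hR : Inc R p) (hX : Inc X p)
    (hXR : X ≠ R) : ∃ X', Inc X' p ∧ X' ≠ R ∧
      ∀ l, Inc R l → l ≠ p → ¬ (side Inc l X ↔ side Inc l X') := by
  obtain ⟨X', hb⟩ := h.extend hXR
  have hX' := hb.on_right h hX hR
  refine ⟨X', hX', hb.2.1.symm, fun l hl hlp => ?_⟩
  exact (btw_iff h (fun e => hXR (h.pt_eq hlp e hX hl hR))
    (fun e => hb.2.1 (h.pt_eq hlp hl hR e hX')) hl hX hR hX').1 hb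

/-- Let `X'` lie on `p` beyond `R`. If `q` did not separate `S` from `X`, it would cross the segment
`SX'` in some `N`. Then `N` and `Q`, both on `q`, would be separated by `n` but not by `p`, although
both of these lines cut `q` in `R`. -/
theorem crossbar (h : Axioms Inc) {n p q : L} {R S X Q : P} (hRn : Inc R n) (hRp : Inc R p)
    (hRq : Inc R q) (hnp : n ≠ p) (hnq : n ≠ q) (hpq : p ≠ q) (hS : Inc S n) (hX : Inc X p)
    (hQ : Inc Q q) (hSR : S ≠ R) (hXR : X ≠ R) (hQR : Q ≠ R)
    (h1 : side Inc n X ↔ side Inc n Q) (h2 : side Inc p S ↔ side Inc p Q) :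
    ¬ (side Inc q S ↔ side Inc q X) := by
  intro h3
  obtain ⟨X', hX', hXR', ho⟩ := h.exists_reflected hRp hX hXR
  have hSX : S ≠ X' := by rintro rfl; exact hSR (h.pt_eq hnp hS hX' hRn hRp)
  obtain ⟨t, hSt, hXt⟩ := h.exists_line hSX
  have hSq : ¬ Inc S q := fun e => hSR (h.pt_eq hnq hS e hRn hRq)
  have hXq' : ¬ Inc X' q := fun e => hXR' (h.pt_eq hpq hX' e hRp hRq)
  have hXn' : ¬ Inc X' n := fun e => hXR' (h.pt_eq hnp.symm hX' e hRp hRn)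
  have hSp : ¬ Inc S p := fun e => hSR (h.pt_eq hnp hS e hRn hRp)
  obtain ⟨N, hNq, hNt, hb⟩ := meets_of_side h hSt hXt hSq hXq' (by
    have := ho q hRq hpq.symm; grind only)
  have hNn : ¬ Inc N n := fun e => hXn' (hb.on_right h hS e)
  have hNp : ¬ Inc N p := fun e => hSp (hb.on_left h e hX')
  have hNR : N ≠ R := by rintro rfl; exact hNn hRn
  have s1 := (hb.side h hS hNn).2
  have s2 := (hb.symm.side h hX' hNp).2
  have s3 := side_indep h hRn hRp hRq hNq hQ hNR hQR hnq hpq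
  have s4 := ho n hRn hnp
  clear ho hb
  grind only

/-- Of three concurrent lines with a point on each, an odd number separates the points on the
other two. -/
theorem three_lines (h : Axioms Inc) {n p q : L} {R S X Q : P} (hRn : Inc R n) (hRp : Inc R p)
    (hRq : Inc R q) (hnp : n ≠ p) (hnq : n ≠ q) (hpq : p ≠ q) (hS : Inc S n) (hX : Inc X p)
    (hQ : Inc Q q) (hSR : S ≠ R) (hXR : X ≠ R) (hQR : Q ≠ R) :
    ¬ ((side Inc n X ↔ side Inc n Q) ↔
      ((side Inc p S ↔ side Inc p Q) ↔ (side Inc q S ↔ side Inc q X))) := by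
  intro hc
  -- Reflecting one of `S`, `X`, `Q` through `R` changes exactly two of the three relations, so the
  -- parity is invariant, and `crossbar` excludes the case of no separation for every choice.
  obtain ⟨S', hS', hSR', hoS⟩ := h.exists_reflected hRn hS hSR
  obtain ⟨X', hX', hXR', hoX⟩ := h.exists_reflected hRp hX hXR
  obtain ⟨Q', hQ', hQR', hoQ⟩ := h.exists_reflected hRq hQ hQR
  have c := crossbar h hRn hRp hRq hnp hnq hpq hS hX hQ hSR hXR hQR
  have cS := crossbar h hRn hRp hRq hnp hnq hpq hS' hX hQ hSR' hXR hQR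
  have cX := crossbar h hRn hRp hRq hnp hnq hpq hS hX' hQ hSR hXR' hQR
  have cQ := crossbar h hRn hRp hRq hnp hnq hpq hS hX hQ' hSR hXR hQR'
  have a1 := hoS p hRp hnp.symm
  have a2 := hoS q hRq hnq.symm
  have a3 := hoX n hRn hnp
  have a4 := hoX q hRq hpq.symm
  have a5 := hoQ n hRn hnq
  have a6 := hoQ p hRp hpq
  clear hoS hoX hoQ
  grind

variable (Inc) in
/-- The half-line of `a` from `R` through `X` is oriented positively; the orientation of `a`
is chosen arbitrarily. -/
def dir (a : L) (R X : P) : Prop :=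
  ∃ (hn : ∀ R, ∃ n : L, Inc R n ∧ n ≠ a) (hO : ∃ O, Inc O a),
    (R = hO.choose ∧ side Inc (hn R).choose X) ∨
      (R ≠ hO.choose ∧ (side Inc (hn hO.choose).choose R ↔
        ¬ (side Inc (hn R).choose X ↔ side Inc (hn R).choose hO.choose)))

/-- The orientation is fixed at the origin `O` by a side of `f O`. At another point `R` the positive
half-line is the one away from `O` exactly if `R` is on the positive half-line of `O`. -/
theorem dir_spec (h : Axioms Inc) (a : L) : ∃ (O : P) (f : P → L), Inc O a ∧
    (∀ R, Inc R (f R) ∧ f R ≠ a) ∧ ∀ R X, dir Inc a R X ↔ (R = O ∧ side Inc (f R) X ∨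
      R ≠ O ∧ (side Inc (f O) R ↔ ¬ (side Inc (f R) X ↔ side Inc (f R) O))) := by
  have hn : ∀ R, ∃ n : L, Inc R n ∧ n ≠ a := fun R =>
    let ⟨k, h1, h2, _⟩ := h.exists_third_line R a a; ⟨k, h1, h2⟩
  have hO := h.A2 a
  refine ⟨hO.choose, fun R => (hn R).choose, hO.choose_spec, fun R => (hn R).choose_spec, ?_⟩
  intro R X
  exact ⟨fun ⟨_, _, e⟩ => e, fun e => ⟨hn, hO, e⟩⟩

theorem dir_iff_side (h : Axioms Inc) {a n : L} {R X Y : P} (hRn : Inc R n) (hna : n ≠ a)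
    (hR : Inc R a) (hX : Inc X a) (hY : Inc Y a) (hXR : X ≠ R) (hYR : Y ≠ R) :
    (dir Inc a R X ↔ dir Inc a R Y) ↔ (side Inc n X ↔ side Inc n Y) := by
  obtain ⟨O, f, hO, hf, hd⟩ := dir_spec h a
  rw [hd, hd, side_indep h hRn (hf R).1 hR hX hY hXR hYR hna (hf R).2]
  by_cases hRO : R = O
  · simp [hRO]
  · simp only [hRO, false_and, ne_eq, not_false_eq_true, true_and, false_or]
    tauto

theorem not_btw_and (h : Axioms Inc) {A B C : P} {l : L} (hAB : A ≠ B) (hBC : B ≠ C)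
    (hAC : A ≠ C) (hA : Inc A l) (hB : Inc B l) (hC : Inc C l) :
    (Between Inc B A C ∧ ¬ Between Inc A B C ∧ ¬ Between Inc A C B) ∨
    (¬ Between Inc B A C ∧ Between Inc A B C ∧ ¬ Between Inc A C B) ∨
    (¬ Between Inc B A C ∧ ¬ Between Inc A B C ∧ Between Inc A C B) := by
  have h1 := h.btw_cases hAB hBC hAC hA hB hC
  have h2 := fun e : Between Inc A B C => e.unique h
  have h3 := fun e : Between Inc A B C => e.unique' h
  have h4 := fun e : Between Inc B A C => e.unique' h
  have h5 : Between Inc A C B → ¬ Between Inc B A C := fun e e' => (e.symm.unique' h) e'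
  tauto

theorem dir_flip (h : Axioms Inc) {a : L} {R X : P} (hR : Inc R a) (hX : Inc X a) (hXR : X ≠ R) :
    dir Inc a X R ↔ ¬ dir Inc a R X := by
  obtain ⟨O, f, hO, hf, hd⟩ := dir_spec h a
  have off : ∀ A B, Inc A a → Inc B a → A ≠ B → ¬ Inc B (f A) := fun A B hA hB hAB e =>
    hAB (h.pt_eq (hf A).2 (hf A).1 hA e hB)
  have key : ∀ A B C, Inc A a → Inc B a → Inc C a → A ≠ B → B ≠ C → 
      (Between Inc A B C ↔ ¬ (side Inc (f B) A ↔ side Inc (f B) C)) :=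
    fun A B C hA hB hC hAB hBC =>
      btw_iff h (off B A hB hA hAB.symm) (off B C hB hC hBC) (hf B).1 hA hB hC
  rw [hd, hd]
  by_cases hRO : R = O
  · subst hRO
    simp [hXR]
  by_cases hXO : X = O
  · subst hXO
    simp [hRO]
  have h1 := not_btw_and h hRO (Ne.symm hXO) hXR.symm hR hO hX
  have k1 := key R O X hR hO hX hRO (Ne.symm hXO)
  have k2 := key O R X hO hR hX (Ne.symm hRO) hXR.symm
  have k3 := key R X O hR hX hO hXR.symm hXO
  simp only [hRO, hXO, false_and, ne_eq, not_false_eq_true, true_and, false_or]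
  rw [k1, k2, k3] at h1
  clear k1 k2 k3 key off hd
  grind

end Angles
end HypInc


namespace HypInc

/-! ### Limiting parallels. -/

section Limiting

variable {P L : Type*} {Inc : P → L → Prop}

theorem Axioms.off (h : Axioms Inc) {l n : L} {R X : P} (hln : l ≠ n) (hR : Inc R l)
    (hRn : Inc R n) (hX : Inc X n) (hXR : X ≠ R) : ¬ Inc X l := fun e =>
  hXR (h.pt_eq hln e hX hR hRn)

variable (Inc) in
/-- The half-line of `a` from `R` through `X` does not meet `b`, but all lines through `R`
inside the angle between this half-line and `S` on `b` do. -/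
def Lim (a b : L) (R X S : P) : Prop :=
  Inc R a ∧ Inc X a ∧ Inc S b ∧ ¬ Meets Inc a b ∧ X ≠ R ∧
  ∀ n v W, Inc R n → Inc S n → Inc R v → Inc W v → ¬ Inc W n → ¬ Inc W a →
    (side Inc n X ↔ side Inc n W) → (side Inc a S ↔ side Inc a W) → Meets Inc v b

/-- Suppose `v` lies inside the angle and misses `b`. By (A5) at `S`, it meets a line `p'` through
`S` missing `p`, in a point `Z`. As `p'` meets `b`, it meets `q` in some `Q`. The parity of
`three_lines` puts `S` between `Q` and `Z`, so `b` separates `Z` from `Q` and hence from `R`, and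
`v` meets `b` after all. -/
theorem lim_of_A5 (h : Axioms Inc) {b p q : L} {R S X : P} (hpq : p ≠ q)
    (hRp : Inc R p) (hRq : Inc R q) (hpb : ¬ Meets Inc p b) (hqb : ¬ Meets Inc q b)
    (hK : ∀ m, m ≠ b → Meets Inc m b → Meets Inc m p ∨ Meets Inc m q) (hS : Inc S b)
    (hX : Inc X p) (hXR : X ≠ R) (hs : side Inc q X ↔ side Inc q S) : Lim Inc p b R X S := by
  refine ⟨hRp, hX, hS, hpb, hXR, ?_⟩
  intro n v W hRn hSn hRv hWv hWn hWp h1 h2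
  by_contra hvb
  have hSp : ¬ Inc S p := fun e => hpb ⟨S, e, hS⟩
  have hSq : ¬ Inc S q := fun e => hqb ⟨S, e, hS⟩
  have hnp : n ≠ p := by rintro rfl; exact hSp hSn
  have hnq : n ≠ q := by rintro rfl; exact hSq hSn
  have hvn : v ≠ n := by rintro rfl; exact hWn hWv
  have hvp : v ≠ p := by rintro rfl; exact hWp hWv
  have hSR : S ≠ R := by rintro rfl; exact hSp hRp
  have hWR : W ≠ R := by rintro rfl; exact hWp hRp
  have hRb : ¬ Inc R b := fun e => hpb ⟨R, hRp, e⟩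
  have key : ∀ p', Inc S p' → ¬ Meets Inc p' p → ¬ Meets Inc v p' := by
    rintro p' hSp' hpp ⟨Z, hZv, hZp⟩
    have hpb' : p' ≠ b := by rintro rfl; exact hvb ⟨Z, hZv, hZp⟩
    obtain ⟨Q, hQp', hQq⟩ := (hK p' hpb' ⟨S, hSp', hS⟩).resolve_left hpp
    have hQR : Q ≠ R := by rintro rfl; exact hpp ⟨Q, hQp', hRp⟩
    have hZR : Z ≠ R := by rintro rfl; exact hpp ⟨Z, hZp, hRp⟩
    have hQn : ¬ Inc Q n := h.off hnq hRn hRq hQq hQR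
    have hZn : ¬ Inc Z n := h.off hvn.symm hRn hRv hZv hZR
    have t := three_lines h hRn hRp hRq hnp hnq hpq hSn hX hQq hSR hXR hQR
    have s1 := side_of_miss h hpp hQp' hSp'
    have s2 := side_of_miss h hpp hZp hSp'
    have s3 := side_indep h hRp hRn hRv hZv hWv hZR hWR hvp.symm hvn.symm
    have hb : Between Inc Q S Z := (btw_iff h hQn hZn hSn hQp' hSp' hZp).2 (by grind only)
    have hQb : ¬ Inc Q b := fun e => hqb ⟨Q, hQq, e⟩
    have hZb : ¬ Inc Z b := fun e => hvb ⟨Z, hZv, e⟩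
    have s4 := (btw_iff h hQb hZb hS hQp' hSp' hZp).1 hb
    have s5 := side_of_miss h hqb hQq hRq
    obtain ⟨N, h3, h4, -⟩ := meets_of_side h hRv hZv hRb hZb (by grind only)
    exact hvb ⟨N, h4, h3⟩
  obtain ⟨p', q', -, h3, h4, h5, h6, hK'⟩ := h.A5 S p hSp
  exact (hK' v hvp ⟨R, hRv, hRp⟩).elim (key p' h3 h5) (key q' h4 h6)

/-- The two lines of (A5) are the limiting lines through `R`, one on each side of the connecting
line `n`; the point `U` selects which is called `a`. -/
theorem exists_lim (h : Axioms Inc) {b n : L} {R S : P} (U : P) (hRb : ¬ Inc R b) (hS : Inc S b)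
    (hRn : Inc R n) (hSn : Inc S n) :
    ∃ a X q Q, Lim Inc a b R X S ∧ Lim Inc q b R Q S ∧ (side Inc n X ↔ side Inc n U) ∧
      ¬ (side Inc n Q ↔ side Inc n U) ∧ q ≠ a ∧ (side Inc q X ↔ side Inc q S) ∧
      ∀ m, m ≠ b → Meets Inc m b → Meets Inc m a ∨ Meets Inc m q := by
  obtain ⟨p, q, hpq, hp, hq, hpb, hqb, hK⟩ := h.A5 R b hRb
  have hSp : ¬ Inc S p := fun e => hpb ⟨S, e, hS⟩
  have hSq : ¬ Inc S q := fun e => hqb ⟨S, e, hS⟩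
  have hnp : n ≠ p := by rintro rfl; exact hSp hSn
  have hnq : n ≠ q := by rintro rfl; exact hSq hSn
  have hSR : S ≠ R := by rintro rfl; exact hSp hp
  obtain ⟨X, hXp, hXq, hs⟩ := h.exists_same_side hp hq hpq hSq
  obtain ⟨Q, hQq, hQp, hs'⟩ := h.exists_same_side hq hp hpq.symm hSp
  have hXR : X ≠ R := by rintro rfl; exact hXq hq
  have hQR : Q ≠ R := by rintro rfl; exact hQp hp
  have t := three_lines h hRn hp hq hnp hnq hpq hSn hXp hQq hSR hXR hQR
  have l1 := lim_of_A5 h hpq hp hq hpb hqb hK hS hXp hXR hs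
  have hK' : ∀ m, m ≠ b → Meets Inc m b → Meets Inc m q ∨ Meets Inc m p :=
    fun m h1 h2 => (hK m h1 h2).symm
  have l2 := lim_of_A5 h hpq.symm hq hp hqb hpb hK' hS hQq hQR hs'
  by_cases hc : side Inc n X ↔ side Inc n U
  · exact ⟨p, X, q, Q, l1, l2, hc, by grind only, hpq.symm, hs, hK⟩
  · exact ⟨q, Q, p, X, l2, l1, by grind only, hc, hpq, hs', hK'⟩

/-- Of two different half-lines on the same side of `n`, one lies inside the angle that the other
forms with `RS`, and so it would have to meet `b`. -/
theorem Lim.unique (h : Axioms Inc) {a a' b n : L} {R X X' S : P} (h1 : Lim Inc a b R X S)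
    (h2 : Lim Inc a' b R X' S) (hRn : Inc R n) (hSn : Inc S n)
    (hs : side Inc n X ↔ side Inc n X') : a = a' := by
  by_contra hne
  obtain ⟨hRa, hXa, hS, hab, hXR, f⟩ := h1
  obtain ⟨hRa', hXa', -, hab', hXR', f'⟩ := h2
  have hSa : ¬ Inc S a := fun e => hab ⟨S, e, hS⟩
  have hSa' : ¬ Inc S a' := fun e => hab' ⟨S, e, hS⟩
  have hna : n ≠ a := by rintro rfl; exact hSa hSn
  have hna' : n ≠ a' := by rintro rfl; exact hSa' hSn
  have hSR : S ≠ R := by rintro rfl; exact hSa hRa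
  have t := three_lines h hRn hRa hRa' hna hna' hne hSn hXa hXa' hSR hXR hXR'
  have f1 := f n a' X' hRn hSn hRa' hXa' (h.off hna' hRn hRa' hXa' hXR')
    (h.off hne hRa hRa' hXa' hXR') hs
  have f2 := f' n a X hRn hSn hRa hXa (h.off hna hRn hRa hXa hXR)
    (h.off (Ne.symm hne) hRa' hRa hXa hXR) hs.symm
  grind only

theorem Lim.congr (h : Axioms Inc) {a b : L} {R X X' S : P} (h1 : Lim Inc a b R X S)
    (hX' : Inc X' a) (hXR' : X' ≠ R) (hd : dir Inc a R X ↔ dir Inc a R X') :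
    Lim Inc a b R X' S := by
  obtain ⟨hRa, hXa, hS, hab, hXR, f⟩ := h1
  refine ⟨hRa, hX', hS, hab, hXR', ?_⟩
  intro n v W hRn hSn hRv hWv hWn hWa h3 h4
  have hna : n ≠ a := by rintro rfl; exact hab ⟨S, hSn, hS⟩
  have := dir_iff_side h hRn hna hRa hXa hX' hXR hXR'
  exact f n v W hRn hSn hRv hWv hWn hWa (by grind only) h4

/-- The limiting relation is symmetric. -/
theorem Lim.symm (h : Axioms Inc) {a b n : L} {R X S Y : P} (h1 : Lim Inc a b R X S)
    (hY : Inc Y b) (hYS : Y ≠ S) (hRn : Inc R n) (hSn : Inc S n)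
    (hs : side Inc n X ↔ side Inc n Y) : Lim Inc b a S Y R := by
  have h0 := h1
  obtain ⟨hRa, hXa, hS, hab, hXR, -⟩ := h1
  have hRb : ¬ Inc R b := fun e => hab ⟨R, hRa, e⟩
  have hSa : ¬ Inc S a := fun e => hab ⟨S, e, hS⟩
  have hna : n ≠ a := by rintro rfl; exact hSa hSn
  have hSR : S ≠ R := by rintro rfl; exact hSa hRa
  have hXn : ¬ Inc X n := h.off hna hRn hRa hXa hXR
  obtain ⟨a', X', q, Q', l1, l2, s1, -, hqa, s2, hK⟩ := exists_lim h X hRb hS hRn hSn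
  have e := l1.unique h h0 hRn hSn s1
  subst e
  have hRq := l2.1
  have hqb := l2.2.2.2.1
  have hSq : ¬ Inc S q := fun e => hqb ⟨S, e, hS⟩
  have hnq : n ≠ q := by rintro rfl; exact hSq hSn
  have s3 := side_indep h hRn hRq hRa hXa l1.2.1 hXR l1.2.2.2.2.1 hna hqa
  refine ⟨hS, hY, hRa, fun e => hab e.symm, hYS, ?_⟩
  intro n' v W hSn' hRn' hSv hWv hWn hWb h3 h4
  have : n' = n := h.line_eq hSR hSn' hRn' hSn hRn
  subst this
  have hvb : v ≠ b := by rintro rfl; exact hWb hWv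
  have hvn : v ≠ n' := by rintro rfl; exact hWn hWv
  by_contra hva
  -- If `v` misses `a`, (A5) makes it meet the other limiting line `q` in a point `Q` across `n`
  -- from `W`. Then `b` separates `W` from `Q`, hence from `R`, contrary to the choice of `W`.
  obtain ⟨Q, hQv, hQq⟩ := (hK v hvb ⟨S, hSv, hS⟩).resolve_left hva
  have hQR : Q ≠ R := by rintro rfl; exact hva ⟨Q, hQv, hRa⟩
  have hQn : ¬ Inc Q n' := h.off hnq hRn hRq hQq hQR
  have hQb : ¬ Inc Q b := fun e => hqb ⟨Q, hQq, e⟩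
  have s4 := side_of_miss h hva hSv hQv
  have t := three_lines h hRn hRa hRq hna hnq hqa.symm hSn hXa hQq hSR hXR hQR
  have hb : Between Inc Q S W := (btw_iff h hQn hWn hSn hQv hSv hWv).2 (by grind only)
  have s5 := (btw_iff h hQb hWb hS hQv hSv hWv).1 hb
  have s6 := side_of_miss h hqb hQq hRq
  grind only

theorem side_pair (h : Axioms Inc) {a b n n' : L} {R X S S' : P} (hRa : Inc R a) (hXa : Inc X a)
    (hXR : X ≠ R) (hab : ¬ Meets Inc a b) (hS : Inc S b) (hS' : Inc S' b) (hSS : S ≠ S')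
    (hRn : Inc R n) (hSn : Inc S n) (hRn' : Inc R n') (hSn' : Inc S' n') :
    n ≠ n' ∧ ((side Inc n X ↔ side Inc n S') ↔ ¬ (side Inc n' X ↔ side Inc n' S)) := by
  have hSa : ¬ Inc S a := fun e => hab ⟨S, e, hS⟩
  have hSa' : ¬ Inc S' a := fun e => hab ⟨S', e, hS'⟩
  have hna : n ≠ a := by rintro rfl; exact hSa hSn
  have hna' : n' ≠ a := by rintro rfl; exact hSa' hSn'
  have hnn : n ≠ n' := by
    rintro rfl
    exact hab ⟨R, hRa, by rwa [h.line_eq hSS hS hS' hSn hSn']⟩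
  have t := three_lines h hRa hRn hRn' hna.symm hna'.symm hnn hXa hSn hSn' hXR
    (by rintro rfl; exact hSa hRa) (by rintro rfl; exact hSa' hRa)
  have s := side_of_miss h (fun e => hab e.symm) hS hS'
  exact ⟨hnn, by grind only⟩

/-- A line `v` through `R` missing `b` has `S` and `S'` on the same side. The parity rule for `v`,
`RS` and `RS'` shows that if `v` is inside the angle for `S'`, it is inside the one for `S`. -/
theorem Lim.change (h : Axioms Inc) {a b : L} {R X S S' : P} (h1 : Lim Inc a b R X S)
    (hS' : Inc S' b) : Lim Inc a b R X S' := by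
  by_cases hSS : S = S'
  · exact hSS ▸ h1
  obtain ⟨hRa, hXa, hS, hab, hXR, f⟩ := h1
  refine ⟨hRa, hXa, hS', hab, hXR, ?_⟩
  intro n' v W hRn' hSn' hRv hWv hWn' hWa h3 h4
  have hRb : ¬ Inc R b := fun e => hab ⟨R, hRa, e⟩
  have hSR : S ≠ R := by rintro rfl; exact hRb hS
  have hSR' : S' ≠ R := by rintro rfl; exact hRb hS'
  obtain ⟨n, hSn, hRn⟩ := h.exists_line hSR
  have s1 := side_of_miss h (fun e => hab e.symm) hS hS'
  by_contra hvb
  have hvn : v ≠ n := by rintro rfl; exact hvb ⟨S, hSn, hS⟩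
  have hvn' : v ≠ n' := by rintro rfl; exact hvb ⟨S', hSn', hS'⟩
  have hWR : W ≠ R := by rintro rfl; exact hWa hRa
  have hWn : ¬ Inc W n := h.off hvn.symm hRn hRv hWv hWR
  have f1 := f n v W hRn hSn hRv hWv hWn hWa
  obtain ⟨hnn, s2⟩ := side_pair h hRa hXa hXR hab hS hS' hSS hRn hSn hRn' hSn'
  have t := three_lines h hRv hRn hRn' hvn hvn' hnn hWv hSn hSn' hWR hSR hSR'
  have s3 := side_of_miss h (fun e => hvb e.symm) hS hS'
  grind only

theorem dir_change (h : Axioms Inc) {a b n n' : L} {R X S S' Y Y' : P} (hRa : Inc R a)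
    (hXa : Inc X a) (hXR : X ≠ R) (hab : ¬ Meets Inc a b) (hS : Inc S b) (hS' : Inc S' b)
    (hY : Inc Y b) (hYS : Y ≠ S) (hY' : Inc Y' b) (hYS' : Y' ≠ S')
    (hRn : Inc R n) (hSn : Inc S n) (hRn' : Inc R n') (hSn' : Inc S' n')
    (hs : side Inc n X ↔ side Inc n Y) (hs' : side Inc n' X ↔ side Inc n' Y') :
    dir Inc b S Y ↔ dir Inc b S' Y' := by
  have hRb : ¬ Inc R b := fun e => hab ⟨R, hRa, e⟩
  have hnb : n ≠ b := by rintro rfl; exact hRb hRn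
  have hnb' : n' ≠ b := by rintro rfl; exact hRb hRn'
  by_cases hSS : S = S'
  · subst hSS
    have : n = n' := h.line_eq (by rintro rfl; exact hRb hS) hRn hSn hRn' hSn'
    subst this
    exact (dir_iff_side h hSn hnb hS hY hY' hYS hYS').2 (by grind only)
  · obtain ⟨hnn, s2⟩ := side_pair h hRa hXa hXR hab hS hS' hSS hRn hSn hRn' hSn'
    have d1 := dir_iff_side h hSn hnb hS hY hS' hYS (Ne.symm hSS)
    have d2 := dir_iff_side h hSn' hnb' hS' hY' hS hYS' hSS
    have d3 := dir_flip h hS hS' (Ne.symm hSS)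
    grind only

variable (Inc) in
/-- The ends of `a` and `b` in the directions `s` and `t` agree. -/
def Asy (a b : L) (s t : Prop) : Prop :=
  ¬ Meets Inc a b ∧ ∀ R S, Inc R a → Inc S b → ∀ X Y, Inc X a → X ≠ R → (dir Inc a R X ↔ s) →
    Inc Y b → Y ≠ S → (dir Inc b S Y ↔ t) → Lim Inc a b R X S ∧ Lim Inc b a S Y R ∧
      ∀ n, Inc R n → Inc S n → (side Inc n X ↔ side Inc n Y)

theorem Asy.symm {a b : L} {s t : Prop} (h1 : Asy Inc a b s t) : Asy Inc b a t s :=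
  ⟨fun e => h1.1 e.symm, fun R S hR hS X Y hX hXR hd hY hYS hd' =>
    let ⟨l1, l2, h3⟩ := h1.2 S R hS hR Y X hY hYS hd' hX hXR hd
    ⟨l2, l1, fun n hn hn' => (h3 n hn' hn).symm⟩⟩

/-- One pair of base points suffices: `Lim.change` moves the point on the second line, and by the
symmetry of `Lim` the same move applies to the first. -/
theorem asy_of_lim (h : Axioms Inc) {a b n : L} {R X S Y : P} (h1 : Lim Inc a b R X S)
    (hY : Inc Y b) (hYS : Y ≠ S) (hRn : Inc R n) (hSn : Inc S n)
    (hs : side Inc n X ↔ side Inc n Y) : Asy Inc a b (dir Inc a R X) (dir Inc b S Y) := by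
  have hab := h1.2.2.2.1
  have hba : ¬ Meets Inc b a := fun e => hab e.symm
  have hRa := h1.1
  have hXa := h1.2.1
  have hXR := h1.2.2.2.2.1
  have hS := h1.2.2.1
  refine ⟨hab, fun R' S' hR' hS' X' Y' hX' hXR' hd hY' hYS' hd' => ?_⟩
  have hRS : ∀ R S, Inc R a → Inc S b → R ≠ S := by
    rintro R S hR hS rfl; exact hab ⟨R, hR, hS⟩
  obtain ⟨n1, hRn1, hSn1⟩ := h.exists_line (hRS R S' hRa hS')
  obtain ⟨n2, hRn2, hSn2⟩ := h.exists_line (hRS R' S' hR' hS')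
  have na : ∀ n, Inc S' n → n ≠ a := by rintro n hn rfl; exact hab ⟨S', hn, hS'⟩
  have nb : ∀ n R, Inc R a → Inc R n → n ≠ b := by rintro n R hR hn rfl; exact hab ⟨R, hR, hn⟩
  obtain ⟨Y1, hY1, hYn1, s1⟩ := h.exists_same_side hS' hSn1 (nb n1 R hRa hRn1).symm
    (h.off (na n1 hSn1) hRn1 hRa hXa hXR)
  have hYS1 : Y1 ≠ S' := by rintro rfl; exact hYn1 hSn1
  have d1 := dir_change h hRa hXa hXR hab hS hS' hY hYS hY1 hYS1 hRn hSn hRn1 hSn1 hs s1.symm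
  have l1 := (h1.change h hS').symm h hY1 hYS1 hRn1 hSn1 s1.symm
  obtain ⟨X1, hX1, hXn1, s2⟩ := h.exists_same_side hR' hRn2 (na n2 hSn2).symm
    (h.off (nb n2 R' hR' hRn2) hSn2 hS' hY1 hYS1)
  have hXR1 : X1 ≠ R' := by rintro rfl; exact hXn1 hRn2
  have d2 := dir_change h hS' hY1 hYS1 hba hRa hR' hXa hXR hX1 hXR1 hSn1 hRn1 hSn2 hRn2 s1 s2.symm
  have l2 := (l1.change h hR')
  have l3 := l2.symm h hX1 hXR1 hSn2 hRn2 s2.symm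
  refine ⟨l3.congr h hX' hXR' (by grind only), l2.congr h hY' hYS' (by grind only), ?_⟩
  intro n hn hn'
  have : n = n2 := h.line_eq (hRS R' S' hR' hS') hn hn' hRn2 hSn2
  subst this
  have e1 := dir_iff_side h hRn2 (na n hSn2) hR' hX' hX1 hXR' hXR1
  have e2 := dir_iff_side h hSn2 (nb n R' hR' hRn2) hS' hY' hY1 hYS' hYS1
  grind only

end Limiting
end HypInc


namespace HypInc

/-! ### Asymptotic lines form pencils. -/

section Pencils

variable {P L : Type*} {Inc : P → L → Prop}

/-- Propositions serve as labels for the two directions of a line. Only their truth value counts,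
and `propext` exchanges equivalent labels. -/
theorem exists_dir (h : Axioms Inc) {a : L} {R : P} (hR : Inc R a) (s : Prop) :
    ∃ X, Inc X a ∧ X ≠ R ∧ (dir Inc a R X ↔ s) := by
  obtain ⟨X, hXR, hX⟩ := h.exists_ne_on a R
  obtain ⟨n, hn, hna, -⟩ := h.exists_third_line R a a
  obtain ⟨X', h1, h2, h3⟩ := h.exists_reflected hR hX hXR
  have := dir_iff_side h hn hna hR hX h1 hXR h2
  have := h3 n hn hna
  by_cases hc : dir Inc a R X ↔ s
  · exact ⟨X, hX, hXR, hc⟩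
  · exact ⟨X', h1, h2, by grind only⟩

theorem Asy.ne_points {a b : L} {s t : Prop} (h1 : Asy Inc a b s t) {R S : P} (hR : Inc R a)
    (hS : Inc S b) : R ≠ S := by rintro rfl; exact h1.1 ⟨R, hR, hS⟩

theorem Asy.ne (h : Axioms Inc) {a b : L} {s t : Prop} (h1 : Asy Inc a b s t) : a ≠ b := by
  rintro rfl
  obtain ⟨R, hR⟩ := h.A2 a
  exact h1.1 ⟨R, hR, hR⟩

/-- If two lines agreed in two pairs of ends, the limiting half-lines on both sides of a connecting
line would lie on one line through `R`, but `exists_lim` yields two different ones. -/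
theorem Asy.functional (h : Axioms Inc) {a b : L} {s t s' t' : Prop} (h1 : Asy Inc a b s t)
    (h2 : Asy Inc a b s' t') : (s ↔ s') ∧ (t ↔ t') := by
  obtain ⟨R, hR⟩ := h.A2 a
  obtain ⟨S, hS⟩ := h.A2 b
  obtain ⟨n, hRn, hSn⟩ := h.exists_line (h1.ne_points hR hS)
  obtain ⟨X, hX, hXR, d1⟩ := exists_dir h hR s
  obtain ⟨X', hX', hXR', d1'⟩ := exists_dir h hR s'
  obtain ⟨Y, hY, hYS, d2⟩ := exists_dir h hS t
  obtain ⟨Y', hY', hYS', d2'⟩ := exists_dir h hS t'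
  have hna : n ≠ a := by rintro rfl; exact h1.1 ⟨S, hSn, hS⟩
  have hnb : n ≠ b := by rintro rfl; exact h1.1 ⟨R, hR, hRn⟩
  obtain ⟨l1, -, s1⟩ := h1.2 R S hR hS X Y hX hXR d1 hY hYS d2
  obtain ⟨l2, -, s2⟩ := h2.2 R S hR hS X' Y' hX' hXR' d1' hY' hYS' d2'
  have e1 := dir_iff_side h hRn hna hR hX hX' hXR hXR'
  have e2 := dir_iff_side h hSn hnb hS hY hY' hYS hYS'
  have s1 := s1 n hRn hSn
  have s2 := s2 n hRn hSn
  by_cases hc : side Inc n X ↔ side Inc n X'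
  · grind only
  · exfalso
    have hRb : ¬ Inc R b := fun e => h1.1 ⟨R, hR, e⟩
    obtain ⟨a', X1, q, Q, m1, m2, k1, k2, hqa, -⟩ :=
      exists_lim h X hRb hS hRn hSn
    have f1 := m1.unique h l1 hRn hSn k1
    have f2 := m2.unique h l2 hRn hSn (by grind only)
    exact hqa (f2.trans f1.symm)

theorem exists_asy (h : Axioms Inc) {b : L} {R : P} (hR : ¬ Inc R b) (t : Prop) :
    ∃ a s, Inc R a ∧ Asy Inc a b s t := by
  obtain ⟨S, hS⟩ := h.A2 b
  have hRS : R ≠ S := by rintro rfl; exact hR hS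
  obtain ⟨n, hRn, hSn⟩ := h.exists_line hRS
  have hnb : n ≠ b := by rintro rfl; exact hR hRn
  obtain ⟨Y, hY, hYS, d⟩ := exists_dir h hS t
  obtain ⟨a, X, -, -, l, -, s1, -⟩ := exists_lim h Y hR hS hRn hSn
  have := asy_of_lim h l hY hYS hRn hSn s1
  rw [propext d] at this
  exact ⟨a, _, l.1, this⟩

theorem Asy.unique (h : Axioms Inc) {a a' b : L} {s s' t : Prop} {R : P} (h1 : Asy Inc a b s t)
    (h2 : Asy Inc a' b s' t) (hR : Inc R a) (hR' : Inc R a') : a = a' := by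
  obtain ⟨S, hS⟩ := h.A2 b
  obtain ⟨n, hRn, hSn⟩ := h.exists_line (h1.ne_points hR hS)
  obtain ⟨X, hX, hXR, d1⟩ := exists_dir h hR s
  obtain ⟨X', hX', hXR', d1'⟩ := exists_dir h hR' s'
  obtain ⟨Y, hY, hYS, d2⟩ := exists_dir h hS t
  obtain ⟨l1, -, s1⟩ := h1.2 R S hR hS X Y hX hXR d1 hY hYS d2
  obtain ⟨l2, -, s2⟩ := h2.2 R S hR' hS X' Y hX' hXR' d1' hY hYS d2
  exact l1.unique h l2 hRn hSn ((s1 n hRn hSn).trans (s2 n hRn hSn).symm)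

/-- A limiting half-line is limiting for the lines in between. -/
theorem Lim.of_between (h : Axioms Inc) {a b c g : L} {R S T Z : P} (h1 : Lim Inc c b T Z S)
    (hR : Inc R a) (hac : ¬ Meets Inc a c) (hab : ¬ Meets Inc a b) (hTg : Inc T g)
    (hRg : Inc R g) (hb : Between Inc T R S) : Lim Inc c a T Z R := by
  obtain ⟨hT, hZ, hS, hcb, hZT, f⟩ := h1
  have hSg := hb.on_right h hTg hRg
  refine ⟨hT, hZ, hR, fun e => hac e.symm, hZT, ?_⟩
  intro n v W hTn hRn hTv hWv hWn hWc h3 h4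
  have : n = g := h.line_eq hb.1 hTn hRn hTg hRg
  subst this
  have hRc : ¬ Inc R c := fun e => hac ⟨R, hR, e⟩
  have s1 := (hb.side h hT hRc).2
  obtain ⟨N, hNv, hNb⟩ := f n v W hTg hSg hTv hWv hWn hWc h3 (by grind only)
  have hTa : ¬ Inc T a := fun e => hac ⟨T, e, hT⟩
  have hSa : ¬ Inc S a := fun e => hab ⟨S, e, hS⟩
  have hNa : ¬ Inc N a := fun e => hab ⟨N, e, hNb⟩
  have s2 := (btw_iff h hTa hSa hR hTg hRg hSg).1 hb
  have s3 := side_of_miss h (fun e => hab e.symm) hS hNb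
  obtain ⟨M, h5, h6, -⟩ := meets_of_side h hTv hNv hTa hNa (by grind only)
  exact ⟨M, h6, h5⟩

/-- A line `v` inside the angle at `R` first meets the middle line `b`, in `N`. Its continuation
beyond `N` is inside the corresponding angle at `N`, so it meets `c` because `b` is limiting to `c`
from `N`. -/
theorem Asy.compose (h : Axioms Inc) {a b c g : L} {s t u : Prop} {R S T : P}
    (h1 : Asy Inc a b s t) (h2 : Asy Inc b c t u) (hac : ¬ Meets Inc a c) (hR : Inc R a)
    (hS : Inc S b) (hT : Inc T c) (hRg : Inc R g) (hSg : Inc S g) (hb : Between Inc R S T) :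
    Asy Inc a c s u := by
  have hTg := hb.on_right h hRg hSg
  obtain ⟨X, hX, hXR, d1⟩ := exists_dir h hR s
  obtain ⟨Y, hY, hYS, d2⟩ := exists_dir h hS t
  obtain ⟨Z, hZ, hZT, d3⟩ := exists_dir h hT u
  obtain ⟨l1, -, s1⟩ := h1.2 R S hR hS X Y hX hXR d1 hY hYS d2
  obtain ⟨-, -, s2⟩ := h2.2 S T hS hT Y Z hY hYS d2 hZ hZT d3
  have s1 := s1 g hRg hSg
  have s2 := s2 g hSg hTg
  have hga : g ≠ a := by rintro rfl; exact h1.1 ⟨S, hSg, hS⟩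
  have hgb : g ≠ b := by rintro rfl; exact h1.1 ⟨R, hR, hRg⟩
  rw [← propext d1, ← propext d3]
  refine asy_of_lim h ⟨hR, hX, hT, hac, hXR, ?_⟩ hZ hZT hRg hTg (s1.trans s2)
  intro n v W hRn hTn hRv hWv hWn hWa h3 h4
  have : n = g := h.line_eq hb.2.2.1 hRn hTn hRg hTg
  subst this
  by_contra hvc
  have hSa : ¬ Inc S a := fun e => h1.1 ⟨S, e, hS⟩
  have hRb : ¬ Inc R b := fun e => h1.1 ⟨R, hR, e⟩
  have hTb : ¬ Inc T b := fun e => h2.1 ⟨T, e, hT⟩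
  have s3 := (hb.side h hR hSa).2
  have hvg : v ≠ n := by rintro rfl; exact hWn hWv
  have hva : v ≠ a := by rintro rfl; exact hWa hWv
  have hWR : W ≠ R := by rintro rfl; exact hWn hRn
  obtain ⟨N, hNv, hNb⟩ := l1.2.2.2.2.2 n v W hRg hSg hRv hWv hWn hWa h3 (by grind only)
  have hNR : N ≠ R := by rintro rfl; exact hRb hNb
  have hNT : N ≠ T := by rintro rfl; exact hTb hNb
  have hNn : ¬ Inc N n := h.off hvg.symm hRg hRv hNv hNR
  have hNS : N ≠ S := by rintro rfl; exact hNn hSg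
  have s4 := side_of_miss h (fun e => h1.1 e.symm) hS hNb
  have s5 := side_indep h hR hRg hRv hNv hWv hNR hWR hva.symm hvg.symm
  have e1 := dir_iff_side h hSg hgb hS hY hNb hYS hNS
  have e2 := dir_flip h hS hNb hNS
  obtain ⟨Y', hY', hYN', d4⟩ := exists_dir h hNb t
  obtain ⟨l2, -, -⟩ := h2.2 N T hNb hT Y' Z hY' hYN' d4 hZ hZT d3
  obtain ⟨m, hNm, hTm⟩ := h.exists_line hNT
  have hmb : m ≠ b := by rintro rfl; exact hTb hTm
  have e3 := dir_iff_side h hNm hmb hNb hY' hS hYN' hNS.symm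
  have hSm : ¬ Inc S m := h.off hmb hNm hNb hS hNS.symm
  have s6 := hb.symm.side h hTm hSm
  obtain ⟨W', hb'⟩ := h.extend hNR.symm
  have hWv' := hb'.on_right h hRv hNv
  have hvb : v ≠ b := by rintro rfl; exact hRb hRv
  have hvm : v ≠ m := by rintro rfl; exact s6.1 hRv
  have hWm : ¬ Inc W' m := h.off hvm.symm hNm hNv hWv' hb'.2.1.symm
  have hWb : ¬ Inc W' b := h.off hvb.symm hNb hNv hWv' hb'.2.1.symm
  have s7 := (btw_iff h s6.1 hWm hNm hRv hNv hWv').1 hb'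
  have s8 := (btw_iff h hRb hWb hNb hRv hNv hWv').1 hb'
  have s9 := (btw_iff h hRb hTb hS hRg hSg hTg).1 hb
  exact hvc (l2.2.2.2.2.2 m v W' hNm hTm hNv hWv' hWm hWb (by grind only) (by grind only))

/-- If `b` separates `R` from `T`, take the line `RT`. Otherwise one of the lines `SR`, `ST` enters
the angle at `S` between `b` and the other, and the limiting property makes it meet the third line.
-/
theorem Asy.exists_transversal (h : Axioms Inc) {a b c : L} {s t u : Prop}
    (h1 : Asy Inc a b s t) (h2 : Asy Inc b c t u) :
    ∃ g R S T, Inc R a ∧ Inc S b ∧ Inc T c ∧ Inc R g ∧ Inc S g ∧ Inc T g := by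
  obtain ⟨R, hR⟩ := h.A2 a
  obtain ⟨S, hS⟩ := h.A2 b
  obtain ⟨T, hT⟩ := h.A2 c
  have hRS := h1.ne_points hR hS
  have hST := h2.ne_points hS hT
  obtain ⟨n, hRn, hSn⟩ := h.exists_line hRS
  obtain ⟨m, hSm, hTm⟩ := h.exists_line hST
  by_cases hnm : n = m
  · subst hnm
    exact ⟨n, R, S, T, hR, hS, hT, hRn, hSn, hTm⟩
  have hnb : n ≠ b := by rintro rfl; exact h1.1 ⟨R, hR, hRn⟩
  have hmb : m ≠ b := by rintro rfl; exact h2.1 ⟨T, hTm, hT⟩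
  have hRb : ¬ Inc R b := fun e => h1.1 ⟨R, hR, e⟩
  have hTb : ¬ Inc T b := fun e => h2.1 ⟨T, e, hT⟩
  by_cases hs : side Inc b R ↔ side Inc b T
  · obtain ⟨X, hX, hXR, d1⟩ := exists_dir h hR s
    obtain ⟨Y, hY, hYS, d2⟩ := exists_dir h hS t
    obtain ⟨Z, hZ, hZT, d3⟩ := exists_dir h hT u
    obtain ⟨-, l1, -⟩ := h1.2 R S hR hS X Y hX hXR d1 hY hYS d2
    obtain ⟨l2, -, -⟩ := h2.2 S T hS hT Y Z hY hYS d2 hZ hZT d3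
    have t := three_lines h hS hSn hSm hnb.symm hmb.symm hnm hY hRn hTm hYS hRS hST.symm
    by_cases hc : side Inc n Y ↔ side Inc n T
    · obtain ⟨R', h3, h4⟩ := l1.2.2.2.2.2 n m T hSn hRn hSm hTm
        (h.off hnm hSn hSm hTm hST.symm) hTb hc hs
      exact ⟨m, R', S, T, h4, hS, hT, h3, hSm, hTm⟩
    · obtain ⟨T', h3, h4⟩ := l2.2.2.2.2.2 m n R hSm hTm hSn hRn
        (h.off (Ne.symm hnm) hSm hSn hRn hRS) hRb (by grind only) hs.symm
      exact ⟨n, R, S, T', hR, hS, h4, hRn, hSn, h3⟩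
  · have hRT : R ≠ T := by rintro rfl; exact hs Iff.rfl
    obtain ⟨g, hRg, hTg⟩ := h.exists_line hRT
    obtain ⟨N, h3, h4, -⟩ := meets_of_side h hRg hTg hRb hTb hs
    exact ⟨g, R, N, T, hR, h3, hT, hRg, h4, hTg⟩

/-- On a transversal one of the three points is in the middle; `Asy.compose` treats a middle point
on `b`, `Lim.of_between` the other two orders. -/
theorem Asy.trans (h : Axioms Inc) {a b c : L} {s t u : Prop}
    (h1 : Asy Inc a b s t) (h2 : Asy Inc b c t u) (hne : a ≠ c) : Asy Inc a c s u := by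
  have hac : ¬ Meets Inc a c := fun ⟨Q, hQa, hQc⟩ => hne (h1.unique h h2.symm hQa hQc)
  obtain ⟨g, R, S, T, hR, hS, hT, hRg, hSg, hTg⟩ := h1.exists_transversal h h2
  have hRS := h1.ne_points hR hS
  have hST := h2.ne_points hS hT
  have hRT : R ≠ T := by rintro rfl; exact hac ⟨R, hR, hT⟩
  obtain ⟨X, hX, hXR, d1⟩ := exists_dir h hR s
  obtain ⟨Y, hY, hYS, d2⟩ := exists_dir h hS t
  obtain ⟨Z, hZ, hZT, d3⟩ := exists_dir h hT u
  obtain ⟨l1, -, s1⟩ := h1.2 R S hR hS X Y hX hXR d1 hY hYS d2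
  obtain ⟨-, l2, s2⟩ := h2.2 S T hS hT Y Z hY hYS d2 hZ hZT d3
  have s3 := (s1 g hRg hSg).trans (s2 g hSg hTg)
  rcases h.btw_cases hRS hST hRT hRg hSg hTg with hb | hb | hb
  · have := asy_of_lim h (l2.of_between h hR hac h1.1 hTg hRg hb.symm) hX hXR hTg hRg s3.symm
    rw [propext d1, propext d3] at this
    exact this.symm
  · exact h1.compose h h2 hac hR hS hT hRg hSg hb
  · have := asy_of_lim h (l1.of_between h hT (fun e => hac e.symm) (fun e => h2.1 e.symm)
      hRg hTg hb) hZ hZT hRg hTg s3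
    rwa [propext d1, propext d3] at this

/-- A line which enters an asymptotic triangle leaves it. -/
theorem Asy.pasch (h : Axioms Inc) {a b g : L} {s t : Prop} {R S N : P} (h1 : Asy Inc a b s t)
    (hR : Inc R a) (hS : Inc S b) (hN : Inc N g) (hb : Between Inc R N S) (hRg : ¬ Inc R g) :
    (∃ M, Inc M g ∧ Inc M a ∧ M ≠ R ∧ (dir Inc a R M ↔ s)) ∨
    (∃ M, Inc M g ∧ Inc M b ∧ M ≠ S ∧ (dir Inc b S M ↔ t)) ∨ ∃ u, Asy Inc g a u s := by
  obtain ⟨n, hRn, hNn, hSn⟩ := hb.2.2.2.1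
  have hna : n ≠ a := by rintro rfl; exact h1.1 ⟨S, hSn, hS⟩
  have hnb : n ≠ b := by rintro rfl; exact h1.1 ⟨R, hR, hRn⟩
  have hSg : ¬ Inc S g := fun e => hRg (hb.on_left h hN e)
  have hNa : ¬ Inc N a := h.off hna.symm hR hRn hNn hb.1.symm
  have hNb : ¬ Inc N b := h.off hnb.symm hS hSn hNn hb.2.1
  -- The line `k` from `N` to the common end divides the asymptotic triangle into two. Unless `g` is
  -- `k`, it enters one half, and the limiting property of `k` makes it meet the side there.
  obtain ⟨k, u, hNk, h2⟩ := exists_asy h hNa s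
  by_cases hkg : k = g
  · exact .inr (.inr ⟨u, hkg ▸ h2⟩)
  have hkb : k ≠ b := by rintro rfl; exact hNb hNk
  have h3 := h2.trans h h1 hkb
  obtain ⟨X, hX, hXR, d1⟩ := exists_dir h hR s
  obtain ⟨Y, hY, hYS, d2⟩ := exists_dir h hS t
  obtain ⟨K, hK, hKN, d3⟩ := exists_dir h hNk u
  have hXn : ¬ Inc X n := h.off hna hRn hR hX hXR
  have hgn : g ≠ n := by rintro rfl; exact hRg hRn
  have hkn : k ≠ n := by rintro rfl; exact h2.1 ⟨R, hRn, hR⟩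
  obtain ⟨V, hVg, hVn, s1⟩ := h.exists_same_side hN hNn hgn hXn
  have hVN : V ≠ N := by rintro rfl; exact hVn hNn
  have hRk : ¬ Inc R k := fun e => h2.1 ⟨R, e, hR⟩
  have hSk : ¬ Inc S k := fun e => h3.1 ⟨S, e, hS⟩
  have hVk : ¬ Inc V k := h.off hkg hNk hN hVg hVN
  have s2 := (btw_iff h hRk hSk hNk hRn hNn hSn).1 hb
  obtain ⟨l1, -, s3⟩ := h2.2 N R hNk hR K X hK hKN d3 hX hXR d1
  obtain ⟨l2, -, s4⟩ := h3.2 N S hNk hS K Y hK hKN d3 hY hYS d2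
  have s3 := s3 n hNn hRn
  have s4 := s4 n hNn hSn
  have key : ∀ a R M, Inc R a → Inc M a → ¬ Meets Inc k a → Inc M g →
      (side Inc k R ↔ side Inc k V) → (side Inc n M ↔ side Inc n V) := by
    intro a R M hR hM hka hMg hs
    have hMN : M ≠ N := by rintro rfl; exact hka ⟨M, hNk, hM⟩
    have := side_indep h hNk hNn hN hMg hVg hMN hVN hkg hgn.symm
    have := side_of_miss h (fun e => hka e.symm) hR hM
    grind only
  by_cases hc : side Inc k R ↔ side Inc k V
  · left
    obtain ⟨M, hMg, hMa⟩ := l1.2.2.2.2.2 n g V hNn hRn hN hVg hVn hVk (by grind only) hc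
    have hMR : M ≠ R := by rintro rfl; exact hRg hMg
    have e := dir_iff_side h hRn hna hR hX hMa hXR hMR
    have := key a R M hR hMa h2.1 hMg hc
    exact ⟨M, hMg, hMa, hMR, by grind only⟩
  · right; left
    have hc' : side Inc k S ↔ side Inc k V := by grind only
    obtain ⟨M, hMg, hMb⟩ := l2.2.2.2.2.2 n g V hNn hSn hN hVg hVn hVk (by grind only) hc'
    have hMS : M ≠ S := by rintro rfl; exact hSg hMg
    have e := dir_iff_side h hSn hnb hS hY hMb hYS hMS
    have := key b S M hS hMb h3.1 hMg hc'
    exact ⟨M, hMg, hMb, hMS, by grind only⟩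

end Pencils
end HypInc


namespace HypInc

/-! ### Parallel rays are rays towards a common end. -/

section ParallelRays

variable {P L : Type*} {Inc : P → L → Prop}

theorem dir_of_btw (h : Axioms Inc) {a : L} {R A B : P} (hb : Between Inc R A B) (hR : Inc R a)
    (hA : Inc A a) : dir Inc a R A ↔ dir Inc a R B := by
  obtain ⟨n, hn, hna, -⟩ := h.exists_third_line R a a
  have hB := hb.on_right h hR hA
  exact (dir_iff_side h hn hna hR hA hB hb.1.symm hb.2.2.1.symm).2
    (hb.side h hn (h.off hna hn hR hA hb.1.symm)).2

theorem mem_ray_iff_dir (h : Axioms Inc) {a : L} {R X Y : P} (hR : Inc R a) (hX : Inc X a)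
    (hXR : X ≠ R) :
    Y ∈ ray Inc R X ↔ Inc Y a ∧ (Y = R ∨ Y ≠ R ∧ (dir Inc a R X ↔ dir Inc a R Y)) := by
  obtain ⟨n, hn, hna, -⟩ := h.exists_third_line R a a
  have hXn := h.off hna hn hR hX hXR
  rw [mem_ray_iff h hn hR hX hXn]
  refine and_congr_right fun hY => or_congr_right ?_
  constructor
  · rintro ⟨h1, h2⟩
    have hYR : Y ≠ R := by rintro rfl; exact h1 hn
    exact ⟨hYR, (dir_iff_side h hn hna hR hX hY hXR hYR).2 h2⟩
  · rintro ⟨h1, h2⟩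
    exact ⟨h.off hna hn hR hY h1, (dir_iff_side h hn hna hR hX hY hXR h1).1 h2⟩

theorem segment_subset (h : Axioms Inc) {R S Z : P} {l : L} (hR : Inc R l) (hS : Inc S l)
    (hZ : Z ∈ segment Inc R S) : Inc Z l := by
  rcases hZ with rfl | rfl | hb
  · exact hR
  · exact hS
  · exact hb.on_mid h hR hS

theorem segment_symm {R S Z : P} (hZ : Z ∈ segment Inc R S) : Z ∈ segment Inc S R := by
  rcases hZ with rfl | rfl | hb
  · exact .inr (.inl rfl)
  · exact .inl rfl
  · exact .inr (.inr hb.symm)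

theorem ParRays.symm {R X S Y : P} (h1 : ParRays Inc R X S Y) : ParRays Inc S Y R X := by
  obtain ⟨h1, h2, h3, h4⟩ := h1
  have sw : ∀ g, MeetsSet Inc g (segment Inc R S) → MeetsSet Inc g (segment Inc S R) :=
    fun g ⟨Z, hZ, hg⟩ => ⟨Z, segment_symm hZ, hg⟩
  exact ⟨h2, h1, fun ⟨l, a, b, c, d⟩ => h3 ⟨l, c, d, a, b⟩, fun g =>
    ⟨fun e => ((h4 g).2 e).imp_right (sw g), fun e => ((h4 g).1 e).imp_right (sw g)⟩⟩

theorem ParRays.off (h : Axioms Inc) {b : L} {R X S Y : P} (h1 : ParRays Inc R X S Y)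
    (hS : Inc S b) (hY : Inc Y b) : ¬ Inc R b := by
  intro hRb
  obtain ⟨hRX, hSY, hn, hg⟩ := h1
  have hXb : ¬ Inc X b := fun e => hn ⟨b, hRb, e, hS, hY⟩
  obtain ⟨u, -, hXu, hub⟩ := h.exists_ne_miss hXb b
  rcases (hg u).1 ⟨X, .inr (.inl rfl), hXu⟩ with ⟨Z, hZ, hZu⟩ | ⟨Z, hZ, hZu⟩
  · exact hub ⟨Z, hZu, ((mem_ray_iff_dir h hS hY hSY.symm).1 hZ).1⟩
  · exact hub ⟨Z, hZu, segment_subset h hRb hS hZ⟩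

/-- Compare `a` with the limiting line `a'` through `R` on the same side. If the ray enters the
angle between `a'` and `RS`, it crosses `b`, and a line missing `b` through a point beyond the
crossing violates parallelism. If it leaves `a'` on the far side, a line through `X` missing `a'`
does. -/
theorem asy_of_parRays (h : Axioms Inc) {a b : L} {R X S Y : P} (h1 : ParRays Inc R X S Y)
    (hR : Inc R a) (hX : Inc X a) (hS : Inc S b) (hY : Inc Y b) :
    Asy Inc a b (dir Inc a R X) (dir Inc b S Y) := by
  have hRb := h1.off h hS hY
  have hSa := h1.symm.off h hR hX
  obtain ⟨hRX, hSY, -, hg⟩ := h1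
  have hRS : R ≠ S := by rintro rfl; exact hRb hS
  obtain ⟨n, hRn, hSn⟩ := h.exists_line hRS
  have hna : n ≠ a := by rintro rfl; exact hSa hSn
  have hnb : n ≠ b := by rintro rfl; exact hRb hRn
  have hXn : ¬ Inc X n := h.off hna hRn hR hX hRX.symm
  have hYn : ¬ Inc Y n := h.off hnb hSn hS hY hSY.symm
  have raySY : ∀ Z, Z ∈ ray Inc S Y → Inc Z b := fun Z hZ =>
    ((mem_ray_iff_dir h hS hY hSY.symm).1 hZ).1
  have hs : side Inc n X ↔ side Inc n Y := by
    obtain ⟨u, -, hXu, hun⟩ := h.exists_ne_miss hXn n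
    rcases (hg u).1 ⟨X, .inr (.inl rfl), hXu⟩ with ⟨Z, hZ, hZu⟩ | ⟨Z, hZ, hZu⟩
    · rcases ((mem_ray_iff h hSn hS hY hYn).1 hZ).2 with rfl | ⟨-, h3⟩
      · exact absurd ⟨Z, hZu, hSn⟩ hun
      · exact (side_of_miss h hun hXu hZu).trans h3.symm
    · exact absurd ⟨Z, hZu, segment_subset h hRn hSn hZ⟩ hun
  obtain ⟨a', X', -, -, l, -, s1, -⟩ := exists_lim h X hRb hS hRn hSn
  by_cases haa : a = a'
  · subst haa
    have hXR' := l.2.2.2.2.1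
    have e := dir_iff_side h hRn hna hR l.2.1 hX hXR' hRX.symm
    exact asy_of_lim h (l.congr h hX hRX.symm (e.2 s1)) hY hSY.symm hRn hSn hs
  exfalso
  have hRa' := l.1
  have hab' := l.2.2.2.1
  have hXa' : ¬ Inc X a' := h.off (Ne.symm haa) hRa' hR hX hRX.symm
  by_cases hc : side Inc a' S ↔ side Inc a' X
  · obtain ⟨Q, hQa, hQb⟩ := l.2.2.2.2.2 n a X hRn hSn hR hX hXn hXa' s1 hc
    have hQR : Q ≠ R := by rintro rfl; exact hRb hQb
    have s2 := side_of_miss h (fun e => hab' e.symm) hS hQb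
    have s3 := side_indep h hRa' hRn hR hQa hX hQR hRX.symm (Ne.symm haa) hna
    have hQn := h.off hna hRn hR hQa hQR
    obtain ⟨X₁, hb⟩ := h.extend hQR.symm
    have hX₁ := hb.on_right h hR hQa
    have s4 := hb.side h hRn hQn
    have hX₁b : ¬ Inc X₁ b := fun e => hRb (hb.on_left h hQb e)
    have s5 := (btw_iff h hRb hX₁b hQb hR hQa hX₁).1 hb
    obtain ⟨u, -, hXu, hub⟩ := h.exists_ne_miss hX₁b b
    have hm : X₁ ∈ ray Inc R X := (mem_ray_iff h hRn hR hX hXn).2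
      ⟨hX₁, .inr ⟨s4.1, by grind only⟩⟩
    rcases (hg u).1 ⟨X₁, hm, hXu⟩ with ⟨Z, hZ, hZu⟩ | ⟨Z, hZ, hZu⟩
    · exact hub ⟨Z, hZu, raySY Z hZ⟩
    · have s6 := side_of_miss h hub hXu hZu
      rcases hZ with rfl | rfl | hb'
      · grind only
      · exact hub ⟨Z, hZu, hS⟩
      · have s7 := (hb'.symm.side h hS fun e => hub ⟨Z, hZu, e⟩).2
        grind only
  · obtain ⟨u, -, hXu, hua⟩ := h.exists_ne_miss hXa' a'
    rcases (hg u).1 ⟨X, .inr (.inl rfl), hXu⟩ with ⟨Z, hZ, hZu⟩ | ⟨Z, hZ, hZu⟩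
    · have s2 := side_of_miss h (fun e => hab' e.symm) hS (raySY Z hZ)
      have s3 := side_of_miss h hua hXu hZu
      grind only
    · have s3 := side_of_miss h hua hXu hZu
      rcases hZ with rfl | rfl | hb'
      · exact hua ⟨Z, hZu, hRa'⟩
      · grind only
      · have s7 := (hb'.side h hRa' fun e => hua ⟨Z, hZu, e⟩).2
        grind only

/-- A line that crosses the ray at `G` but avoids the segment `RS` separates `S` from a point `X'`
beyond `G`. It thus enters the asymptotic triangle based on `X'S`, and `Asy.pasch` leaves only an
exit through the other ray. -/
theorem Asy.meets_ray (h : Axioms Inc) {a b g : L} {R X S Y : P} 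
    (h1 : Asy Inc a b (dir Inc a R X) (dir Inc b S Y)) (hR : Inc R a) (hX : Inc X a)
    (hXR : X ≠ R) (hS : Inc S b) (hY : Inc Y b) (hYS : Y ≠ S)
    (hg : MeetsSet Inc g (ray Inc R X)) :
    MeetsSet Inc g (ray Inc S Y) ∨ MeetsSet Inc g (segment Inc R S) := by
  by_contra! hno
  obtain ⟨h2, h3⟩ := hno
  obtain ⟨G, hG, hGg⟩ := hg
  obtain ⟨hGa, h4⟩ := (mem_ray_iff_dir h hR hX hXR).1 hG
  have hRg : ¬ Inc R g := fun e => h3 ⟨R, .inl rfl, e⟩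
  have hSg : ¬ Inc S g := fun e => h3 ⟨S, .inr (.inl rfl), e⟩
  have hRS := h1.ne_points hR hS
  obtain ⟨n, hRn, hSn⟩ := h.exists_line hRS
  obtain ⟨hGR, d1⟩ := h4.resolve_left (by rintro rfl; exact hRg hGg)
  have s1 : side Inc g R ↔ side Inc g S := by
    by_contra hc
    obtain ⟨N, h5, -, hb⟩ := meets_of_side h hRn hSn hRg hSg hc
    exact h3 ⟨N, .inr (.inr hb), h5⟩
  obtain ⟨X', hb⟩ := h.extend hGR.symm
  have hX' := hb.on_right h hR hGa
  have hXg' : ¬ Inc X' g := fun e => hRg (hb.on_left h hGg e)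
  have s2 := (btw_iff h hRg hXg' hGg hR hGa hX').1 hb
  obtain ⟨m, hXm, hSm⟩ := h.exists_line (h1.ne_points hX' hS)
  obtain ⟨N, hN, -, hb'⟩ := meets_of_side h hXm hSm hXg' hSg (by grind only)
  rcases h1.pasch h hX' hS hN hb' hXg' with ⟨M, h5, h6, h7, h8⟩ | ⟨M, h5, h6, h7, h8⟩ | ⟨u, h5⟩
  · have : M = G := h.pt_eq (l := g) (m := a) (by rintro rfl; exact hRg hR) h5 h6 hGg hGa
    subst this
    have d2 := dir_of_btw h hb hR hGa
    have d3 := dir_of_btw h hb.symm hX' hGa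
    have d4 := dir_flip h hR hX' hb.2.2.1.symm
    grind only
  · exact h2 ⟨M, (mem_ray_iff_dir h hS hY hYS).2 ⟨h6, .inr ⟨h7, h8.symm⟩⟩, h5⟩
  · exact h5.1 ⟨G, hGg, hGa⟩

theorem parRays_of_asy (h : Axioms Inc) {a b : L} {R X S Y : P}
    (h1 : Asy Inc a b (dir Inc a R X) (dir Inc b S Y)) (hR : Inc R a) (hX : Inc X a)
    (hXR : X ≠ R) (hS : Inc S b) (hY : Inc Y b) (hYS : Y ≠ S) : ParRays Inc R X S Y := by
  refine ⟨hXR.symm, hYS.symm, ?_, fun g => ⟨h1.meets_ray h hR hX hXR hS hY hYS, fun hg => ?_⟩⟩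
  · rintro ⟨l, h2, h3, h4, h5⟩
    have e1 := h.line_eq hXR h3 h2 hX hR
    exact h1.1 ⟨S, e1 ▸ h4, hS⟩
  · exact (h1.symm.meets_ray h hS hY hYS hR hX hXR hg).imp_right
      fun ⟨Z, hZ, hZg⟩ => ⟨Z, segment_symm hZ, hZg⟩

theorem par_iff (h : Axioms Inc) {a b : L} : Par Inc a b ↔ ∃ s t, Asy Inc a b s t := by
  constructor
  · rintro ⟨R, X, S, Y, hR, hX, hS, hY, hp⟩
    exact ⟨_, _, asy_of_parRays h hp hR hX hS hY⟩
  · rintro ⟨s, t, h1⟩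
    obtain ⟨R, hR⟩ := h.A2 a
    obtain ⟨S, hS⟩ := h.A2 b
    obtain ⟨X, hX, hXR, d1⟩ := exists_dir h hR s
    obtain ⟨Y, hY, hYS, d2⟩ := exists_dir h hS t
    rw [← propext d1, ← propext d2] at h1
    exact ⟨R, X, S, Y, hR, hX, hS, hY, parRays_of_asy h h1 hR hX hXR hS hY hYS⟩

/-- Two ends of different lines are on a common line. -/
theorem exists_joining (h : Axioms Inc) {a b : L} (s t : Prop) (hab : a ≠ b) :
    ∃ l, (l = a ∨ ∃ u, Asy Inc a l s u) ∧ (l = b ∨ ∃ u, Asy Inc b l t u) := by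
  obtain ⟨R, hR⟩ := h.A2 a
  obtain ⟨S, hS⟩ := h.A2 b
  obtain ⟨X, hX, hXR, d1⟩ := exists_dir h hR s
  obtain ⟨Y, hY, hYS, d2⟩ := exists_dir h hS t
  have wide : ∀ a R X s l, Inc R a → Inc X a → X ≠ R → (dir Inc a R X ↔ s) →
      RayParWide Inc R X l → (l = a ∨ ∃ u, Asy Inc a l s u) := by
    rintro a R X s l hR hX hXR d (⟨h1, h2⟩ | ⟨R', X', S, Y, h1, hS, hY, h2⟩)
    · exact .inl (h.line_eq hXR h2 h1 hX hR)
    · right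
      have hm : ∀ Z, Z ∈ ray Inc R' X' → _ := fun Z hZ =>
        (mem_ray_iff_dir h hR hX hXR).1 (h1 hZ)
      have hRa' := (hm R' (.inl rfl)).1
      have hXa' := (hm X' (.inr (.inl rfl))).1
      have h3 := asy_of_parRays h h2 hRa' hXa' hS hY
      have key : dir Inc a R' X' ↔ s := by
        rw [← d]
        -- A ray contained in another one has the same direction: otherwise its points beyond `R`
        -- would lie outside the larger ray.
        by_cases hRR : R' = R
        · subst hRR
          exact ((hm X' (.inr (.inl rfl))).2.resolve_left h2.1.symm).2.symm
        have d3 := ((hm R' (.inl rfl)).2.resolve_left hRR).2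
        have d4 := dir_flip h hR hRa' hRR
        by_contra hc
        have d5 : dir Inc a R' R ↔ dir Inc a R' X' := by grind only
        obtain ⟨Z, hb⟩ := h.extend hRR
        have hZ := hb.on_right h hRa' hR
        have hZ1 : Z ∈ ray Inc R' X' := (mem_ray_iff_dir h hRa' hXa' h2.1.symm).2
          ⟨hZ, .inr ⟨hb.2.2.1.symm, d5.symm.trans (dir_of_btw h hb hRa' hR)⟩⟩
        have d6 := ((hm Z hZ1).2.resolve_left hb.2.1.symm).2
        obtain ⟨n, hn, hna, -⟩ := h.exists_third_line R a a
        have d7 := (dir_iff_side h hn hna hR hRa' hZ hRR hb.2.1.symm).1 (by grind only)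
        exact (btw_iff h (h.off hna hn hR hRa' hRR) (h.off hna hn hR hZ hb.2.1.symm) hn hRa'
          hR hZ).1 hb d7
      rw [propext key] at h3
      exact ⟨_, h3⟩
  obtain ⟨l, h1, h2⟩ := h.A6 R X S Y hXR.symm hYS.symm (by
    rintro ⟨l, h1, h2, h3, h4⟩
    exact hab ((h.line_eq hXR hX hR h2 h1).trans (h.line_eq hYS h4 h3 hY hS)))
  exact ⟨l, wide a R X s l hR hX hXR d1 h1, wide b S Y t l hS hY hYS d2 h2⟩

end ParallelRays
end HypInc


namespace HypInc

/-! ### Rimpoints as ends of lines, and their sides. -/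

section Rims

variable {P L : Type*} {Inc : P → L → Prop}

variable (Inc) in
/-- The lines through the end of `a` in the direction `s`. -/
def pen (a : L) (s : Prop) : Set L := {l | l = a ∨ ∃ t, Asy Inc a l s t}

theorem pen_eq_of_asy (h : Axioms Inc) {a b : L} {s t : Prop} (h1 : Asy Inc a b s t) :
    pen Inc a s = pen Inc b t := by
  have key : ∀ a b s t, Asy Inc a b s t → pen Inc a s ⊆ pen Inc b t := by
    rintro a b s t h1 l (rfl | ⟨u, h2⟩)
    · exact .inr ⟨s, h1.symm⟩
    · by_cases hbl : b = l
      · exact .inl hbl.symm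
      · exact .inr ⟨u, h1.symm.trans h h2 hbl⟩
  exact (key a b s t h1).antisymm (key b a t s h1.symm)

theorem mem_pen_self (a : L) (s : Prop) : a ∈ pen Inc a s := .inl rfl

theorem exists_pen_eq (h : Axioms Inc) {a l : L} {s : Prop} (hl : l ∈ pen Inc a s) :
    ∃ t, pen Inc a s = pen Inc l t := by
  rcases hl with rfl | ⟨t, h1⟩
  · exact ⟨s, rfl⟩
  · exact ⟨t, pen_eq_of_asy h h1⟩

theorem exists_asy_line (h : Axioms Inc) (a : L) (s : Prop) : ∃ b t, Asy Inc a b s t := by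
  obtain ⟨R, hR⟩ := h.exists_not_on a
  obtain ⟨k, u, -, h1⟩ := exists_asy h hR s
  exact ⟨k, u, h1.symm⟩

/-- Membership in the pencil only shows that some end of `b` agrees with the end of `a`. A third
line of the pencil, to which `Asy.functional` applies, identifies that end as `t`. -/
theorem asy_of_pen_eq (h : Axioms Inc) {a b : L} {s t : Prop} (hab : a ≠ b)
    (he : pen Inc a s = pen Inc b t) : Asy Inc a b s t := by
  obtain ⟨t', h1⟩ : ∃ t', Asy Inc a b s t' :=
    (show b ∈ pen Inc a s from he ▸ mem_pen_self b t).resolve_left (Ne.symm hab)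
  have h2 := (pen_eq_of_asy h h1).symm.trans he
  obtain ⟨c, u, h3⟩ := exists_asy_line h b t'
  obtain ⟨v, h4⟩ : ∃ v, Asy Inc b c t v :=
    (show c ∈ pen Inc b t from h2 ▸ .inr ⟨u, h3⟩).resolve_left (h3.ne h).symm
  rwa [propext (h3.functional h h4).1] at h1

theorem pen_inj (h : Axioms Inc) {a : L} {s t : Prop} (he : pen Inc a s = pen Inc a t) :
    s ↔ t := by
  obtain ⟨c, u, h3⟩ := exists_asy_line h a s
  obtain ⟨v, h4⟩ : ∃ v, Asy Inc a c t v :=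
    (show c ∈ pen Inc a t from he ▸ .inr ⟨u, h3⟩).resolve_left (h3.ne h).symm
  exact (h3.functional h h4).1

/-- The line `b` enters the asymptotic triangle through `S` and cannot leave it through `a` or `c`,
so it goes to the common end. -/
theorem Asy.mid (h : Axioms Inc) {a b c : L} {s t : Prop} {R S T : P} (h1 : Asy Inc a c s t)
    (hR : Inc R a) (hS : Inc S b) (hT : Inc T c)
    (hba : ¬ Meets Inc b a) (hbc : ¬ Meets Inc b c) (hb : Between Inc R S T) :
    ∃ u, Asy Inc b a u s := by
  rcases h1.pasch h hR hT hS hb (fun e => hba ⟨R, e, hR⟩) with ⟨M, h2, h3, -⟩ | ⟨M, h2, h3, -⟩ | h2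
  · exact absurd ⟨M, h2, h3⟩ hba
  · exact absurd ⟨M, h2, h3⟩ hbc
  · exact h2

/-- The transversal in the definition excludes the third side of an ideal triangle: of three lines
cut by a transversal the middle one goes to the common end of the outer two (`Asy.mid`), so all
three share one end. -/
theorem pairOn_iff (h : Axioms Inc) {a b l : L} {s t : Prop} (h1 : Asy Inc a b s t) :
    PairOn Inc a b l ↔ l ∈ pen Inc a s := by
  constructor
  · rintro (rfl | rfl | ⟨h2, h3, g, ⟨R, hRg, hR⟩, ⟨S, hSg, hS⟩, ⟨T, hTg, hT⟩⟩)
    · exact .inl rfl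
    · exact .inr ⟨t, h1⟩
    · obtain ⟨u, v, h2⟩ := (par_iff h).1 h2
      obtain ⟨u', v', h3⟩ := (par_iff h).1 h3
      by_cases c1 : v ↔ s
      · exact .inr ⟨u, propext c1 ▸ h2.symm⟩
      by_cases c2 : v' ↔ t
      · exact .inr ⟨u', h1.trans h (propext c2 ▸ h3.symm) (h2.ne h).symm⟩
      exfalso
      have mab : ¬ Meets Inc b a := h1.symm.1
      have mal : ¬ Meets Inc a l := h2.symm.1
      have mbl : ¬ Meets Inc b l := h3.symm.1
      rcases h.btw_cases (h1.ne_points hR hS) (h3.symm.ne_points hS hT)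
        (h2.symm.ne_points hR hT) hRg hSg hTg with hb | hb | hb
      · obtain ⟨w, h4⟩ := h3.symm.mid h hS hR hT h1.1 mal hb
        exact c2 (h1.functional h h4).2.symm
      · obtain ⟨w, h4⟩ := h2.symm.mid h hR hS hT mab mbl hb
        exact c1 (h1.functional h h4.symm).1.symm
      · obtain ⟨w, h4⟩ := h1.mid h hR hT hS h2.1 h3.1 hb
        exact c1 (h2.functional h h4).2
  · rintro (rfl | ⟨u, h2⟩)
    · exact .inl rfl
    · by_cases hbl : b = l
      · exact .inr (.inl hbl.symm)
      · obtain ⟨g, S, R, T, hS, hR, hT, hSg, hRg, hTg⟩ := h1.symm.exists_transversal h h2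
        exact .inr (.inr ⟨(par_iff h).2 ⟨_, _, h2.symm⟩,
          (par_iff h).2 ⟨_, _, (h1.symm.trans h h2 hbl).symm⟩,
          g, ⟨R, hRg, hR⟩, ⟨S, hSg, hS⟩, ⟨T, hTg, hT⟩⟩)

/-- The third line required for a rimpoint is the one to the common end through a point between the
two lines. -/
theorem isRimPair_of_asy (h : Axioms Inc) {a b : L} {s t : Prop} (h1 : Asy Inc a b s t) :
    IsRimPair Inc a b := by
  refine ⟨(par_iff h).2 ⟨s, t, h1⟩, ?_⟩
  obtain ⟨R, hR⟩ := h.A2 a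
  obtain ⟨S, hS⟩ := h.A2 b
  obtain ⟨N, hb⟩ := h.dense (h1.ne_points hR hS)
  have hNa : ¬ Inc N a := fun e => h1.1 ⟨S, hb.on_right h hR e, hS⟩
  have hNb : ¬ Inc N b := fun e => h1.1 ⟨R, hR, hb.on_left h e hS⟩
  obtain ⟨k, u, hNk, h2⟩ := exists_asy h hNa s
  have hkb : k ≠ b := by rintro rfl; exact hNb hNk
  obtain ⟨g, S, R, T, hS, hR, hT, hSg, hRg, hTg⟩ := h1.symm.exists_transversal h h2.symm
  exact ⟨k, (par_iff h).2 ⟨_, _, h2⟩, (par_iff h).2 ⟨_, _, h2.trans h h1 hkb⟩,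
    g, ⟨R, hRg, hR⟩, ⟨S, hSg, hS⟩, ⟨T, hTg, hT⟩⟩

/-- The rimpoint of `a` in the direction `s`. -/
def rim (h : Axioms Inc) (a : L) (s : Prop) : Rim Inc := ⟨pen Inc a s, by
  obtain ⟨b, t, h1⟩ := exists_asy_line h a s
  exact ⟨a, b, isRimPair_of_asy h h1, Set.ext fun l => (pairOn_iff h h1).symm⟩⟩

theorem rim_on (h : Axioms Inc) (a : L) (s : Prop) : (rim h a s).On a := mem_pen_self a s

theorem Rim.exists_eq (h : Axioms Inc) {A : Rim Inc} {l : L} (hA : A.On l) :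
    ∃ s, A = rim h l s := by
  obtain ⟨S, a, b, h1, rfl⟩ := A
  obtain ⟨s, t, h2⟩ := (par_iff h).1 h1.1
  have he : {l | PairOn Inc a b l} = pen Inc a s := Set.ext fun l => pairOn_iff h h2
  obtain ⟨u, hu⟩ := exists_pen_eq h (show l ∈ pen Inc a s from he ▸ hA)
  exact ⟨u, Subtype.ext (he.trans hu)⟩

theorem Rim.exists_on (A : Rim Inc) : ∃ l, A.On l := by
  obtain ⟨S, a, b, h1, rfl⟩ := A
  exact ⟨a, .inl rfl⟩

theorem rim_inj (h : Axioms Inc) {a : L} {s t : Prop} (he : rim h a s = rim h a t) : s ↔ t :=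
  pen_inj h (congrArg Subtype.val he)

theorem asy_iff_rim (h : Axioms Inc) {a b : L} {s t : Prop} (hab : a ≠ b) :
    Asy Inc a b s t ↔ rim h a s = rim h b t :=
  ⟨fun h1 => Subtype.ext (pen_eq_of_asy h h1), fun e =>
    asy_of_pen_eq h hab (congrArg Subtype.val e)⟩

theorem par_iff_rim (h : Axioms Inc) {a b : L} :
    Par Inc a b ↔ a ≠ b ∧ ∃ A : Rim Inc, A.On a ∧ A.On b := by
  rw [par_iff h]
  constructor
  · rintro ⟨s, t, h1⟩
    exact ⟨h1.ne h, rim h a s, rim_on h a s, (asy_iff_rim h (h1.ne h)).1 h1 ▸ rim_on h b t⟩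
  · rintro ⟨hab, A, hA, hB⟩
    obtain ⟨s, rfl⟩ := Rim.exists_eq h hA
    obtain ⟨t, e⟩ := Rim.exists_eq h hB
    exact ⟨s, t, (asy_iff_rim h hab).2 e⟩

/-- Lines through a rimpoint have no finite point in common. -/
theorem Rim.line_eq (h : Axioms Inc) {A : Rim Inc} {X : P} {a b : L} (hA : A.On a)
    (hB : A.On b) (hXa : Inc X a) (hXb : Inc X b) : a = b := by
  by_contra hab
  obtain ⟨s, rfl⟩ := Rim.exists_eq h hA
  obtain ⟨t, e⟩ := Rim.exists_eq h hB
  exact ((asy_iff_rim h hab).2 e).1 ⟨X, hXa, hXb⟩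

theorem Rim.exists_line (h : Axioms Inc) (A : Rim Inc) (X : P) : ∃ l, Inc X l ∧ A.On l := by
  obtain ⟨b, hb⟩ := A.exists_on
  by_cases hX : Inc X b
  · exact ⟨b, hX, hb⟩
  obtain ⟨t, rfl⟩ := Rim.exists_eq h hb
  obtain ⟨a, s, hXa, h1⟩ := exists_asy h hX t
  exact ⟨a, hXa, (asy_iff_rim h (h1.ne h)).1 h1 ▸ rim_on h a s⟩

theorem Rim.exists_join (h : Axioms Inc) {A B : Rim Inc} (hAB : A ≠ B) :
    ∃ c, A.On c ∧ B.On c := by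
  obtain ⟨a, hA⟩ := A.exists_on
  obtain ⟨X, hX⟩ := h.A2 a
  obtain ⟨b, hXb, hB⟩ := B.exists_line h X
  by_cases hab : a = b
  · exact ⟨a, hA, hab ▸ hB⟩
  obtain ⟨s, rfl⟩ := Rim.exists_eq h hA
  obtain ⟨t, rfl⟩ := Rim.exists_eq h hB
  exact exists_joining h s t hab

theorem Rim.join_unique (h : Axioms Inc) {A B : Rim Inc} {c d : L} (hAB : A ≠ B) (h1 : A.On c)
    (h2 : B.On c) (h3 : A.On d) (h4 : B.On d) : c = d := by
  by_contra hcd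
  obtain ⟨s, rfl⟩ := Rim.exists_eq h h1
  obtain ⟨t, rfl⟩ := Rim.exists_eq h h2
  obtain ⟨u, e1⟩ := Rim.exists_eq h h3
  obtain ⟨v, e2⟩ := Rim.exists_eq h h4
  have := (((asy_iff_rim h hcd).2 e1).functional h ((asy_iff_rim h hcd).2 e2)).1
  exact hAB (by rw [propext this])

theorem Rim.exists_other (h : Axioms Inc) {A : Rim Inc} {l : L} (hA : A.On l) :
    ∃ B : Rim Inc, B ≠ A ∧ B.On l ∧ ∀ C : Rim Inc, C.On l → C = A ∨ C = B := by
  obtain ⟨s, rfl⟩ := Rim.exists_eq h hA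
  refine ⟨rim h l (¬ s), fun e => ?_, rim_on h l _, fun C hC => ?_⟩
  · have := rim_inj h e
    tauto
  · obtain ⟨t, rfl⟩ := Rim.exists_eq h hC
    by_cases hc : t ↔ s
    · exact .inl (by rw [propext hc])
    · exact .inr (by rw [propext (by tauto : t ↔ ¬ s)])

variable (Inc) in
/-- From `R` on, the half-line of `a` in the direction `s` is on one side of `g`. -/
def Tail (g a : L) (s : Prop) (R : P) : Prop :=
  Inc R a ∧ ¬ Inc R g ∧ ∀ X, Inc X a → X ≠ R → (dir Inc a R X ↔ s) →
    ¬ Inc X g ∧ (side Inc g X ↔ side Inc g R)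

theorem tail_of_miss (h : Axioms Inc) {g a : L} (s : Prop) {R : P} (hga : ¬ Meets Inc a g)
    (hR : Inc R a) : Tail Inc g a s R :=
  ⟨hR, fun e => hga ⟨R, hR, e⟩, fun X hX _ _ =>
    ⟨fun e => hga ⟨X, hX, e⟩, side_of_miss h hga hX hR⟩⟩

theorem tail_of_meets (h : Axioms Inc) {g a : L} {s : Prop} {M R : P} (hag : a ≠ g)
    (hMa : Inc M a) (hMg : Inc M g) (hR : Inc R a) (hRM : R ≠ M) (hd : dir Inc a M R ↔ s) :
    Tail Inc g a s R := by
  refine ⟨hR, h.off (Ne.symm hag) hMg hMa hR hRM, fun X hX hXR d => ?_⟩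
  have d1 := dir_flip h hMa hR hRM
  obtain ⟨n, hn, hna, -⟩ := h.exists_third_line R a a
  have hXM : X ≠ M := by rintro rfl; grind only
  have e := dir_iff_side h hn hna hR hMa hX (Ne.symm hRM) hXR
  have hb : Between Inc M R X := (btw_iff h (h.off hna hn hR hMa (Ne.symm hRM))
    (h.off hna hn hR hX hXR) hn hMa hR hX).2 (by grind only)
  have := hb.side h hMg (h.off (Ne.symm hag) hMg hMa hR hRM)
  exact ⟨this.1, this.2.symm⟩

theorem Tail.side_eq_self (h : Axioms Inc) {g a : L} {s : Prop} {R R' : P}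
    (h1 : Tail Inc g a s R) (h2 : Tail Inc g a s R') : side Inc g R ↔ side Inc g R' := by
  by_cases hRR : R' = R
  · rw [hRR]
  have := dir_flip h h1.1 h2.1 hRR
  by_cases hc : dir Inc a R R' ↔ s
  · exact (h1.2.2 R' h2.1 hRR hc).2.symm
  · exact (h2.2.2 R h1.1 (Ne.symm hRR) (by grind only)).2

/-- If `g` separated the tails, it would cross `RS` and, by `Asy.pasch`, leave through one of the
tails or through the common end; all three are excluded. Hence the side of a rimpoint is well
defined. -/
theorem Tail.side_eq (h : Axioms Inc) {g a b : L} {s t : Prop} {R S : P}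
    (h1 : Tail Inc g a s R) (h2 : Tail Inc g b t S) (he : pen Inc a s = pen Inc b t)
    (hg : g ∉ pen Inc a s) : side Inc g R ↔ side Inc g S := by
  by_cases hab : a = b
  · subst hab
    rw [← propext (pen_inj h he)] at h2
    exact h1.side_eq_self h h2
  have h3 := asy_of_pen_eq h hab he
  by_contra hc
  obtain ⟨n, hRn, hSn⟩ := h.exists_line (h3.ne_points h1.1 h2.1)
  obtain ⟨N, hN, -, hb⟩ := meets_of_side h hRn hSn h1.2.1 h2.2.1 hc
  rcases h3.pasch h h1.1 h2.1 hN hb h1.2.1 with ⟨M, h4, h5, h6, h7⟩ | ⟨M, h4, h5, h6, h7⟩ | ⟨u, h4⟩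
  · exact (h1.2.2 M h5 h6 h7).1 h4
  · exact (h2.2.2 M h5 h6 h7).1 h4
  · exact hg (.inr ⟨u, h4.symm⟩)

/-- The side of `g` on which a rimpoint is. -/
def rside (g : L) (A : Rim Inc) : Prop :=
  ∃ a s R, A.val = pen Inc a s ∧ Tail Inc g a s R ∧ side Inc g R

theorem rside_iff (h : Axioms Inc) {g a : L} {s : Prop} {R : P} (h1 : Tail Inc g a s R)
    (hg : ¬ (rim h a s).On g) : rside g (rim h a s) ↔ side Inc g R := by
  constructor
  · rintro ⟨b, t, S, he, h2, h3⟩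
    exact (h1.side_eq h h2 he hg).2 h3
  · exact fun h2 => ⟨a, s, R, rfl, h1, h2⟩

theorem rside_of_miss (h : Axioms Inc) {g a : L} {A : Rim Inc} {R : P} (hA : A.On a)
    (hg : ¬ A.On g) (hm : ¬ Meets Inc a g) (hR : Inc R a) : rside g A ↔ side Inc g R := by
  obtain ⟨s, rfl⟩ := Rim.exists_eq h hA
  exact rside_iff h (tail_of_miss h s hm hR) hg

/-- A chord meets a line if and only if its rimpoints are on different sides. -/
theorem meets_iff_rside (h : Axioms Inc) {g c : L} {A B : Rim Inc} (hAB : A ≠ B) (hA : A.On c)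
    (hB : B.On c) (hAg : ¬ A.On g) (hBg : ¬ B.On g) :
    Meets Inc c g ↔ ¬ (rside g A ↔ rside g B) := by
  by_cases hm : Meets Inc c g
  · refine ⟨fun _ => ?_, fun _ => hm⟩
    obtain ⟨M, hMc, hMg⟩ := hm
    have hcg : c ≠ g := by rintro rfl; exact hAg hA
    obtain ⟨s, rfl⟩ := Rim.exists_eq h hA
    obtain ⟨t, rfl⟩ := Rim.exists_eq h hB
    have hst : ¬ (s ↔ t) := fun e => hAB (by rw [propext e])
    obtain ⟨X, hX, hXM, d1⟩ := exists_dir h hMc s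
    obtain ⟨Y, hY, hYM, d2⟩ := exists_dir h hMc t
    rw [rside_iff h (tail_of_meets h hcg hMc hMg hX hXM d1) hAg,
      rside_iff h (tail_of_meets h hcg hMc hMg hY hYM d2) hBg]
    have := dir_iff_side h hMg (Ne.symm hcg) hMc hX hY hXM hYM
    grind only
  · obtain ⟨R, hR⟩ := h.A2 c
    rw [rside_of_miss h hA hAg hm hR, rside_of_miss h hB hBg hm hR]
    simp [hm]

/-- Of three lines through a rimpoint, exactly one separates the other two. -/
theorem rside_three (h : Axioms Inc) {A B C D : Rim Inc} {b c d : L} (hAb : A.On b) (hAc : A.On c)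
    (hAd : A.On d) (hB : B.On b) (hC : C.On c) (hD : D.On d) (hAB : A ≠ B) (hAC : A ≠ C)
    (hAD : A ≠ D) (hBC : B ≠ C) (hBD : B ≠ D) (hCD : C ≠ D) :
    (¬ (rside b C ↔ rside b D) ∧ (rside c B ↔ rside c D) ∧ (rside d B ↔ rside d C)) ∨
    ((rside b C ↔ rside b D) ∧ ¬ (rside c B ↔ rside c D) ∧ (rside d B ↔ rside d C)) ∨
    ((rside b C ↔ rside b D) ∧ (rside c B ↔ rside c D) ∧ ¬ (rside d B ↔ rside d C)) := by
  have two : ∀ {X Y : Rim Inc} {l : L}, A ≠ X → A ≠ Y → X ≠ Y → A.On l → X.On l → ¬ Y.On l := by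
    intro X Y l h1 h2 h3 h4 h5 h6
    obtain ⟨E, -, -, h9⟩ := Rim.exists_other h h4
    have := h9 X h5
    have := h9 Y h6
    grind
  have hCb := two hAB hAC hBC hAb hB
  have hDb := two hAB hAD hBD hAb hB
  have hBc := two hAC hAB hBC.symm hAc hC
  have hDc := two hAC hAD hCD hAc hC
  have hBd := two hAD hAB hBD.symm hAd hD
  have hCd := two hAD hAC hCD.symm hAd hD
  have hbc : b ≠ c := by rintro rfl; exact hCb hC
  have hcd : c ≠ d := by rintro rfl; exact hDc hD
  have hbd : b ≠ d := by rintro rfl; exact hDb hD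
  obtain ⟨s, rfl⟩ := Rim.exists_eq h hAb
  obtain ⟨t, e1⟩ := Rim.exists_eq h hAc
  obtain ⟨u, e2⟩ := Rim.exists_eq h hAd
  have a1 := (asy_iff_rim h hbc).2 e1
  have a2 := (asy_iff_rim h hcd).2 (e1.symm.trans e2)
  have a3 := (asy_iff_rim h hbd).2 e2
  -- A transversal translates the statement into the fact that exactly one of its three points is
  -- between the others.
  obtain ⟨g, R, S, T, hR, hS, hT, hRg, hSg, hTg⟩ := a1.exists_transversal h a2
  rw [rside_of_miss h hC hCb a1.symm.1 hS, rside_of_miss h hD hDb a3.symm.1 hT,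
    rside_of_miss h hB hBc a1.1 hR, rside_of_miss h hD hDc a2.symm.1 hT,
    rside_of_miss h hB hBd a3.1 hR, rside_of_miss h hC hCd a2.1 hS]
  have hRS := a1.ne_points hR hS
  have hST := a2.ne_points hS hT
  have hRT := a3.ne_points hR hT
  have k1 := btw_iff h (fun e => a1.1 ⟨S, e, hS⟩) (fun e => a3.1 ⟨T, e, hT⟩) hR hSg hRg hTg
  have k2 := btw_iff h (fun e => a1.1 ⟨R, hR, e⟩) (fun e => a2.1 ⟨T, e, hT⟩) hS hRg hSg hTg
  have k3 := btw_iff h (fun e => a3.1 ⟨R, hR, e⟩) (fun e => a2.1 ⟨S, hS, e⟩) hT hRg hTg hSg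
  have := not_btw_and h hRS hST hRT hRg hSg hTg
  grind only

end Rims
end HypInc


namespace HypInc

/-! ### Half-turns as permutations of the rimpoints. -/

section HalfTurns

variable {P L : Type*} {Inc : P → L → Prop}

theorem Rim.eq_or_eq (h : Axioms Inc) {A B C : Rim Inc} {l : L} (hAB : A ≠ B) (hA : A.On l)
    (hB : B.On l) (hC : C.On l) : C = A ∨ C = B := by
  obtain ⟨D, -, -, h3⟩ := Rim.exists_other h hA
  have := h3 B hB
  have := h3 C hC
  grind

theorem ht_exists (h : Axioms Inc) (X : P) (A : Rim Inc) :
    ∃ B : Rim Inc, B ≠ A ∧ ∃ l, Inc X l ∧ A.On l ∧ B.On l := by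
  obtain ⟨l, hX, hA⟩ := A.exists_line h X
  obtain ⟨B, h1, h2, -⟩ := Rim.exists_other h hA
  exact ⟨B, h1, l, hX, hA, h2⟩

theorem ht_exists_unique (h : Axioms Inc) {X : P} {A B C : Rim Inc} {l : L} (hX : Inc X l)
    (hA : A.On l) (hBA : B ≠ A) (hB : ∃ l, Inc X l ∧ A.On l ∧ B.On l) (hCA : C ≠ A)
    (hC : C.On l) : B = C := by
  obtain ⟨m, h1, h2, h3⟩ := hB
  have := Rim.line_eq h hA h2 hX h1
  subst this
  exact ((Rim.eq_or_eq h hBA h3 hA hC).resolve_right hCA).symm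

/-- The half-turn about a point, as a permutation of the rimpoints. -/
noncomputable def ht (h : Axioms Inc) (X : P) : Equiv.Perm (Rim Inc) :=
  Function.Involutive.toPerm (fun A => (ht_exists h X A).choose) fun A => by
    obtain ⟨h1, l, h2, h3, h4⟩ := (ht_exists h X A).choose_spec
    exact ht_exists_unique h h2 h4 (ht_exists h X _).choose_spec.1
      (ht_exists h X _).choose_spec.2 h1.symm h3

theorem ht_spec (h : Axioms Inc) (X : P) (A : Rim Inc) :
    ht h X A ≠ A ∧ ∃ l, Inc X l ∧ A.On l ∧ (ht h X A).On l := (ht_exists h X A).choose_spec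

theorem ht_ne (h : Axioms Inc) (X : P) (A : Rim Inc) : ht h X A ≠ A := (ht_spec h X A).1

theorem ht_eq (h : Axioms Inc) {X : P} {A B : Rim Inc} {l : L} (hX : Inc X l) (hA : A.On l)
    (hB : B.On l) (hAB : A ≠ B) : ht h X A = B :=
  ht_exists_unique h hX hA (ht_spec h X A).1 (ht_spec h X A).2 hAB.symm hB

theorem ht_on (h : Axioms Inc) {X : P} {A : Rim Inc} {l : L} (hX : Inc X l) (hA : A.On l) :
    (ht h X A).On l := by
  obtain ⟨-, m, h1, h2, h3⟩ := ht_spec h X A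
  rwa [Rim.line_eq h hA h2 hX h1]

@[simp] theorem ht_ht (h : Axioms Inc) (X : P) (A : Rim Inc) : ht h X (ht h X A) = A := by
  obtain ⟨h0, m, h1, h2, h3⟩ := ht_spec h X A
  exact ht_eq h h1 h3 h2 h0

@[simp] theorem ht_mul_self (h : Axioms Inc) (X : P) : ht h X * ht h X = 1 :=
  Equiv.ext fun A => ht_ht h X A

@[simp] theorem ht_inv (h : Axioms Inc) (X : P) : (ht h X)⁻¹ = ht h X :=
  inv_eq_of_mul_eq_one_left (ht_mul_self h X)

theorem ht_on_iff (h : Axioms Inc) {X : P} {A : Rim Inc} {l : L} (hX : Inc X l) :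
    (ht h X A).On l ↔ A.On l :=
  ⟨fun e => by simpa using ht_on h hX e, ht_on h hX⟩

/-- A line contains `X` if the half-turn about `X` preserves it. -/
theorem inc_of_ht (h : Axioms Inc) {X : P} {A : Rim Inc} {l : L} (hA : A.On l)
    (hB : (ht h X A).On l) : Inc X l := by
  obtain ⟨h0, m, h1, h2, h3⟩ := ht_spec h X A
  rwa [Rim.join_unique h h0 hB hA h3 h2]

theorem isHalfTurnImage_iff (h : Axioms Inc) {X : P} {A B : Rim Inc} :
    IsHalfTurnImage X A B ↔ ht h X A = B := by
  constructor
  · rintro ⟨h1, k, h2, h3, h4⟩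
    exact ht_eq h h2 h3 h4 h1.symm
  · rintro rfl
    exact ht_spec h X A

theorem ht_ne_ht (h : Axioms Inc) {X Y : P} {A : Rim Inc} {l : L} (hX : Inc X l) (hY : Inc Y l)
    (hXY : X ≠ Y) (hA : ¬ A.On l) : ht h X A ≠ ht h Y A := by
  intro he
  obtain ⟨h0, m, h1, h2, h3⟩ := ht_spec h X A
  have h4 := inc_of_ht h (X := Y) h2 (he ▸ h3)
  exact hA (by rwa [h.line_eq hXY hX hY h1 h4])

theorem ht_injective (h : Axioms Inc) : Function.Injective (ht h) := by
  intro X Y he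
  by_contra hXY
  obtain ⟨l, hX, hY⟩ := h.exists_line hXY
  obtain ⟨m, hm⟩ := h.exists_line_not_on X
  obtain ⟨Z, hZ⟩ := h.exists_not_on l
  have hXZ : X ≠ Z := by rintro rfl; exact hZ hX
  obtain ⟨k, h1, h2⟩ := h.exists_line hXZ
  have hlk : k ≠ l := by rintro rfl; exact hZ h2
  by_cases hA : (rim h k True).On l
  · exact hlk (Rim.line_eq h (rim_on h k True) hA h1 hX)
  · exact ht_ne_ht h hX hY hXY hA (by rw [he])

theorem rside_ht (h : Axioms Inc) {X : P} {A : Rim Inc} {l : L} (hX : Inc X l) (hA : ¬ A.On l) :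
    ¬ (rside l A ↔ rside l (ht h X A)) := by
  obtain ⟨h0, m, h1, h2, h3⟩ := ht_spec h X A
  exact (meets_iff_rside h h0.symm h2 h3 hA (fun e => hA ((ht_on_iff h hX).1 e))).1 ⟨X, h1, hX⟩

/-- Rimpoints on different sides of a line are interchanged by the half-turn about a point
of it. -/
theorem exists_ht (h : Axioms Inc) {A B : Rim Inc} {l : L} (hA : ¬ A.On l) (hB : ¬ B.On l)
    (hs : ¬ (rside l A ↔ rside l B)) : ∃ X, Inc X l ∧ ht h X A = B := by
  have hAB : A ≠ B := by rintro rfl; exact hs Iff.rfl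
  obtain ⟨c, h1, h2⟩ := Rim.exists_join h hAB
  obtain ⟨X, h3, h4⟩ := (meets_iff_rside h hAB h1 h2 hA hB).2 hs
  exact ⟨X, h4, ht_eq h h3 h1 h2 hAB⟩

/-- The line `j` lies wholly on one side of `l`, while the chord `XY`, having both ends on the other
side, does not cross `l` and therefore stays away from `j`. -/
theorem rside_far (h : Axioms Inc) {j l : L} {D X Y : Rim Inc} (hD : D.On j) (hj : ¬ Meets Inc j l)
    (hDl : ¬ D.On l) (hX : ¬ X.On l) (hY : ¬ Y.On l) (hXD : ¬ (rside l X ↔ rside l D))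
    (hYD : ¬ (rside l Y ↔ rside l D)) : rside j X ↔ rside j Y := by
  by_contra hc
  have hXY : X ≠ Y := by rintro rfl; exact hc Iff.rfl
  have off : ∀ X : Rim Inc, ¬ X.On l → ¬ (rside l X ↔ rside l D) → ¬ X.On j := by
    intro X hX hXD e
    obtain ⟨Z, hZ⟩ := h.A2 j
    exact hXD ((rside_of_miss h e hX hj hZ).trans (rside_of_miss h hD hDl hj hZ).symm)
  obtain ⟨c, h1, h2⟩ := Rim.exists_join h hXY
  obtain ⟨Z, h3, h4⟩ := (meets_iff_rside h hXY h1 h2 (off X hX hXD) (off Y hY hYD)).2 hc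
  have hcl : ¬ Meets Inc c l := fun e => by
    have := (meets_iff_rside h hXY h1 h2 hX hY).1 e
    grind only
  have := rside_of_miss h h1 hX hcl h3
  have := rside_of_miss h hD hDl hj h4
  grind only

theorem Rim.miss (h : Axioms Inc) {A : Rim Inc} {a b : L} (hA : A.On a) (hB : A.On b)
    (hab : a ≠ b) : ¬ Meets Inc a b := fun ⟨_, h1, h2⟩ => hab (Rim.line_eq h hA hB h1 h2)

/-- For a point moving along a side of `l`, the direction does not depend on the line used to
measure it. -/
theorem rside_toward (h : Axioms Inc) {l k p : L} {M D F : Rim Inc} (hM : M.On l) (hD : ¬ D.On l)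
    (hF : ¬ F.On l) (hDF : D ≠ F) (hs : rside l D ↔ rside l F) (hDk : D.On k) (hDp : D.On p)
    (hk : Meets Inc k l) (hp : Meets Inc p l) :
    (rside k F ↔ rside k M) ↔ (rside p F ↔ rside p M) := by
  have hMD : M ≠ D := by rintro rfl; exact hD hM
  have hMF : M ≠ F := by rintro rfl; exact hF hM
  obtain ⟨j, hMj, hDj⟩ := Rim.exists_join h hMD
  obtain ⟨f, hDf, hFf⟩ := Rim.exists_join h hDF
  have hjl : ¬ Meets Inc j l := Rim.miss h hMj hM (by rintro rfl; exact hD hDj)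
  have hfl : ¬ Meets Inc f l := fun e => (meets_iff_rside h hDF hDf hFf hD hF).1 e hs
  -- Apply `rside_three` to the lines `j = DM`, `k = DX` and `f = DF`. Since `f` does not meet `l`,
  -- it leaves `M` and `X` on one side, so the side of `k` is governed by the side of `j` on which
  -- `X` lies; by `rside_far` this is the same for all `k`.
  have key : ∀ k, D.On k → Meets Inc k l → ∃ X : Rim Inc, ¬ X.On l ∧ ¬ (rside l X ↔ rside l D) ∧
      ((rside k M ↔ rside k F) ↔ ¬ (rside j X ↔ rside j F)) := by
    rintro k hDk ⟨R, hRk, hRl⟩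
    have hX : ¬ (ht h R D).On l := fun e => hD ((ht_on_iff h hRl).1 e)
    have hXD := rside_ht h hRl hD
    refine ⟨ht h R D, hX, fun e => hXD e.symm, ?_⟩
    have hMX : M ≠ ht h R D := by rintro e; exact hX (e ▸ hM)
    have hXF : ht h R D ≠ F := by rintro e; rw [e] at hXD; exact hXD hs
    have t := rside_three h hDj hDk hDf hMj (ht_on h hRk hDk) hFf hMD.symm (ht_ne h R D).symm hDF
      hMX hMF hXF
    have e : rside f M ↔ rside f (ht h R D) := by
      by_contra hc
      obtain ⟨c, h1, h2⟩ := Rim.exists_join h hMX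
      have hMf : ¬ M.On f := fun e => (Rim.eq_or_eq h hDF hDf hFf e).elim hMD hMF
      have hXf : ¬ (ht h R D).On f := fun e =>
        (Rim.eq_or_eq h hDF hDf hFf e).elim (ht_ne h R D) hXF
      obtain ⟨Z, h3, h4⟩ := (meets_iff_rside h hMX h1 h2 hMf hXf).2 hc
      have hcl : ¬ Meets Inc c l := Rim.miss h h1 hM (by rintro rfl; exact hX h2)
      have := rside_of_miss h h2 hX hcl h3
      have := rside_of_miss h hDf hD hfl h4
      grind only
    grind only
  obtain ⟨X, h1, h2, h3⟩ := key k hDk hk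
  obtain ⟨Y, h4, h5, h6⟩ := key p hDp hp
  have := rside_far h hDj hjl hD h1 h4 h2 h5
  grind only

theorem rside_line (h : Axioms Inc) {l k : L} {s : Prop} {R Q : P} (hRk : Inc R k) (hR : Inc R l)
    (hkl : k ≠ l) (hQ : Inc Q l) (hQR : Q ≠ R) :
    (rside k (rim h l s) ↔ side Inc k Q) ↔ (dir Inc l R Q ↔ s) := by
  obtain ⟨Y, hY, hYR, d⟩ := exists_dir h hR s
  have hk : ¬ (rim h l s).On k := fun e => hkl (Rim.line_eq h e (rim_on h l s) hRk hR)
  rw [rside_iff h (tail_of_meets h (Ne.symm hkl) hR hRk hY hYR d) hk, ← d,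
    ← dir_iff_side h hRk hkl hR hY hQ hYR hQR]
  exact Iff.comm

/-- The direction in which a product of two half-turns moves the rimpoints. -/
theorem rside_ht_ht (h : Axioms Inc) {l p : L} {s : Prop} {Q R : P} {X : Rim Inc} (hR : Inc R l)
    (hQ : Inc Q l) (hQR : Q ≠ R) (hX : ¬ X.On l) (hXp : X.On p) (hp : Meets Inc p l) :
    (rside p (ht h Q (ht h R X)) ↔ rside p (rim h l s)) ↔ (dir Inc l R Q ↔ s) := by
  obtain ⟨h0, k, hRk, hXk, hRXk⟩ := ht_spec h R X
  have hkl : k ≠ l := by rintro rfl; exact hX hXk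
  have hRX : ¬ (ht h R X).On l := fun e => hX ((ht_on_iff h hR).1 e)
  have hF : ¬ (ht h Q (ht h R X)).On l := fun e => hRX ((ht_on_iff h hQ).1 e)
  have hne : X ≠ ht h Q (ht h R X) := fun e =>
    ht_ne_ht h hQ hR hQR hX ((congrArg (ht h Q) e).trans (ht_ht h Q _))
  have s1 := rside_ht h hR hX
  have s2 := rside_ht h hQ hRX
  -- Measure with the line `k` through `X` and `R`. The line through `Q` and the image shares the
  -- rimpoint `ht h R X` with `k`, so it misses `k`, and the image is on the side of `Q`.
  rw [← rside_toward h (rim_on h l s) hX hF hne (by grind only) hXk hXp ⟨R, hRk, hR⟩ hp,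
    ← rside_line h hRk hR hkl hQ hQR]
  obtain ⟨h3, m, hQm, h4, h5⟩ := ht_spec h Q (ht h R X)
  have hQk : ¬ Inc Q k := h.off hkl hRk hR hQ hQR
  have hmk : m ≠ k := by rintro rfl; exact hQk hQm
  have hFk : ¬ (ht h Q (ht h R X)).On k := fun e => hmk (Rim.join_unique h h3 h5 h4 e hRXk)
  rw [rside_of_miss h h5 hFk (Rim.miss h h4 hRXk hmk) hQm]
  exact Iff.comm

end HalfTurns
end HypInc


namespace HypInc

/-! ### Pascal's axiom and the group of translations along a line. -/

section Translations

variable {Pt L : Type*} {Inc : Pt → L → Prop}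

theorem isMeet_ht (h : Axioms Inc) {R : Pt} {A B C D : Rim Inc} (hB : ht h R A = B)
    (hD : ht h R C = D) (hCA : C ≠ A) (hCB : C ≠ B) : IsMeet A B C D R := by
  obtain ⟨h0, c, h1, h2, h3⟩ := ht_spec h R A
  obtain ⟨k0, d, k1, k2, k3⟩ := ht_spec h R C
  subst hB hD
  refine ⟨c, d, ⟨h0.symm, h2, h3⟩, ⟨k0.symm, k2, k3⟩, ?_, h1, k1⟩
  rintro rfl
  exact (Rim.eq_or_eq h h0.symm h2 h3 k2).elim hCA hCB

theorem ht_apply_ne (h : Axioms Inc) {l : L} {P Q : Pt} {A : Rim Inc} (hP : Inc P l) (hQ : Inc Q l)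
    (hPQ : P ≠ Q) (hA : ¬ A.On l) : ht h P (ht h Q A) ≠ A := fun e =>
  ht_ne_ht h hP hQ hPQ hA (by rw [← e, ht_ht, e])

/-- For the hexagon A, B = A^R, C = B^Q, D = C^P, E = D^R, F = E^Q, two pairs of opposite sides meet
in `R` and `Q`. By Pascal the third pair, `CD` and `FA`, meets on `l`, necessarily in `P`; thus the
half-turn about `P` takes F to A. -/
theorem three_ht_sq (h : Axioms Inc) {l : L} {P Q R : Pt} {A : Rim Inc} (hP : Inc P l)
    (hQ : Inc Q l) (hR : Inc R l) (hPQ : P ≠ Q) (hQR : Q ≠ R) (hPR : P ≠ R) (hA : ¬ A.On l) :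
    ht h P (ht h Q (ht h R (ht h P (ht h Q (ht h R A))))) = A := by
  have off : ∀ {X : Pt} {B : Rim Inc}, Inc X l → ¬ B.On l → ¬ (ht h X B).On l := fun hX hB e =>
    hB ((ht_on_iff h hX).1 e)
  obtain ⟨B, hB⟩ : ∃ B, ht h R A = B := ⟨_, rfl⟩
  obtain ⟨C, hC⟩ : ∃ C, ht h Q B = C := ⟨_, rfl⟩
  obtain ⟨D, hD⟩ : ∃ D, ht h P C = D := ⟨_, rfl⟩
  obtain ⟨E, hE⟩ : ∃ E, ht h R D = E := ⟨_, rfl⟩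
  obtain ⟨F, hF⟩ : ∃ F, ht h Q E = F := ⟨_, rfl⟩
  rw [hB, hC, hD, hE, hF]
  have oB : ¬ B.On l := hB ▸ off hR hA
  have oC : ¬ C.On l := hC ▸ off hQ oB
  have oD : ¬ D.On l := hD ▸ off hP oC
  have oE : ¬ E.On l := hE ▸ off hR oD
  have oF : ¬ F.On l := hF ▸ off hQ oE
  have sB := rside_ht h hR hA
  have sC := rside_ht h hQ oB
  have sD := rside_ht h hP oC
  have sE := rside_ht h hR oD
  have sF := rside_ht h hQ oE
  have hAC := ht_apply_ne h hQ hR hQR hA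
  have hBD := ht_apply_ne h hP hQ hPQ oB
  have hCE := ht_apply_ne h hR hP hPR.symm oC
  have hDF := ht_apply_ne h hQ hR hQR oD
  have hAE : E ≠ A := by
    intro e
    apply ht_apply_ne h hP hQ hPQ oB
    rw [hC, hD, ← hB, ← e, ← hE, ht_ht]
  have hBF : F ≠ B := by
    intro e
    apply ht_apply_ne h hR hP hPR.symm oC
    rw [hD, hE, ← hC, ← e, ← hF, ht_ht]
  rw [hB] at hAC sB
  rw [hC] at hAC sC hBD
  rw [hD] at hBD sD hCE
  rw [hE] at hCE sE hDF
  rw [hF] at hDF sF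
  have ne : ∀ {X Y : Rim Inc}, ¬ (rside l X ↔ rside l Y) → X ≠ Y := by
    rintro X Y hs rfl; exact hs Iff.rfl
  have hAB := ne sB
  have hBC := ne sC
  have hCD := ne sD
  have hDE := ne sE
  have hEF := ne sF
  have hAD : A ≠ D := ne (by grind only)
  have hAF : A ≠ F := ne (by grind only)
  have hBE : B ≠ E := ne (by grind only)
  have hCF : C ≠ F := ne (by grind only)
  clear sB sC sD sE sF ne off
  obtain ⟨-, p, hPp, hCp, hDp⟩ := ht_spec h P C
  rw [hD] at hDp
  have hpl : p ≠ l := by rintro rfl; exact oC hCp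
  -- Pascal needs a finite intersection of `CD` and `FA`. Now A arises from C, and F from D, by
  -- opposite translations, so A and F are on different sides of `p = CD`.
  have r1 := rside_ht_ht h (s := True) hQ hR hQR.symm oC hCp ⟨P, hPp, hP⟩
  have r2 := rside_ht_ht h (s := True) hR hQ hQR oD hDp ⟨P, hPp, hP⟩
  rw [hE, hF] at r2
  rw [← hC, ht_ht, ← hB, ht_ht] at r1
  have hd := dir_flip h hR hQ hQR
  have hAp : ¬ A.On p := fun e => (Rim.eq_or_eq h hCD hCp hDp e).elim hAC.symm hAD
  have hFp : ¬ F.On p := fun e => (Rim.eq_or_eq h hCD hCp hDp e).elim hCF.symm hDF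
  obtain ⟨d, hFd, hAd⟩ := Rim.exists_join h hAF.symm
  obtain ⟨Z, hZd, hZp⟩ := (meets_iff_rside h hAF.symm hFd hAd hFp hAp).2 (by grind only)
  have hZ : IsMeet C D F A Z :=
    ⟨p, d, ⟨hCD, hCp, hDp⟩, ⟨hAF.symm, hFd, hAd⟩, by rintro rfl; exact hAp hAd, hZp, hZd⟩
  obtain ⟨m, hRm, hQm, hZm⟩ := h.A7 A B C D E F
    (by simp only [List.nodup_cons, List.mem_cons, List.not_mem_nil,
      List.nodup_nil]; clear r1 r2 hd; grind only)
    R Q Z (isMeet_ht h hB hE hAD.symm hBD) (isMeet_ht h hC hF hBE.symm hCE) hZ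
  have hml := h.line_eq hQR hQm hRm hQ hR
  subst hml
  have := h.pt_eq hpl hZp hZm hPp hP
  subst this
  exact ht_eq h hZd hFd hAd hAF.symm

theorem three_ht (h : Axioms Inc) {l : L} {P Q R : Pt} (hP : Inc P l) (hQ : Inc Q l)
    (hR : Inc R l) : ht h P * ht h Q * ht h R = ht h R * ht h Q * ht h P := by
  by_cases hPQ : P = Q
  · subst hPQ; simp [mul_assoc]
  by_cases hQR : Q = R
  · subst hQR; simp [mul_assoc]
  by_cases hPR : P = R
  · subst hPR; rfl
  have key : (ht h P * ht h Q * ht h R) * (ht h P * ht h Q * ht h R) = 1 := by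
    ext1 A
    simp only [Equiv.Perm.mul_apply, Equiv.Perm.one_apply]
    by_cases hA : A.On l
    · obtain ⟨B, hBA, hB, -⟩ := Rim.exists_other h hA
      have e1 : ∀ {X}, Inc X l → ht h X A = B := fun hX => ht_eq h hX hA hB hBA.symm
      have e2 : ∀ {X}, Inc X l → ht h X B = A := fun hX => ht_eq h hX hB hA hBA
      simp only [e1, e2, hP, hQ, hR]
    · exact three_ht_sq h hP hQ hR hPQ hQR hPR hA
  rw [mul_eq_one_iff_eq_inv] at key
  rw [key]
  simp [mul_assoc]

theorem ht_conj_translation (h : Axioms Inc) {l : L} {P Q R : Pt} (hP : Inc P l) (hQ : Inc Q l)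
    (hR : Inc R l) : ht h R * (ht h P * ht h Q) * ht h R = ht h Q * ht h P := by
  rw [← mul_assoc, three_ht h hR hP hQ, mul_assoc, ht_mul_self, mul_one]

theorem translation_comm (h : Axioms Inc) {l : L} {P Q R S : Pt} (hP : Inc P l) (hQ : Inc Q l)
    (hR : Inc R l) (hS : Inc S l) : (ht h P * ht h Q) * (ht h R * ht h S) =
      (ht h R * ht h S) * (ht h P * ht h Q) := by
  rw [← mul_assoc, three_ht h hP hQ hR, mul_assoc, mul_assoc, ← mul_assoc (ht h Q),
    three_ht h hQ hP hS, mul_assoc, mul_assoc]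

/-- A product of four half-turns about points of `l` is inverted by conjugation with each half-turn
about a point of `l`. Hence fixed rimpoints go to fixed rimpoints under these half-turns. Every
rimpoint across `l` from a fixed one is such an image, so all of them are fixed. -/
theorem ht_four (h : Axioms Inc) {l : L} {P Q R S : Pt} {A : Rim Inc} (hP : Inc P l) (hQ : Inc Q l)
    (hR : Inc R l) (hS : Inc S l) (hA : ¬ A.On l) (he : ht h P (ht h Q (ht h R A)) = ht h S A) :
    ht h P * ht h Q * ht h R = ht h S := by
  have hinv : ∀ {X}, Inc X l → ht h S * (ht h P * ht h Q * ht h R) * ht h X =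
      ht h X * (ht h S * (ht h P * ht h Q * ht h R))⁻¹ := by
    intro X hX
    have h1 := ht_conj_translation h hS hP hX
    have h2 := ht_conj_translation h hQ hR hX
    have h3 := translation_comm h hP hS hR hQ
    calc ht h S * (ht h P * ht h Q * ht h R) * ht h X
        = ht h X * ((ht h X * (ht h S * ht h P) * ht h X) *
          (ht h X * (ht h Q * ht h R) * ht h X)) := by
          simp only [mul_assoc]
          rw [← mul_assoc (ht h X) (ht h X), ht_mul_self, one_mul, ← mul_assoc (ht h X) (ht h X),
            ht_mul_self, one_mul]
      _ = _ := by rw [h1, h2, h3]; simp [mul_assoc]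
  have fix : ∀ {B : Rim Inc}, ¬ B.On l → (ht h S * (ht h P * ht h Q * ht h R)) B = B → ∀ C,
      ¬ C.On l → ¬ (rside l B ↔ rside l C) → (ht h S * (ht h P * ht h Q * ht h R)) C = C := by
    intro B hB hfix C hC hBC
    obtain ⟨X, hX, rfl⟩ := exists_ht h hB hC hBC
    rw [← Equiv.Perm.mul_apply, hinv hX, Equiv.Perm.mul_apply, Equiv.Perm.inv_eq_iff_eq.2 hfix.symm]
  have hAA : (ht h S * (ht h P * ht h Q * ht h R)) A = A := by simp [he]
  have key : ht h S * (ht h P * ht h Q * ht h R) = 1 := by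
    ext1 B
    by_cases hB : B.On l
    · obtain ⟨C, hCB, hC, -⟩ := Rim.exists_other h hB
      have e1 : ∀ {X}, Inc X l → ht h X B = C := fun hX => ht_eq h hX hB hC hCB.symm
      have e2 : ∀ {X}, Inc X l → ht h X C = B := fun hX => ht_eq h hX hC hB hCB
      simp only [Equiv.Perm.mul_apply, e1, e2, hP, hQ, hR, hS, Equiv.Perm.one_apply]
    · by_cases hs : rside l A ↔ rside l B
      · have hSA := rside_ht h hS hA
        have hSA' : ¬ (ht h S A).On l := fun e => hA ((ht_on_iff h hS).1 e)
        exact fix hSA' (fix hA hAA _ hSA' hSA) B hB (by grind only)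
      · exact fix hA hAA B hB hs
  rw [mul_eq_one_iff_inv_eq, ht_inv] at key
  exact key.symm

theorem exists_rim_not_on (h : Axioms Inc) (l : L) : ∃ A : Rim Inc, ¬ A.On l := by
  obtain ⟨Z, hZ⟩ := h.A2 l
  obtain ⟨m, hm, hml, -⟩ := h.exists_third_line Z l l
  exact ⟨rim h m True, fun e => hml (Rim.line_eq h (rim_on h m True) e hm hZ)⟩

/-- The product of the half-turns about three collinear points is a half-turn. -/
theorem exists_three_ht (h : Axioms Inc) {l : L} {P Q R : Pt} (hP : Inc P l) (hQ : Inc Q l)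
    (hR : Inc R l) : ∃ S, Inc S l ∧ ht h P * ht h Q * ht h R = ht h S := by
  obtain ⟨A, hA⟩ := exists_rim_not_on h l
  have s1 := rside_ht h hR hA
  have o1 : ¬ (ht h R A).On l := fun e => hA ((ht_on_iff h hR).1 e)
  have s2 := rside_ht h hQ o1
  have o2 : ¬ (ht h Q (ht h R A)).On l := fun e => o1 ((ht_on_iff h hQ).1 e)
  have s3 := rside_ht h hP o2
  have o3 : ¬ (ht h P (ht h Q (ht h R A))).On l := fun e => o2 ((ht_on_iff h hP).1 e)
  obtain ⟨S, hS, he⟩ := exists_ht h hA o3 (by grind only)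
  exact ⟨S, hS, ht_four h hP hQ hR hS hA he.symm⟩

theorem Axioms.exists_common_line (h : Axioms Inc) (A B : Pt) : ∃ l, Inc A l ∧ Inc B l := by
  by_cases hAB : A = B
  · obtain ⟨l, hl, -⟩ := h.exists_third_line A (h.exists_line_not_on A).choose
      (h.exists_line_not_on A).choose
    exact ⟨l, hl, hAB ▸ hl⟩
  · exact h.exists_line hAB

theorem exists_ht_conj (h : Axioms Inc) {l : L} {O X : Pt} (hO : Inc O l) (hX : Inc X l) :
    ∃ Y, Inc Y l ∧ ht h O * ht h X * ht h O = ht h Y :=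
  exists_three_ht h hO hX hO

/-- A translation without fixed points on a side of a line is not an involution there. -/
theorem ht_ht_ne (h : Axioms Inc) {l : L} {P Q : Pt} {A : Rim Inc} (hP : Inc P l) (hQ : Inc Q l)
    (hPQ : P ≠ Q) (hA : ¬ A.On l) : ht h P (ht h Q A) ≠ ht h Q (ht h P A) := by
  intro e
  obtain ⟨p, hPp, hAp⟩ := A.exists_line h P
  have r1 := rside_ht_ht h (s := True) hQ hP hPQ hA hAp ⟨P, hPp, hP⟩
  have r2 := rside_ht_ht h (s := True) hP hQ hPQ.symm hA hAp ⟨P, hPp, hP⟩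
  have := dir_flip h hP hQ (Ne.symm hPQ)
  rw [e] at r1
  grind only

/-- The motions: permutations of the rimpoints that permute the half-turns by conjugation. -/
def motions (h : Axioms Inc) : Subgroup (Equiv.Perm (Rim Inc)) where
  carrier := {g | ∃ φ : Equiv.Perm Pt, ∀ X, g * ht h X * g⁻¹ = ht h (φ X)}
  one_mem' := ⟨1, fun X => by simp⟩
  mul_mem' := by
    rintro g k ⟨φ, hφ⟩ ⟨χ, hχ⟩
    refine ⟨φ * χ, fun X => ?_⟩
    rw [Equiv.Perm.mul_apply, ← hφ, ← hχ]
    group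
  inv_mem' := by
    rintro g ⟨φ, hφ⟩
    refine ⟨φ⁻¹, fun X => ?_⟩
    have := hφ (φ⁻¹ X)
    rw [show φ (φ⁻¹ X) = X from φ.apply_symm_apply X] at this
    rw [← this]
    group

theorem ht_mem_motions (h : Axioms Inc) (O : Pt) : ht h O ∈ motions h := by
  have key : ∀ X, ∃ Y, ht h O * ht h X * ht h O = ht h Y := fun X => by
    obtain ⟨l, h1, h2⟩ := h.exists_common_line O X
    obtain ⟨Y, -, e⟩ := exists_ht_conj h h1 h2
    exact ⟨Y, e⟩
  choose f hf using key
  refine ⟨⟨f, f, fun X => ?_, fun X => ?_⟩, fun X => by rw [ht_inv]; exact hf X⟩ <;>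
  · apply ht_injective h
    rw [← hf, ← hf]
    simp only [mul_assoc, ht_mul_self, mul_one]
    rw [← mul_assoc, ht_mul_self, one_mul]

theorem sep_iff_ht (h : Axioms Inc) {A B C D : Rim Inc} :
    Sep A B C D ↔ C ≠ A ∧ C ≠ B ∧ ∃ Z, ht h Z A = B ∧ ht h Z C = D := by
  constructor
  · rintro ⟨Z, c, d, ⟨h1, h2, h3⟩, ⟨h4, h5, h6⟩, hcd, h7, h8⟩
    refine ⟨?_, ?_, Z, ht_eq h h7 h2 h3 h1, ht_eq h h8 h5 h6 h4⟩
    · rintro rfl; exact hcd (Rim.line_eq h h2 h5 h7 h8)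
    · rintro rfl; exact hcd (Rim.line_eq h h3 h5 h7 h8)
  · rintro ⟨h1, h2, Z, h3, h4⟩
    exact ⟨Z, isMeet_ht h h3 h4 h1 h2⟩

theorem sep_iff_rside (h : Axioms Inc) {A B C D : Rim Inc} {l : L} (hAB : A ≠ B) (hA : A.On l)
    (hB : B.On l) :
    Sep A B C D ↔ ¬ C.On l ∧ ¬ D.On l ∧ ¬ (rside l C ↔ rside l D) := by
  constructor
  · rintro ⟨Z, c, d, ⟨h1, h2, h3⟩, ⟨h4, h5, h6⟩, hcd, h7, h8⟩
    have := Rim.join_unique h hAB hA hB h2 h3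
    subst this
    have hC : ¬ C.On l := fun e => hcd (Rim.line_eq h e h5 h7 h8)
    have hD : ¬ D.On l := fun e => hcd (Rim.line_eq h e h6 h7 h8)
    exact ⟨hC, hD, (meets_iff_rside h h4 h5 h6 hC hD).1 ⟨Z, h8, h7⟩⟩
  · rintro ⟨hC, hD, hs⟩
    have hCD : C ≠ D := by rintro rfl; exact hs Iff.rfl
    obtain ⟨d, h1, h2⟩ := Rim.exists_join h hCD
    obtain ⟨Z, h3, h4⟩ := (meets_iff_rside h hCD h1 h2 hC hD).2 hs
    exact ⟨Z, l, d, ⟨hAB, hA, hB⟩, ⟨hCD, h1, h2⟩, by rintro rfl; exact hC h1, h4, h3⟩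

theorem IsMeet.swap {A B C D : Rim Inc} {Z : Pt} : IsMeet A B C D Z → IsMeet C D A B Z := by
  rintro ⟨c, d, h1, h2, h3, h4, h5⟩
  exact ⟨d, c, h2, h1, h3.symm, h5, h4⟩

theorem IsMeet.symm_left {A B C D : Rim Inc} {Z : Pt} : IsMeet A B C D Z → IsMeet B A C D Z := by
  rintro ⟨c, d, ⟨h1, h6, h7⟩, h2, h3, h4, h5⟩
  exact ⟨c, d, ⟨h1.symm, h7, h6⟩, h2, h3, h4, h5⟩

theorem Sep.swap {A B C D : Rim Inc} : Sep A B C D → Sep C D A B := fun ⟨Z, hZ⟩ => ⟨Z, hZ.swap⟩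

theorem Sep.symm_left {A B C D : Rim Inc} : Sep A B C D → Sep B A C D := fun ⟨Z, hZ⟩ =>
  ⟨Z, hZ.symm_left⟩

theorem Sep.symm_right {A B C D : Rim Inc} (hs : Sep A B C D) : Sep A B D C :=
  hs.swap.symm_left.swap

theorem Sep.ne (h : Axioms Inc) {A B C D : Rim Inc} (hs : Sep A B C D) :
    A ≠ B ∧ A ≠ C ∧ A ≠ D ∧ B ≠ C ∧ B ≠ D ∧ C ≠ D := by
  have h1 := (sep_iff_ht h).1 hs
  have h2 := (sep_iff_ht h).1 hs.symm_right
  obtain ⟨Z, c, d, h3, h4, -⟩ := hs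
  exact ⟨h3.1, h1.1.symm, h2.1.symm, h1.2.1.symm, h2.2.1.symm, h4.1⟩

theorem sep_motion (h : Axioms Inc) {g : Equiv.Perm (Rim Inc)} (hg : g ∈ motions h)
    {A B C D : Rim Inc} : Sep (g A) (g B) (g C) (g D) ↔ Sep A B C D := by
  have key : ∀ g ∈ motions h, ∀ A B C D : Rim Inc, Sep A B C D → Sep (g A) (g B) (g C) (g D) := by
    rintro g ⟨φ, hφ⟩ A B C D hs
    obtain ⟨h1, h2, Z, rfl, rfl⟩ := (sep_iff_ht h).1 hs
    refine (sep_iff_ht h).2 ⟨fun e => h1 (g.injective e), fun e => h2 (g.injective e), φ Z, ?_, ?_⟩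
    all_goals rw [← hφ]; simp
  refine ⟨fun e => ?_, key g hg A B C D⟩
  have := key g⁻¹ (inv_mem hg) _ _ _ _ e
  simpa using this

end Translations
end HypInc


namespace HypInc

/-! ### A cyclic order compatible with separation. -/

section CyclicOrders

theorem isCyclicOrder_of_linear {Ω : Type*} {r : Ω → Ω → Prop} (irr : ∀ x, ¬ r x x)
    (tot : ∀ x y, x ≠ y → (r x y ↔ ¬ r y x)) (tr : ∀ x y z, r x y → r y z → r x z) :
    IsCyclicOrder fun x y z => (r x y ∧ r y z) ∨ (r y z ∧ r z x) ∨ (r z x ∧ r x y) where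
  C1 x y z hC := by
    have h1 := irr x
    have h2 := irr y
    have h3 := irr z
    refine ⟨?_, ?_, ?_⟩ <;> rintro rfl <;> grind only
  C2 x y z h1 h2 h3 := by
    have := tot x y h1
    have := tot y z h2
    have := tot z x h3
    have := tr x y z
    have := tr z y x
    rw [xor_def]
    grind only
  C3 x y z hC := by grind only
  C4 x y z t h1 h2 := by
    have h3 := irr x
    have h4 := irr y
    have h5 := irr z
    have := tr x y t
    have := tr y z t
    have := tr x z t
    have := tr z t x
    have := tr y t x
    have := tr t x y
    have := tr t x z
    have := tr x y z
    have := tr y z x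
    have := tr z x y
    have := tr x z x
    have := tr x t x
    have := tr z t z
    have := tr x y x
    have := tr y z y
    grind only

variable {Pt L : Type*} {Inc : Pt → L → Prop}

theorem sep_three (h : Axioms Inc) {w x y z : Rim Inc} (hx : w ≠ x) (hy : w ≠ y) (hz : w ≠ z)
    (hxy : x ≠ y) (hyz : y ≠ z) (hxz : x ≠ z) :
    (Sep w x y z ∧ ¬ Sep w y x z ∧ ¬ Sep w z x y) ∨ (¬ Sep w x y z ∧ Sep w y x z ∧ ¬ Sep w z x y) ∨
    (¬ Sep w x y z ∧ ¬ Sep w y x z ∧ Sep w z x y) := by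
  obtain ⟨a, h1, h2⟩ := Rim.exists_join h hx
  obtain ⟨b, h3, h4⟩ := Rim.exists_join h hy
  obtain ⟨c, h5, h6⟩ := Rim.exists_join h hz
  rw [sep_iff_rside h hx h1 h2, sep_iff_rside h hy h3 h4, sep_iff_rside h hz h5 h6]
  have e1 : ¬ y.On a := fun e => (Rim.eq_or_eq h hx h1 h2 e).elim hy.symm hxy.symm
  have e2 : ¬ z.On a := fun e => (Rim.eq_or_eq h hx h1 h2 e).elim hz.symm hxz.symm
  have e3 : ¬ x.On b := fun e => (Rim.eq_or_eq h hy h3 h4 e).elim hx.symm hxy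
  have e4 : ¬ z.On b := fun e => (Rim.eq_or_eq h hy h3 h4 e).elim hz.symm hyz.symm
  have e5 : ¬ x.On c := fun e => (Rim.eq_or_eq h hz h5 h6 e).elim hx.symm hxz
  have e6 : ¬ y.On c := fun e => (Rim.eq_or_eq h hz h5 h6 e).elim hy.symm hyz
  have := rside_three h h1 h3 h5 h2 h4 h6 hx hy hz hxy hxz hyz
  grind only

theorem sep_change (h : Axioms Inc) {x z y v w : Rim Inc} (hxz : x ≠ z) (hyx : y ≠ x) (hyz : y ≠ z)
    (hvx : v ≠ x) (hvz : v ≠ z) (hwx : w ≠ x) (hwz : w ≠ z) :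
    Sep x z y v ↔ ¬ (Sep x z y w ↔ Sep x z v w) := by
  obtain ⟨a, h1, h2⟩ := Rim.exists_join h hxz
  have e1 : ¬ y.On a := fun e => (Rim.eq_or_eq h hxz h1 h2 e).elim hyx hyz
  have e2 : ¬ v.On a := fun e => (Rim.eq_or_eq h hxz h1 h2 e).elim hvx hvz
  have e3 : ¬ w.On a := fun e => (Rim.eq_or_eq h hxz h1 h2 e).elim hwx hwz
  rw [sep_iff_rside h hxz h1 h2, sep_iff_rside h hxz h1 h2, sep_iff_rside h hxz h1 h2]
  grind only

/-- Removing `w` from the circle leaves a line. Here `w` is kept as greatest element; for other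
points, `r x y` says on which side of the chord `wy` the point `x` lies. -/
theorem exists_linear (h : Axioms Inc) (w : Rim Inc) : ∃ r : Rim Inc → Rim Inc → Prop,
    (∀ x, ¬ r x x) ∧ (∀ x y, x ≠ y → (r x y ↔ ¬ r y x)) ∧ (∀ x y z, r x y → r y z → r x z) ∧
    (∀ x, ¬ r w x) ∧
    ∀ x y z, x ≠ w → y ≠ w → z ≠ w → x ≠ y → y ≠ z → x ≠ z →
      (Sep w y x z ↔ ¬ (r x y ↔ r z y)) := by
  obtain ⟨l, hl⟩ := w.exists_on
  obtain ⟨o, how, -⟩ := Rim.exists_other h hl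
  have key : ∃ f : Rim Inc → Rim Inc → Prop, ∀ x y z, x ≠ w → y ≠ w → z ≠ w → x ≠ y → y ≠ z →
      x ≠ z → (Sep w y x z ↔ ¬ (f y x ↔ f y z)) := by
    have : ∀ y : Rim Inc, ∃ a : L, y ≠ w → w.On a ∧ y.On a := fun y => by
      by_cases hy : y = w
      · exact ⟨l, fun e => absurd hy e⟩
      · obtain ⟨a, h1, h2⟩ := Rim.exists_join h hy
        exact ⟨a, fun _ => ⟨h2, h1⟩⟩
    choose a ha using this
    refine ⟨fun y x => rside (a y) x, fun x y z hx hy hz hxy hyz hxz => ?_⟩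
    obtain ⟨h1, h2⟩ := ha y hy
    have e1 : ¬ x.On (a y) := fun e => (Rim.eq_or_eq h hy.symm h1 h2 e).elim hx hxy
    have e2 : ¬ z.On (a y) := fun e => (Rim.eq_or_eq h hy.symm h1 h2 e).elim hz hyz.symm
    rw [sep_iff_rside h hy.symm h1 h2]
    grind only
  obtain ⟨f, hf⟩ := key
  -- The side called "below" `y` is arbitrary for each `y`; `e` adjusts these choices to the one
  -- made at the reference point `o`, so that `r` becomes antisymmetric.
  obtain ⟨e, he⟩ : ∃ e : Rim Inc → Prop, ∀ y, e y ↔ (y = o ∨ (f y o ↔ ¬ f o y)) :=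
    ⟨fun y => y = o ∨ (f y o ↔ ¬ f o y), fun y => Iff.rfl⟩
  obtain ⟨r, hr⟩ : ∃ r : Rim Inc → Rim Inc → Prop, ∀ x y, r x y ↔
      x ≠ w ∧ (y = w ∨ x ≠ y ∧ (f y x ↔ e y)) := ⟨_, fun _ _ => Iff.rfl⟩
  have three : ∀ x y z, x ≠ w → y ≠ w → z ≠ w → x ≠ y → y ≠ z → x ≠ z →
      (¬ (f x y ↔ f x z) ∧ (f y x ↔ f y z) ∧ (f z x ↔ f z y)) ∨
      ((f x y ↔ f x z) ∧ ¬ (f y x ↔ f y z) ∧ (f z x ↔ f z y)) ∨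
      ((f x y ↔ f x z) ∧ (f y x ↔ f y z) ∧ ¬ (f z x ↔ f z y)) := by
    intro x y z hx hy hz hxy hyz hxz
    have h1 := sep_three h hx.symm hy.symm hz.symm hxy hyz hxz
    rw [hf y x z hy hx hz hxy.symm hxz hyz, hf x y z hx hy hz hxy hyz hxz,
      hf x z y hx hz hy hxz hyz.symm hxy] at h1
    grind only
  have tot : ∀ x y, x ≠ y → (r x y ↔ ¬ r y x) := by
    intro x y hxy
    rw [hr, hr, he, he]
    by_cases hx : x = w
    · have : y ≠ w := fun e => hxy (hx.trans e.symm)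
      grind only
    by_cases hy : y = w
    · grind only
    by_cases hxo : x = o
    · subst hxo
      grind only
    by_cases hyo : y = o
    · subst hyo
      grind only
    have := three x y o hx hy how hxy hyo hxo
    grind only
  have irr : ∀ x, ¬ r x x := by
    intro x e
    rw [hr] at e
    grind only
  have hS : ∀ x y z, x ≠ w → y ≠ w → z ≠ w → x ≠ y → y ≠ z → x ≠ z →
      (Sep w y x z ↔ ¬ (r x y ↔ r z y)) := by
    intro x y z hx hy hz hxy hyz hxz
    rw [hf x y z hx hy hz hxy hyz hxz, hr, hr]
    have := hyz.symm
    grind only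
  have hw : ∀ x, ¬ r w x := by
    intro x e
    exact ((hr _ _).1 e).1 rfl
  refine ⟨r, irr, tot, fun x y z h1 h2 => ?_, hw, hS⟩
  have hxy : x ≠ y := by rintro rfl; exact irr _ h1
  have hyz : y ≠ z := by rintro rfl; exact irr _ h2
  have hxz : x ≠ z := by rintro rfl; exact (tot _ _ hxy).1 h1 h2
  have hx : x ≠ w := by rintro rfl; exact hw _ h1
  have hy : y ≠ w := by rintro rfl; exact hw _ h2
  by_cases hz : z = w
  · exact (hr _ _).2 ⟨hx, .inl hz⟩
  have t := sep_three h hx.symm hy.symm (Ne.symm hz) hxy hyz hxz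
  rw [hS y x z hy hx hz hxy.symm hxz hyz, hS x y z hx hy hz hxy hyz hxz,
    hS x z y hx hz hy hxz hyz.symm hxy] at t
  have := tot x y hxy
  have := tot y z hyz
  have := tot x z hxz
  grind only

theorem exists_compatibleOrder (h : Axioms Inc) : ∃ C : Rim Inc → Rim Inc → Rim Inc → Prop,
    CompatibleOrder C := by
  obtain ⟨Z, -⟩ := h.A3_noncollinear
  obtain ⟨l, -⟩ := h.exists_line_not_on Z
  obtain ⟨w, -⟩ := exists_rim_not_on h l
  obtain ⟨r, irr, tot, tr, hw, hS⟩ := exists_linear h w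
  refine ⟨_, isCyclicOrder_of_linear irr tot tr, fun X Y Z W => ?_⟩
  by_cases hd : X ≠ Z ∧ X ≠ Y ∧ X ≠ W ∧ Z ≠ Y ∧ Z ≠ W ∧ Y ≠ W
  swap
  · have h1 : ¬ Sep X Z Y W := fun e => hd (e.ne h)
    simp only [h1, false_iff]
    have := irr X
    have := irr Y
    have := irr Z
    have := irr W
    have := tr X Y Z
    have := tr Z Y X
    have := tr X X Z
    intro hc
    apply hd
    have t1 := tot X Y
    have t2 := tot Y Z
    have t3 := tot Z X
    clear h1 hd hS
    refine ⟨?_, ?_, ?_, ?_, ?_, ?_⟩ <;> rintro rfl <;> grind only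
  obtain ⟨h1, h2, h3, h4, h5, h6⟩ := hd
  have tXY := tot X Y h2
  have tXZ := tot X Z h1
  have tXW := tot X W h3
  have tZY := tot Z Y h4
  have tZW := tot Z W h5
  have tYW := tot Y W h6
  have sep_comm : ∀ {A B C D : Rim Inc}, Sep A B C D ↔ Sep C D A B := ⟨Sep.swap, Sep.swap⟩
  have sep_symm : ∀ {A B C D : Rim Inc}, Sep A B C D ↔ Sep B A C D :=
    ⟨Sep.symm_left, Sep.symm_left⟩
  have kXYZ := tr X Y Z
  have kXZY := tr X Z Y
  have kYXZ := tr Y X Z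
  have kYZX := tr Y Z X
  have kZXY := tr Z X Y
  have kZYX := tr Z Y X
  have kXWZ := tr X W Z
  have kXZW := tr X Z W
  have kWXZ := tr W X Z
  have kWZX := tr W Z X
  have kZXW := tr Z X W
  have kZWX := tr Z W X
  by_cases hX : X = w
  · subst hX
    rw [hS Y Z W h2.symm h1.symm h3.symm h4.symm h5 h6]
    have := hw Y
    have := hw Z
    have := hw W
    clear hS hw tr irr tot
    grind only
  by_cases hZ : Z = w
  · subst hZ
    rw [sep_symm, hS Y X W h4.symm h1 h5.symm h2.symm h3 h6]
    have := hw Y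
    have := hw X
    have := hw W
    clear hS hw tr irr tot
    grind only
  by_cases hY : Y = w
  · subst hY
    rw [sep_comm, hS X W Z h2 h6.symm h4 h3 h5.symm h1]
    have := hw Z
    have := hw X
    have := hw W
    clear hS hw tr irr tot
    grind only
  by_cases hW : W = w
  · subst hW
    rw [sep_comm, sep_symm, hS X Y Z h3 h6 h5 h2 h4.symm h1]
    have := hw Z
    have := hw X
    have := hw Y
    clear hS hw tr irr tot
    grind only
  -- With `w` different from all four points, `sep_change` reduces their separation to two
  -- separations involving `w`, which the linear order describes.
  rw [sep_change h h1 h2.symm h4.symm h3.symm h5.symm (Ne.symm hX) (Ne.symm hZ),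
    sep_comm, sep_symm, hS X Y Z hX hY hZ h2 h4.symm h1, @sep_comm X Z W w, @sep_symm W w,
    hS X W Z hX hW hZ h3 h5.symm h1]
  clear hS hw tr irr tot
  grind only

end CyclicOrders
end HypInc


namespace HypInc

/-! ### Permutations that preserve separation. -/

section OrderPreserving

variable {Pt L : Type*} {Inc : Pt → L → Prop}

theorem IsCyclicOrder.rev {Ω : Type*} {C : Ω → Ω → Ω → Prop} (hC : IsCyclicOrder C) {x y z : Ω}
    (hxy : x ≠ y) (hyz : y ≠ z) (hzx : z ≠ x) : C x z y ↔ ¬ C x y z := by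
  have := hC.C2 x y z hxy hyz hzx
  rw [xor_def] at this
  grind only

theorem IsCyclicOrder.rot {Ω : Type*} {C : Ω → Ω → Ω → Prop} (hC : IsCyclicOrder C) {x y z : Ω} :
    C x y z ↔ C y z x := ⟨hC.C3 x y z, fun e => hC.C3 z x y (hC.C3 y z x e)⟩

theorem CompatibleOrder.sep_iff {C : Rim Inc → Rim Inc → Rim Inc → Prop} (hC : CompatibleOrder C)
    {x y z v : Rim Inc} (hxz : x ≠ z) (hyx : y ≠ x) (hyz : y ≠ z) (hvx : v ≠ x) (hvz : v ≠ z) :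
    Sep x z y v ↔ ¬ (C x y z ↔ C x v z) := by
  rw [hC.2 x y z v]
  have h1 := hC.1.rev hyx.symm hyz hxz.symm
  have h2 := hC.1.rev hvx.symm hvz hxz.symm
  have h3 := @IsCyclicOrder.rot _ C hC.1 z v x
  have h4 := @IsCyclicOrder.rot _ C hC.1 z y x
  have h5 := @IsCyclicOrder.rot _ C hC.1 v x z
  have h6 := @IsCyclicOrder.rot _ C hC.1 y x z
  grind only

/-- Separation determines a compatible cyclic order up to reversal: whether `g` keeps the
orientation of a triple does not change when one member is replaced, so a single triple decides. -/
theorem order_preserving {C : Rim Inc → Rim Inc → Rim Inc → Prop}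
    (hC : CompatibleOrder C) {g : Equiv.Perm (Rim Inc)}
    (hg : ∀ A B C D, Sep (g A) (g B) (g C) (g D) ↔ Sep A B C D) {p q r : Rim Inc} (hpq : p ≠ q)
    (hqr : q ≠ r) (hpr : p ≠ r) (h0 : C p q r ↔ C (g p) (g q) (g r)) (x y z : Rim Inc) :
    C x y z ↔ C (g x) (g y) (g z) := by
  obtain ⟨E, hE⟩ : ∃ E : Rim Inc → Rim Inc → Rim Inc → Prop,
    ∀ x y z, E x y z ↔ (C x y z ↔ C (g x) (g y) (g z)) := ⟨_, fun _ _ _ => Iff.rfl⟩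
  have inj : ∀ {a b}, a ≠ b → g a ≠ g b := fun hab e => hab (g.injective e)
  have rot : ∀ {x y z}, E x y z → E y z x := by
    intro x y z e
    rw [hE] at e ⊢
    exact (hC.1.rot.symm.trans e).trans hC.1.rot
  have rev : ∀ {x y z}, x ≠ y → y ≠ z → x ≠ z → E x y z → E x z y := by
    intro x y z h1 h2 h3 e
    rw [hE] at e ⊢
    rw [hC.1.rev h1 h2 h3.symm, hC.1.rev (inj h1) (inj h2) (inj h3.symm), e]
  have rep : ∀ {x y z} v, x ≠ y → y ≠ z → x ≠ z → v ≠ x → v ≠ z → E x y z → E x v z := by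
    intro x y z v h1 h2 h3 h4 h5 e
    have s1 := hC.sep_iff h3 h1.symm h2 h4 h5
    have s2 := hC.sep_iff (inj h3) (inj h1.symm) (inj h2) (inj h4) (inj h5)
    have s3 := hg x z y v
    rw [hE] at e ⊢
    grind only
  have two : ∀ z, z ≠ p → z ≠ q → E p q z := by
    intro z h1 h2
    have e := rev hpq hqr hpr ((hE _ _ _).2 h0)
    exact rev h1.symm h2 hpq (rep z hpr hqr.symm hpq h1 h2 e)
  have one : ∀ y z, y ≠ p → z ≠ p → y ≠ z → E p y z := by
    intro y z h1 h2 h3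
    by_cases hz : z = q
    · subst hz
      exact rev hpq h3.symm h1.symm (two y h1 h3)
    · exact rep y hpq (Ne.symm hz) h2.symm h1 h3 (two z h2 hz)
  by_cases hd : x ≠ y ∧ y ≠ z ∧ z ≠ x
  · obtain ⟨h1, h2, h3⟩ := hd
    rw [← hE]
    by_cases hx : x = p
    · subst hx
      exact one y z h1.symm h3 h2
    by_cases hy : y = p
    · subst hy
      exact rot (rot (one z x h2.symm h1 h3))
    by_cases hz : z = p
    · subst hz
      exact rot (one x y h3.symm h2 h1)
    · have e := rot (rot (one y z hy hz h2))
      exact rot (rep x hz (Ne.symm hy) h2.symm h3.symm h1 e)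
  · refine ⟨fun e => absurd (hC.1.C1 _ _ _ e) hd, fun e => absurd ?_ hd⟩
    have := hC.1.C1 _ _ _ e
    simpa using this

/-- For the triple p, q, p^O the orientation is kept because the chords pp^O and qq^O cross in `O`.
-/
theorem ht_order (h : Axioms Inc) {C : Rim Inc → Rim Inc → Rim Inc → Prop}
    (hC : CompatibleOrder C) (O : Pt) (x y z : Rim Inc) :
    C x y z ↔ C (ht h O x) (ht h O y) (ht h O z) := by
  obtain ⟨l, hl, -⟩ := h.exists_common_line O O
  obtain ⟨q, hq⟩ := exists_rim_not_on h l
  obtain ⟨p, hp⟩ : ∃ p : Rim Inc, p.On l := ⟨rim h l True, rim_on h l True⟩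
  have e1 : p ≠ q := by rintro rfl; exact hq hp
  have e2 : q ≠ ht h O p := by rintro rfl; exact hq (ht_on h hl hp)
  have e3 : p ≠ ht h O p := (ht_ne h O p).symm
  have e4 : q ≠ ht h O q := (ht_ne h O q).symm
  have e5 : ht h O q ≠ p := by rintro rfl; exact hq (by simpa using ht_on h hl hp)
  have e6 : ht h O q ≠ ht h O p := fun e => e1.symm ((ht h O).injective e)
  refine order_preserving hC (fun A B C D => sep_motion h (ht_mem_motions h O)) e1 e2 e3 ?_ x y z
  have s := (hC.sep_iff e3 e1.symm e2 e5 e6).1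
    ((sep_iff_ht h).2 ⟨e1.symm, e2, O, rfl, rfl⟩)
  rw [ht_ht]
  have r1 := hC.1.rev e5.symm e6 e3.symm
  have r2 := @IsCyclicOrder.rot _ C hC.1 p (ht h O p) (ht h O q)
  grind only

/-- A permutation of the rimpoints that preserves separation is determined by its values off a
line. -/
theorem eq_of_eq_off (h : Axioms Inc) {l : L} {f g : Equiv.Perm (Rim Inc)}
    (hf : ∀ A B C D, Sep (f A) (f B) (f C) (f D) ↔ Sep A B C D)
    (hg : ∀ A B C D, Sep (g A) (g B) (g C) (g D) ↔ Sep A B C D)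
    (he : ∀ A, ¬ A.On l → f A = g A) : f = g := by
  obtain ⟨k, hk⟩ : ∃ k, k = g⁻¹ * f := ⟨_, rfl⟩
  have hk1 : ∀ A, ¬ A.On l → k A = A := fun A hA => by simp [hk, he A hA]
  have hkS : ∀ A B C D, Sep (k A) (k B) (k C) (k D) ↔ Sep A B C D := fun A B C D => by
    rw [← hg (k A) (k B) (k C) (k D), ← hf A B C D]
    simp [hk]
  suffices k = 1 by
    rw [hk, inv_mul_eq_one] at this
    exact this.symm
  obtain ⟨P, hP⟩ := h.A2 l
  obtain ⟨Q, hQP, hQ⟩ := h.exists_ne_on l P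
  obtain ⟨X, hX⟩ := exists_rim_not_on h l
  obtain ⟨Y, hY⟩ : ∃ Y, Y = ht h Q (ht h P X) := ⟨_, rfl⟩
  have hYl : ¬ Y.On l := by rwa [hY, ht_on_iff h hQ, ht_on_iff h hP]
  have hYX : Y ≠ X := by rw [hY]; exact ht_apply_ne h hQ hP hQP hX
  have hs : rside l X ↔ rside l Y := by
    have h1 := rside_ht h hP hX
    have h2 := rside_ht h hQ (fun e => hX ((ht_on_iff h hP).1 e))
    rw [hY]
    grind only
  ext1 A
  by_cases hA : A.On l
  swap
  · exact hk1 A hA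
  obtain ⟨B, hBA, hB, hu⟩ := Rim.exists_other h hA
  have kA : k A = A ∨ k A = B := by
    apply hu
    by_contra hc
    exact hc ((k.injective (hk1 _ hc)).symm ▸ hA)
  have hXA : X ≠ A := by rintro rfl; exact hX hA
  have hXB : X ≠ B := by rintro rfl; exact hX hB
  have hYA : Y ≠ A := by rintro rfl; exact hYl hA
  have hYB : Y ≠ B := by rintro rfl; exact hYl hB
  -- The quotient `k` fixes everything off `l`, so it could at most interchange the ends A and B. As
  -- `AB` does not separate X from Y, exactly one of the pairs AX, BY and AY, BX separates, but
  -- interchanging A and B would exchange the two cases.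
  refine kA.resolve_right fun kB => ?_
  have kBA : k B = A := by
    refine (hu _ ?_).resolve_right fun e => hBA (k.injective (e.trans kB.symm))
    by_contra hc
    exact hc ((k.injective (hk1 _ hc)).symm ▸ hB)
  have e1 := hkS A X Y B
  rw [kB, kBA, hk1 X hX, hk1 Y hYl] at e1
  have e2 : Sep B X Y A ↔ Sep A Y X B := ⟨fun e => e.swap.symm_left.symm_right,
    fun e => e.swap.symm_left.symm_right⟩
  have t := sep_three h hBA.symm hXA.symm hYA.symm hXB.symm hYX.symm hYB.symm
  have e3 : ¬ Sep A B X Y := fun e => ((sep_iff_rside h hBA.symm hA hB).1 e).2.2 hs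
  have e4 : Sep A X B Y ↔ Sep A X Y B := ⟨Sep.symm_right, Sep.symm_right⟩
  have e5 : Sep A Y B X ↔ Sep A Y X B := ⟨Sep.symm_right, Sep.symm_right⟩
  grind only

end OrderPreserving
end HypInc


namespace HypInc

/-! ### Axial permutations are the translations. -/

section Axial

variable {Pt L : Type*} {Inc : Pt → L → Prop}

theorem oppositeSides_iff (h : Axioms Inc) {l : L} {X Y : Rim Inc} :
    OppositeSides l X Y ↔ ¬ X.On l ∧ ¬ Y.On l ∧ ¬ (rside l X ↔ rside l Y) := by
  constructor
  · rintro ⟨hX, hY, c, ⟨h1, h2, h3⟩, h4⟩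
    exact ⟨hX, hY, (meets_iff_rside h h1 h2 h3 hX hY).1 h4⟩
  · rintro ⟨hX, hY, hs⟩
    have hXY : X ≠ Y := by rintro rfl; exact hs Iff.rfl
    obtain ⟨c, h2, h3⟩ := Rim.exists_join h hXY
    exact ⟨hX, hY, c, ⟨hXY, h2, h3⟩, (meets_iff_rside h hXY h2 h3 hX hY).2 hs⟩

theorem IsMeet.ht_eq (h : Axioms Inc) {A B C D : Rim Inc} {Z : Pt} (hZ : IsMeet A B C D Z) :
    ht h Z A = B ∧ ht h Z C = D := by
  obtain ⟨c, d, ⟨h1, h2, h3⟩, ⟨h4, h5, h6⟩, -, h7, h8⟩ := hZ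
  exact ⟨HypInc.ht_eq h h7 h2 h3 h1, HypInc.ht_eq h h8 h5 h6 h4⟩

theorem rside_ht_ht_iff (h : Axioms Inc) {l : L} {P Q : Pt} {X : Rim Inc} (hP : Inc P l)
    (hQ : Inc Q l) (hX : ¬ X.On l) : rside l (ht h P (ht h Q X)) ↔ rside l X := by
  have h1 := rside_ht h hQ hX
  have h2 := rside_ht h hP (fun e => hX ((ht_on_iff h hQ).1 e))
  grind only

theorem exists_translation (h : Axioms Inc) {l : L} {Q : Pt} {X Y : Rim Inc} (hQ : Inc Q l)
    (hX : ¬ X.On l) (hY : ¬ Y.On l) (hs : rside l X ↔ rside l Y) :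
    ∃ P, Inc P l ∧ ht h P (ht h Q X) = Y := by
  have h1 := rside_ht h hQ hX
  exact exists_ht h (fun e => hX ((ht_on_iff h hQ).1 e)) hY (by grind only)

/-- The rimpoints on a side of the line `MN`, ordered by a compatible cyclic order. -/
theorem toward_iff (h : Axioms Inc) {C : Rim Inc → Rim Inc → Rim Inc → Prop}
    (hC : CompatibleOrder C) {l k : L} {M N D F : Rim Inc} (hMN : M ≠ N) (hM : M.On l) (hN : N.On l)
    (hD : ¬ D.On l) (hF : ¬ F.On l) (hDF : D ≠ F) (hs : rside l D ↔ rside l F) (hDk : D.On k)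
    (hk : Meets Inc k l) (hMDN : C M D N) : (rside k F ↔ rside k M) ↔ C M F D := by
  obtain ⟨R, hRk, hRl⟩ := hk
  obtain ⟨E, hE⟩ : ∃ E, E = ht h R D := ⟨_, rfl⟩
  have hEk : E.On k := hE ▸ ht_on h hRk hDk
  have hED : E ≠ D := hE ▸ ht_ne h R D
  have hEl : ¬ E.On l := by rwa [hE, ht_on_iff h hRl]
  have hEs : ¬ (rside l D ↔ rside l E) := hE ▸ rside_ht h hRl hD
  have hEF : E ≠ F := by rintro rfl; exact hEs hs
  have ne : ∀ {A B : Rim Inc}, A.On l → ¬ B.On l → A ≠ B := by rintro A B h1 h2 rfl; exact h2 h1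
  have hMD := ne hM hD
  have hME := ne hM hEl
  have hMF := ne hM hF
  have hND := ne hN hD
  have hNE := ne hN hEl
  have hNF := ne hN hF
  have hMk : ¬ M.On k := fun e => (Rim.eq_or_eq h hED hEk hDk e).elim hME hMD
  have hFk : ¬ F.On k := fun e => (Rim.eq_or_eq h hED hEk hDk e).elim hEF.symm hDF.symm
  have s1 := sep_iff_rside h (C := F) (D := M) hED hEk hDk
  have s2 := sep_iff_rside h (C := D) (D := E) hMN hM hN
  have s3 := sep_iff_rside h (C := D) (D := F) hMN hM hN
  have c1 := hC.sep_iff hED hEF.symm hDF.symm hME hMD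
  have c2 := hC.sep_iff hMN hMD.symm hND.symm hME.symm hNE.symm
  have c3 := hC.sep_iff hMN hMD.symm hND.symm hMF.symm hNF.symm
  have t1 : ¬ C M E N := by grind only
  have t2 : C M F N := by grind only
  have t3 := hC.1.rev hMN hNE hME.symm
  have t4 : C M N E := by grind only
  have t5 := hC.1.C4 M D N E hMDN t4
  have t6 := hC.1.C4 M F N E t2 t4
  have rot := @IsCyclicOrder.rot _ C hC.1
  have t7 := hC.1.C4 D E M F
  have t8 := hC.1.C4 F E M D
  have t9 := hC.1.rev hMD hDF hMF.symm
  have t10 := hC.1.rev hED hDF hEF.symm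
  have t11 := hC.1.rev hED hMD.symm hME
  have r1 := rot (x := M) (y := D) (z := E)
  have r2 := rot (x := D) (y := E) (z := M)
  have r3 := rot (x := E) (y := F) (z := D)
  have r4 := rot (x := F) (y := D) (z := E)
  have r5 := rot (x := M) (y := F) (z := D)
  have r6 := rot (x := F) (y := D) (z := M)
  have r7 := rot (x := M) (y := F) (z := E)
  have r8 := rot (x := F) (y := E) (z := M)
  have r9 := rot (x := M) (y := D) (z := F)
  have r10 := rot (x := D) (y := F) (z := M)
  have r11 := rot (x := F) (y := E) (z := D)
  have r12 := rot (x := E) (y := D) (z := F)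
  have r13 := rot (x := D) (y := E) (z := F)
  have r14 := rot (x := E) (y := M) (z := D)
  have r15 := rot (x := E) (y := D) (z := M)
  have r16 := rot (x := D) (y := F) (z := E)
  clear rot c2 c3 s2 s3 ne
  grind only

/-- On a side of `l`, ordered from one end of `l`, a translation τ is increasing and moves all
points in the same direction. For A before B, the points of {A, τA, B, τB} occur with A and τB on
the same side of the chord of τA and B, so the chords AτB and BτA cannot cross. -/
theorem not_sep_translation (h : Axioms Inc) {l : L} {P Q : Pt} {X Y : Rim Inc} (hP : Inc P l)
    (hQ : Inc Q l) (hPQ : P ≠ Q) (hX : ¬ X.On l) (hY : ¬ Y.On l) (hs : rside l X ↔ rside l Y) :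
    ¬ Sep X (ht h P (ht h Q Y)) Y (ht h P (ht h Q X)) := by
  obtain ⟨C, hC⟩ := exists_compatibleOrder h
  have ends : ∃ (s : Prop) (N : Rim Inc), rim h l s ≠ N ∧ N.On l ∧ C (rim h l s) X N := by
    obtain ⟨N, h1, h2, -⟩ := Rim.exists_other h (rim_on h l True)
    obtain ⟨t, rfl⟩ := Rim.exists_eq h h2
    have ne : ∀ {u}, rim h l u ≠ X := fun e => hX (e ▸ rim_on h l _)
    have := hC.1.rev ne ne.symm h1
    by_cases hc : C (rim h l True) X (rim h l t)
    · exact ⟨True, _, h1.symm, h2, hc⟩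
    · refine ⟨t, _, h1, rim_on h l _, ?_⟩
      have := @IsCyclicOrder.rot _ C hC.1 (rim h l True) (rim h l t) X
      grind only
  obtain ⟨s, N, hMN, hN, hMXN⟩ := ends
  have hM := rim_on h l s
  obtain ⟨τ, hτ⟩ : ∃ τ, τ = ht h P * ht h Q := ⟨_, rfl⟩
  have hτM : τ (rim h l s) = rim h l s := by
    obtain ⟨B, h1, h2, -⟩ := Rim.exists_other h hM
    rw [hτ, Equiv.Perm.mul_apply, ht_eq h hQ hM h2 h1.symm, ht_eq h hP h2 hM h1]
  have ho : ∀ x y z, C x y z ↔ C (τ x) (τ y) (τ z) := fun x y z => by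
    rw [hτ, ht_order h hC Q, ht_order h hC P]; rfl
  have hoff : ∀ {A}, ¬ A.On l → ¬ (τ A).On l := fun hA => by
    rwa [hτ, Equiv.Perm.mul_apply, ht_on_iff h hP, ht_on_iff h hQ]
  have hside : ∀ {A}, ¬ A.On l → (rside l (τ A) ↔ rside l A) := fun hA => by
    rw [hτ]; exact rside_ht_ht_iff h hP hQ hA
  have hne : ∀ {A}, ¬ A.On l → τ A ≠ A := fun hA => by
    rw [hτ]; exact ht_apply_ne h hP hQ hPQ hA
  have ne : ∀ {A : Rim Inc}, ¬ A.On l → rim h l s ≠ A := by rintro A h2 rfl; exact h2 hM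
  have side : ∀ {A}, ¬ A.On l → (rside l X ↔ rside l A) → C (rim h l s) A N := by
    intro A hA hsA
    have hNA : ∀ {A : Rim Inc}, ¬ A.On l → N ≠ A := by rintro A h2 rfl; exact h2 hN
    have c := hC.sep_iff hMN (ne hX).symm (hNA hX).symm (ne hA).symm (hNA hA).symm
    have := sep_iff_rside h (C := X) (D := A) hMN hM hN
    grind only
  have mono : ∀ {A}, ¬ A.On l → (rside l X ↔ rside l A) →
      (C (rim h l s) (τ A) A ↔ (dir Inc l Q P ↔ s)) := by
    intro A hA hsA
    obtain ⟨p, hQp, hAp⟩ := A.exists_line h Q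
    rw [← rside_ht_ht h hQ hP hPQ hA hAp ⟨Q, hQp, hQ⟩, ← toward_iff h hC hMN hM hN hA (hoff hA)
      (hne hA).symm (hside hA).symm hAp ⟨Q, hQp, hQ⟩ (side hA hsA), hτ]
    rfl
  have chain : ∀ {a b c}, C (rim h l s) a b → C (rim h l s) b c → C a b c := fun h1 h2 =>
    hC.1.C3 _ _ _ (hC.1.C3 _ _ _ (hC.1.C4 _ _ _ _ (hC.1.C3 _ _ _ h2)
      (hC.1.C3 _ _ _ (hC.1.C3 _ _ _ h1))))
  have key : ∀ A B, ¬ A.On l → ¬ B.On l → (rside l X ↔ rside l A) → (rside l X ↔ rside l B) →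
      C (rim h l s) A B → ¬ Sep A (τ B) B (τ A) := by
    intro A B hA hB hsA hsB hAB hS
    obtain ⟨n1, n2, n3, n4, n5, n6⟩ := hS.ne h
    have hAB' : C (rim h l s) (τ A) (τ B) := by
      have := (ho _ _ _).1 hAB
      rwa [hτM] at this
    have mA := mono hA hsA
    have mB := mono hB hsB
    have rA := hC.1.rev (ne hA) (hne hA).symm (ne (hoff hA)).symm
    have rB := hC.1.rev (ne hB) (hne hB).symm (ne (hoff hB)).symm
    by_cases hd : dir Inc l Q P ↔ s
    · have e1 := chain (mA.2 hd) hAB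
      have e2 := chain hAB' (mB.2 hd)
      have c := (hC.sep_iff n6.symm n3 n2 n5 n4).1 hS.swap.symm_left
      grind only
    · have e1 := chain hAB (by grind only : C (rim h l s) B (τ B))
      have e2 := chain (by grind only : C (rim h l s) A (τ A)) hAB'
      have c := (hC.sep_iff n1 n2.symm n4.symm n3.symm n5.symm).1 hS
      grind only
  have hτS : ∀ A B : Rim Inc, Sep A (τ B) B (τ A) ↔
      Sep A (ht h P (ht h Q B)) B (ht h P (ht h Q A)) := fun A B => by rw [hτ]; rfl
  rw [← hτS]
  intro hS
  obtain ⟨n1, n2, n3, n4, n5, n6⟩ := hS.ne h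
  by_cases hc : C (rim h l s) X Y
  · exact key X Y hX hY Iff.rfl hs hc hS
  · have := hC.1.rev (ne hX) n2 (ne hY).symm
    exact key Y X hY hX hs Iff.rfl (by grind only) hS.swap

/-- For X and Y across `l`, some point S of `l` takes X to τY. Since S inverts the translation τ, it
also takes Y to τX, so the two chords meet in S. For X and Y on one side the chords do not meet, by
`not_sep_translation`. -/
theorem translation_isAxial (h : Axioms Inc) {l : L} {P Q : Pt} (hP : Inc P l) (hQ : Inc Q l)
    (hPQ : P ≠ Q) : IsAxial (ht h P * ht h Q) l := by
  have hm : ∀ X Y, OppositeSides l X Y → ∃ Z, Inc Z l ∧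
      IsMeet X ((ht h P * ht h Q) Y) Y ((ht h P * ht h Q) X) Z := by
    intro X Y hXY
    obtain ⟨hX, hY, hs⟩ := (oppositeSides_iff h).1 hXY
    have hY' := rside_ht_ht_iff h hP hQ hY
    obtain ⟨S, hS, e⟩ := exists_ht h (A := X) (B := ht h P (ht h Q Y)) hX
      (by rwa [ht_on_iff h hP, ht_on_iff h hQ]) (by grind only)
    refine ⟨S, hS, isMeet_ht h e ?_ ?_ (ht_apply_ne h hP hQ hPQ hY).symm⟩
    · have := congrArg (fun g => g (ht h S X)) (ht_conj_translation h hP hQ hS)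
      simp only [Equiv.Perm.mul_apply, ht_ht] at this
      rw [e, ht_ht, ht_ht] at this
      rw [Equiv.Perm.mul_apply, ← this, ht_ht]
    · rintro rfl
      exact hs Iff.rfl
  refine ⟨fun e => ?_, ?_, ?_, fun X Y hXY => ?_⟩
  · obtain ⟨A, hA⟩ := exists_rim_not_on h l
    exact ht_apply_ne h hP hQ hPQ hA (by rw [← Equiv.Perm.mul_apply, e]; rfl)
  · obtain ⟨C, hC⟩ := exists_compatibleOrder h
    exact ⟨C, hC, fun x y z => by rw [ht_order h hC Q, ht_order h hC P]; rfl⟩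
  · intro X Y Z hZ
    obtain ⟨n1, n2, n3, n4, n5, n6⟩ := Sep.ne h ⟨Z, hZ⟩
    have fix : ∀ {A : Rim Inc}, A.On l → ht h P (ht h Q A) = A := fun {A} hA => by
      obtain ⟨B, h1, h2, -⟩ := Rim.exists_other h hA
      rw [ht_eq h hQ hA h2 h1.symm, ht_eq h hP h2 hA h1]
    have hX : ¬ X.On l := fun e => n3 (fix e).symm
    have hY : ¬ Y.On l := fun e => n4 (fix e)
    by_cases hs : rside l X ↔ rside l Y
    · exact absurd ⟨Z, hZ⟩ (not_sep_translation h hP hQ hPQ hX hY hs)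
    · obtain ⟨S, hS, hS'⟩ := hm X Y ((oppositeSides_iff h).2 ⟨hX, hY, hs⟩)
      have e := hS'.ht_eq h
      have e' := hZ.ht_eq h
      by_contra hZl
      have hZS : Z ≠ S := by rintro rfl; exact hZl hS
      obtain ⟨c, d, ⟨h1, h2, h3⟩, ⟨h4, h5, h6⟩, hcd, h7, h8⟩ := hZ
      have h9 := inc_of_ht h h2 (X := S) (by rw [e.1]; exact h3)
      have h10 := inc_of_ht h h5 (X := S) (by rw [e.2]; exact h6)
      exact hcd (h.line_eq hZS h7 h9 h8 h10)
  · obtain ⟨Z, -, hZ⟩ := hm X Y hXY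
    exact ⟨Z, hZ⟩

/-- The axis point of the pair X, X^Q, called `Z`, makes α agree with the translation ZQ at both of
them. Every rimpoint off `l` is across `l` from one of the two, and there the axis point of that
pair and `three_ht` force the same value. -/
theorem IsAxial.exists_eq (h : Axioms Inc) {l : L} {α : Equiv.Perm (Rim Inc)} (hα : IsAxial α l) :
    ∃ P Q, Inc P l ∧ Inc Q l ∧ P ≠ Q ∧ α = ht h P * ht h Q := by
  obtain ⟨Q, hQ⟩ := h.A2 l
  obtain ⟨X, hX⟩ := exists_rim_not_on h l
  have hm : ∀ {A B}, ¬ A.On l → ¬ B.On l → ¬ (rside l A ↔ rside l B) →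
      ∃ Z, Inc Z l ∧ ht h Z A = α B ∧ ht h Z B = α A := by
    intro A B hA hB hs
    obtain ⟨Z, hZ⟩ := hα.meets A B ((oppositeSides_iff h).2 ⟨hA, hB, hs⟩)
    exact ⟨Z, hα.on_axis _ _ _ hZ, hZ.ht_eq h⟩
  have hQX : ¬ (ht h Q X).On l := by rwa [ht_on_iff h hQ]
  have hQs := rside_ht h hQ hX
  obtain ⟨Z, hZ, e1, e2⟩ := hm hX hQX hQs
  have step : ∀ {A}, ¬ A.On l → ht h Z (ht h Q A) = α A → ∀ B, ¬ B.On l →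
      ¬ (rside l A ↔ rside l B) → α B = ht h Z (ht h Q B) := by
    intro A hA eA B hB hs
    obtain ⟨W, hW, e3, e4⟩ := hm hA hB hs
    rw [← e3]
    have : B = ht h W (ht h Z (ht h Q A)) := by rw [eA, ← e4, ht_ht]
    have t := congrArg (fun g => g (ht h Z (ht h Q A))) (three_ht h hZ hQ hW)
    simp only [Equiv.Perm.mul_apply, ht_ht] at t
    rw [this, t]
  have e3 : ht h Z (ht h Q (ht h Q X)) = α (ht h Q X) := by rw [ht_ht, e1]
  have key : ∀ A, ¬ A.On l → α A = (ht h Z * ht h Q) A := by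
    intro A hA
    by_cases hs : rside l X ↔ rside l A
    · exact step hQX e3 A hA (by grind only)
    · exact step hX e2 A hA hs
  obtain ⟨C, hC, hCα⟩ := hα.order
  have e := eq_of_eq_off h (fun A B C D => by
      rw [hC.2, hC.2, ← hCα, ← hCα, ← hCα, ← hCα])
    (fun A B C D => sep_motion h (mul_mem (ht_mem_motions h Z) (ht_mem_motions h Q))) key
  refine ⟨Z, Q, hZ, hQ, ?_, e⟩
  rintro rfl
  exact hα.ne_one (e.trans (ht_mul_self h Z))

end Axial
end HypInc


namespace HypInc

/-! ### The reflection in a line. -/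

section LineReflections

variable {Pt L : Type*} {Inc : Pt → L → Prop}

/-- The half-turn about `O` maps the rimpoints of `l` to `U` and `V`. -/
def Bow (h : Axioms Inc) (l : L) (U V : Rim Inc) (O : Pt) : Prop :=
  ∃ M N, M ≠ N ∧ M.On l ∧ N.On l ∧ ht h O M = U ∧ ht h O N = V

/-- With the same labelling of the ends of `l`, both points are the intersection of the same two
chords. Opposite labellings would make two different splittings of the four rimpoints separate,
contrary to `sep_three`. -/
theorem Bow.unique (h : Axioms Inc) {l : L} {U V : Rim Inc} {O O' : Pt} (hU : ¬ U.On l)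
    (hV : ¬ V.On l) (h1 : Bow h l U V O) (h2 : Bow h l U V O') : O = O' := by
  obtain ⟨M, N, hMN, hM, hN, rfl, rfl⟩ := h1
  obtain ⟨M', N', hMN', hM', hN', e1, e2⟩ := h2
  have hne : ∀ {A B : Rim Inc}, A.On l → ¬ B.On l → A ≠ B := by
    rintro A B h1 h2 rfl; exact h2 h1
  have hUV : ht h O M ≠ ht h O N := fun e => hMN ((ht h O).injective e)
  have s1 : Sep M (ht h O M) N (ht h O N) :=
    (sep_iff_ht h).2 ⟨hMN.symm, hne hN hU, O, rfl, rfl⟩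
  have s2 : Sep M' (ht h O M) N' (ht h O N) :=
    (sep_iff_ht h).2 ⟨hMN'.symm, hne hN' hU, O', e1, e2⟩
  rcases Rim.eq_or_eq h hMN hM hN hM' with rfl | rfl
  · rcases Rim.eq_or_eq h hMN hM hN hN' with rfl | rfl
    · exact absurd rfl hMN'
    obtain ⟨Z, c, d, ⟨h1, h2, h3⟩, ⟨h4, h5, h6⟩, hcd, -⟩ := s1
    exact h.pt_eq hcd (inc_of_ht h h2 h3) (inc_of_ht h h5 h6)
      (inc_of_ht h (X := O') h2 (by rwa [e1])) (inc_of_ht h (X := O') h5 (by rwa [e2]))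
  · rcases Rim.eq_or_eq h hMN hM hN hN' with rfl | rfl
    · have t := sep_three h (hne hM hU) hMN (hne hM hV) (hne hN hU).symm (hne hN hV) hUV
      have s3 : Sep N' (ht h O N') (ht h O M') M' := s1.symm_right.symm_right.symm_right
      have := s2.swap.symm_right
      have := s3.symm_right
      grind only
    · exact absurd rfl hMN'

/-- Different lines through `O` share no rimpoint, so two common parallels through `O` must join the
ends of `l` to those of `n` bijectively. -/
theorem bow_of_common (h : Axioms Inc) {l n : L} {U V : Rim Inc} {O : Pt} (hUV : U ≠ V)
    (hU : ¬ U.On l) (hV : ¬ V.On l) (hUn : U.On n) (hVn : V.On n)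
    (hc : CommonParallelsMeetAt Inc l n O) : Bow h l U V O := by
  obtain ⟨c, d, hcd, h1, h2, h3, h4, hOc, hOd⟩ := hc
  obtain ⟨-, M, hMc, hMl⟩ := (par_iff_rim h).1 h1
  obtain ⟨-, N, hNd, hNl⟩ := (par_iff_rim h).1 h3
  obtain ⟨-, A, hAc, hAn⟩ := (par_iff_rim h).1 h2
  obtain ⟨-, B, hBd, hBn⟩ := (par_iff_rim h).1 h4
  have hMN : M ≠ N := by rintro rfl; exact hcd (Rim.line_eq h hMc hNd hOc hOd)
  have hAB : A ≠ B := by rintro rfl; exact hcd (Rim.line_eq h hAc hBd hOc hOd)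
  have hAl : ¬ A.On l := by
    intro e
    rcases Rim.eq_or_eq h hUV hUn hVn hAn with rfl | rfl
    · exact hU e
    · exact hV e
  have hBl : ¬ B.On l := by
    intro e
    rcases Rim.eq_or_eq h hUV hUn hVn hBn with rfl | rfl
    · exact hU e
    · exact hV e
  have e1 : ht h O M = A := ht_eq h hOc hMc hAc (by rintro rfl; exact hAl hMl)
  have e2 : ht h O N = B := ht_eq h hOd hNd hBd (by rintro rfl; exact hBl hNl)
  rcases Rim.eq_or_eq h hUV hUn hVn hAn with rfl | rfl
  · rcases Rim.eq_or_eq h hUV hUn hVn hBn with rfl | rfl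
    · exact absurd rfl hAB
    · exact ⟨M, N, hMN, hMl, hNl, e1, e2⟩
  · rcases Rim.eq_or_eq h hUV hUn hVn hBn with rfl | rfl
    · exact ⟨N, M, hMN.symm, hNl, hMl, e2, e1⟩
    · exact absurd rfl hAB

theorem isBowtie_iff (h : Axioms Inc) {l n : L} {U V : Rim Inc} {O : Pt} (hUV : U ≠ V)
    (hU : ¬ U.On l) (hV : ¬ V.On l) (hUn : U.On n) (hVn : V.On n) :
    IsBowtie Inc l n O ↔ Bow h l U V O := by
  constructor
  · rintro ⟨L₁, L₂, M₁, M₂, ⟨h1, h2, h3⟩, ⟨h4, h5, h6⟩, hO⟩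
    have e := hO.ht_eq h
    rcases Rim.eq_or_eq h hUV hUn hVn h5 with rfl | rfl
    · rcases Rim.eq_or_eq h hUV hUn hVn h6 with rfl | rfl
      · exact absurd rfl h4
      · exact ⟨L₂, L₁, h1.symm, h3, h2, e.2, e.1⟩
    · rcases Rim.eq_or_eq h hUV hUn hVn h6 with rfl | rfl
      · exact ⟨L₁, L₂, h1, h2, h3, e.1, e.2⟩
      · exact absurd rfl h4
  · rintro ⟨M, N, hMN, hM, hN, rfl, rfl⟩
    refine ⟨M, N, ht h O N, ht h O M, ⟨hMN, hM, hN⟩, ⟨hUV.symm, hVn, hUn⟩,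
      isMeet_ht h rfl rfl hMN.symm ?_⟩
    intro e
    exact hU (e ▸ hN)

theorem exists_foot (h : Axioms Inc) {l : L} {A : Rim Inc} (hA : ¬ A.On l) : ∃ R, Inc R l ∧
    ∀ S, Inc S l → S ≠ R → ∃ O, Bow h l (ht h R (ht h S A)) (ht h S (ht h R A)) O ∧
      ht h O A = ht h R A := by
  obtain ⟨R, ⟨hR, hS⟩, -⟩ := h.A11 A l hA
  refine ⟨R, hR, fun S hSl hSR => ?_⟩
  obtain ⟨B, C, U, V, n, k, O, h1, h2, h3, h4, ⟨hUV, hUn, hVn⟩, h6, hAk, hRk, hOk⟩ := hS S hSl hSR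
  rw [isHalfTurnImage_iff h] at h1 h2 h3 h4
  subst h1 h3 h2 h4
  refine ⟨O, bow_of_common h hUV ?_ ?_ hUn hVn h6, ht_eq h hOk hAk (ht_on h hRk hAk)
    (ht_ne h R A).symm⟩
  · rwa [ht_on_iff h hR, ht_on_iff h hSl]
  · rwa [ht_on_iff h hSl, ht_on_iff h hR]

/-- Axiom (A11) speaks only of translations RS with its special point `R`. Every translation PQ
along `l` is of this form, with S given by the product RPQ. -/
theorem exists_foot_translation (h : Axioms Inc) {l : L} {A : Rim Inc} (hA : ¬ A.On l) :
    ∃ R, Inc R l ∧ ∀ P Q, Inc P l → Inc Q l → P ≠ Q →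
      ∃ O, Bow h l (ht h P (ht h Q A)) (ht h Q (ht h P A)) O ∧ ht h O A = ht h R A := by
  obtain ⟨R, hR, hf⟩ := exists_foot h hA
  refine ⟨R, hR, fun P Q hP hQ hPQ => ?_⟩
  obtain ⟨S, hS, e⟩ := exists_three_ht h hR hP hQ
  have e1 : ht h P * ht h Q = ht h R * ht h S := by rw [← e]; simp [← mul_assoc]
  have e2 : ht h Q * ht h P = ht h S * ht h R := by
    have := congrArg (·⁻¹) e1
    simpa using this
  have hSR : S ≠ R := by
    rintro rfl
    rw [ht_mul_self, mul_eq_one_iff_eq_inv, ht_inv] at e1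
    exact hPQ (ht_injective h e1)
  obtain ⟨O, h1, h2⟩ := hf S hS hSR
  refine ⟨O, ?_, h2⟩
  rwa [← Equiv.Perm.mul_apply, ← Equiv.Perm.mul_apply (ht h Q), e1, e2]

theorem refl_exists (h : Axioms Inc) (l : L) (A : Rim Inc) : ∃ B, (A.On l → B = A) ∧
    (¬ A.On l → ∃ R, Inc R l ∧ B = ht h R A ∧ ∀ P Q, Inc P l → Inc Q l → P ≠ Q →
      ∃ O, Bow h l (ht h P (ht h Q A)) (ht h Q (ht h P A)) O ∧ ht h O A = ht h R A) := by
  by_cases hA : A.On l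
  · exact ⟨A, fun _ => rfl, fun e => absurd hA e⟩
  · obtain ⟨R, hR, hf⟩ := exists_foot_translation h hA
    exact ⟨ht h R A, fun e => absurd e hA, fun _ => ⟨R, hR, rfl, hf⟩⟩

/-- The reflection in a line, as a map. -/
noncomputable def reflFun (h : Axioms Inc) (l : L) (A : Rim Inc) : Rim Inc :=
  (refl_exists h l A).choose

theorem reflFun_on (h : Axioms Inc) {l : L} {A : Rim Inc} (hA : A.On l) : reflFun h l A = A :=
  (refl_exists h l A).choose_spec.1 hA

theorem reflFun_off (h : Axioms Inc) {l : L} {A : Rim Inc} (hA : ¬ A.On l) :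
    ∃ R, Inc R l ∧ reflFun h l A = ht h R A :=
  let ⟨R, h1, h2, _⟩ := (refl_exists h l A).choose_spec.2 hA
  ⟨R, h1, h2⟩

theorem reflFun_exists_bow (h : Axioms Inc) {l : L} {A : Rim Inc} {P Q : Pt} (hA : ¬ A.On l)
    (hP : Inc P l) (hQ : Inc Q l) (hPQ : P ≠ Q) :
    ∃ O, Bow h l (ht h P (ht h Q A)) (ht h Q (ht h P A)) O ∧ reflFun h l A = ht h O A := by
  obtain ⟨R, -, h2, h3⟩ := (refl_exists h l A).choose_spec.2 hA
  obtain ⟨O, h4, h5⟩ := h3 P Q hP hQ hPQ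
  exact ⟨O, h4, h2.trans h5.symm⟩

theorem reflFun_eq (h : Axioms Inc) {l : L} {A : Rim Inc} {P Q O : Pt} (hA : ¬ A.On l)
    (hP : Inc P l) (hQ : Inc Q l) (hPQ : P ≠ Q)
    (hO : Bow h l (ht h P (ht h Q A)) (ht h Q (ht h P A)) O) : reflFun h l A = ht h O A := by
  obtain ⟨O', h1, h2⟩ := reflFun_exists_bow h hA hP hQ hPQ
  rw [hO.unique h _ _ h1, h2]
  · rwa [ht_on_iff h hP, ht_on_iff h hQ]
  · rwa [ht_on_iff h hQ, ht_on_iff h hP]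

theorem motion_inc (h : Axioms Inc) {g : Equiv.Perm (Rim Inc)} {φ : Equiv.Perm Pt}
    (hφ : ∀ X, g * ht h X * g⁻¹ = ht h (φ X)) {l l' : L} (hg : ∀ A, (g A).On l' ↔ A.On l) {X : Pt} :
    Inc (φ X) l' ↔ Inc X l := by
  have e : ∀ A, ht h (φ X) (g A) = g (ht h X A) := fun A => by rw [← hφ]; simp
  constructor
  · intro hX
    have h1 := rim_on h l True
    refine inc_of_ht h h1 ?_
    rw [← hg, ← e, ht_on_iff h hX]
    exact (hg _).2 h1
  · intro hX
    have h1 := rim_on h l True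
    refine inc_of_ht h ((hg _).2 h1) ?_
    rwa [e, hg, ht_on_iff h hX]

/-- The reflection is determined by half-turns about points of `l` and by incidence, all of which a
motion transports. In particular it commutes with half-turns about points of its axis, which makes
it an involution. -/
theorem reflFun_motion (h : Axioms Inc) {g : Equiv.Perm (Rim Inc)} (hgm : g ∈ motions h) {l l' : L}
    (hg : ∀ A, (g A).On l' ↔ A.On l) (A : Rim Inc) : reflFun h l' (g A) = g (reflFun h l A) := by
  by_cases hA : A.On l
  · rw [reflFun_on h hA, reflFun_on h ((hg A).2 hA)]
  obtain ⟨φ, hφ⟩ := hgm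
  have e : ∀ X A, ht h (φ X) (g A) = g (ht h X A) := fun X A => by rw [← hφ]; simp
  obtain ⟨P, hP⟩ := h.A2 l
  obtain ⟨Q, hQP, hQ⟩ := h.exists_ne_on l P
  obtain ⟨O, ⟨M, N, hMN, hM, hN, e1, e2⟩, hO⟩ := reflFun_exists_bow h hA hP hQ hQP.symm
  rw [hO, ← e]
  refine reflFun_eq h (fun e => hA ((hg A).1 e)) ((motion_inc h hφ hg).2 hP)
    ((motion_inc h hφ hg).2 hQ) (fun e => hQP (φ.injective e).symm) ⟨g M, g N,
      fun e => hMN (g.injective e), (hg M).2 hM, (hg N).2 hN, ?_, ?_⟩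
  · rw [e, e, e, e1]
  · rw [e, e, e, e2]

theorem reflFun_ht (h : Axioms Inc) {l : L} {S : Pt} (hS : Inc S l) (A : Rim Inc) :
    reflFun h l (ht h S A) = ht h S (reflFun h l A) :=
  reflFun_motion h (ht_mem_motions h S) (fun _ => ht_on_iff h hS) A

/-- The reflection in a line, as a permutation of the rimpoints. -/
noncomputable def refl (h : Axioms Inc) (l : L) : Equiv.Perm (Rim Inc) :=
  Function.Involutive.toPerm (reflFun h l) fun A => by
    by_cases hA : A.On l
    · rw [reflFun_on h hA, reflFun_on h hA]
    · obtain ⟨R, hR, e⟩ := reflFun_off h hA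
      rw [e, reflFun_ht h hR, e, ht_ht]

@[simp] theorem refl_refl (h : Axioms Inc) (l : L) (A : Rim Inc) : refl h l (refl h l A) = A :=
  (refl h l).left_inv A

@[simp] theorem refl_mul_self (h : Axioms Inc) (l : L) : refl h l * refl h l = 1 :=
  Equiv.ext fun A => refl_refl h l A

@[simp] theorem refl_inv (h : Axioms Inc) (l : L) : (refl h l)⁻¹ = refl h l :=
  inv_eq_of_mul_eq_one_left (refl_mul_self h l)

theorem refl_on (h : Axioms Inc) {l : L} {A : Rim Inc} (hA : A.On l) : refl h l A = A :=
  reflFun_on h hA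

theorem refl_off (h : Axioms Inc) {l : L} {A : Rim Inc} (hA : ¬ A.On l) :
    ∃ R, Inc R l ∧ refl h l A = ht h R A := reflFun_off h hA

theorem refl_eq_self (h : Axioms Inc) {l : L} {A : Rim Inc} : refl h l A = A ↔ A.On l := by
  refine ⟨fun e => ?_, refl_on h⟩
  by_contra hA
  obtain ⟨R, hR, e'⟩ := refl_off h hA
  exact ht_ne h R A (e'.symm.trans e)

theorem refl_exists_bow (h : Axioms Inc) {l : L} {A : Rim Inc} {P Q : Pt} (hA : ¬ A.On l)
    (hP : Inc P l) (hQ : Inc Q l) (hPQ : P ≠ Q) :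
    ∃ O, Bow h l (ht h P (ht h Q A)) (ht h Q (ht h P A)) O ∧ refl h l A = ht h O A :=
  reflFun_exists_bow h hA hP hQ hPQ

theorem refl_eq (h : Axioms Inc) {l : L} {A : Rim Inc} {P Q O : Pt} (hA : ¬ A.On l)
    (hP : Inc P l) (hQ : Inc Q l) (hPQ : P ≠ Q)
    (hO : Bow h l (ht h P (ht h Q A)) (ht h Q (ht h P A)) O) : refl h l A = ht h O A :=
  reflFun_eq h hA hP hQ hPQ hO

theorem refl_motion (h : Axioms Inc) {g : Equiv.Perm (Rim Inc)} (hgm : g ∈ motions h) {l l' : L}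
    (hg : ∀ A, (g A).On l' ↔ A.On l) : g * refl h l * g⁻¹ = refl h l' := by
  rw [mul_inv_eq_iff_eq_mul]
  exact Equiv.ext fun A => (reflFun_motion h hgm hg A).symm

theorem refl_mul_ht (h : Axioms Inc) {l : L} {S : Pt} (hS : Inc S l) :
    refl h l * ht h S = ht h S * refl h l := Equiv.ext fun A => reflFun_ht h hS A

theorem refl_ht (h : Axioms Inc) {l : L} {S : Pt} (hS : Inc S l) (A : Rim Inc) :
    refl h l (ht h S A) = ht h S (refl h l A) := reflFun_ht h hS A

theorem refl_injective (h : Axioms Inc) : Function.Injective (refl h) := by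
  intro l m e
  obtain ⟨N, h1, h2, -⟩ := Rim.exists_other h (rim_on h l True)
  refine Rim.join_unique h h1.symm (rim_on h l True) h2 ?_ ?_
  · rw [← refl_eq_self h, ← e, refl_eq_self h]; exact rim_on h l True
  · rw [← refl_eq_self h, ← e, refl_eq_self h]; exact h2

theorem refl_isLineReflection (h : Axioms Inc) (l : L) : IsLineReflection l (refl h l) := by
  refine ⟨fun A hA => refl_on h hA, fun A hA α hα => ?_⟩
  obtain ⟨P, Q, hP, hQ, hPQ, rfl⟩ := hα.exists_eq h
  obtain ⟨O, h1, h2⟩ := refl_exists_bow h hA hP hQ hPQ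
  have hne : ht h P (ht h Q A) ≠ ht h Q (ht h P A) := ht_ht_ne h hP hQ hPQ hA
  obtain ⟨n, h3, h4⟩ := Rim.exists_join h hne
  refine ⟨n, O, ⟨?_, ?_, ?_⟩, ?_, (isHalfTurnImage_iff h).2 h2.symm⟩
  · simpa using hne
  · simpa using h3
  · simpa using h4
  · exact (isBowtie_iff h hne (by rwa [ht_on_iff h hP, ht_on_iff h hQ])
      (by rwa [ht_on_iff h hQ, ht_on_iff h hP]) h3 h4).2 h1

theorem isLineReflection_iff (h : Axioms Inc) {l : L} {σ : Rim Inc → Rim Inc} :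
    IsLineReflection l σ ↔ σ = refl h l := by
  constructor
  · rintro ⟨h1, h2⟩
    funext A
    by_cases hA : A.On l
    · rw [h1 A hA, refl_on h hA]
    obtain ⟨P, hP⟩ := h.A2 l
    obtain ⟨Q, hQP, hQ⟩ := h.exists_ne_on l P
    obtain ⟨n, O, ⟨h3, h4, h5⟩, h6, h7⟩ := h2 A hA _ (translation_isAxial h hP hQ hQP.symm)
    simp only [mul_inv_rev, ht_inv, Equiv.Perm.mul_apply] at h3 h4 h5
    rw [isHalfTurnImage_iff h] at h7
    rw [← h7, refl_eq h hA hP hQ hQP.symm]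
    exact (isBowtie_iff h h3 (by rwa [ht_on_iff h hP, ht_on_iff h hQ])
      (by rwa [ht_on_iff h hQ, ht_on_iff h hP]) h4 h5).1 h6
  · rintro rfl
    exact refl_isLineReflection h l

theorem perp_iff (h : Axioms Inc) {l m : L} :
    Perp Inc l m ↔ ∃ A : Rim Inc, A.On m ∧ ¬ A.On l ∧ (refl h l A).On m := by
  constructor
  · rintro ⟨-, σ, hσ, M, N, ⟨h1, h2, h3⟩, h4, h5⟩
    rw [isLineReflection_iff h] at hσ
    subst hσ
    refine ⟨M, h2, fun e => h1 ?_, h4 ▸ h3⟩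
    rw [← h4, refl_on h e]
  · rintro ⟨A, h1, h2, h3⟩
    obtain ⟨R, hR, e⟩ := refl_off h h2
    refine ⟨⟨R, hR, inc_of_ht h h1 (e ▸ h3)⟩, _, refl_isLineReflection h l, A, refl h l A,
      ⟨?_, h1, h3⟩, rfl, refl_refl h l A⟩
    rw [e]
    exact (ht_ne h R A).symm

end LineReflections
end HypInc


namespace HypInc

/-! ### Perpendicular lines, midpoints and the action of reflections on points. -/

section Perpendiculars

variable {Pt L : Type*} {Inc : Pt → L → Prop}

theorem perp_of_refl (h : Axioms Inc) {l k : L} {A : Rim Inc} {R : Pt} (hA : ¬ A.On l)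
    (hAk : A.On k) (hR : Inc R k) (he : refl h l A = ht h R A) : Perp Inc l k :=
  (perp_iff h).2 ⟨A, hAk, hA, by rw [he]; exact ht_on h hR hAk⟩

theorem Perp.exists_foot (h : Axioms Inc) {l k : L} (hp : Perp Inc l k) :
    ∃ R, Inc R l ∧ Inc R k ∧ l ≠ k ∧ ∀ A : Rim Inc, A.On k → ¬ A.On l ∧ refl h l A = ht h R A := by
  obtain ⟨A, h1, h2, h3⟩ := (perp_iff h).1 hp
  obtain ⟨R, hR, e⟩ := refl_off h h2
  have hRk : Inc R k := inc_of_ht h h1 (e ▸ h3)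
  have hlk : l ≠ k := by rintro rfl; exact h2 h1
  refine ⟨R, hR, hRk, hlk, fun B hB => ⟨fun e => hlk (Rim.line_eq h e hB hR hRk), ?_⟩⟩
  rcases Rim.eq_or_eq h (ht_ne h R A).symm h1 (ht_on h hRk h1) hB with rfl | rfl
  · exact e
  · rw [refl_ht h hR, e]

theorem Perp.refl_eq_ht (h : Axioms Inc) {l k : L} (hp : Perp Inc l k) {R : Pt} (hRl : Inc R l)
    (hRk : Inc R k) {A : Rim Inc} (hA : A.On k) : refl h l A = ht h R A := by
  obtain ⟨R', h1, h2, h3, h4⟩ := hp.exists_foot h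
  rw [h.pt_eq h3 hRl hRk h1 h2]
  exact (h4 A hA).2

theorem perp_core (h : Axioms Inc) {l k : L} {A : Rim Inc} {R S : Pt} (hA : ¬ A.On l)
    (hAk : A.On k) (hRl : Inc R l) (hRk : Inc R k) (he : refl h l A = ht h R A) (hS : Inc S l)
    (hSR : S ≠ R) : ∃ M N O, M ≠ N ∧ M.On l ∧ N.On l ∧ ¬ M.On k ∧ Inc O k ∧
      ht h O M = ht h R (ht h S A) ∧ ht h O N = ht h S (ht h R A) ∧ refl h k M = N := by
  obtain ⟨O, ⟨M, N, hMN, hM, hN, e1, e2⟩, e3⟩ := refl_exists_bow h hA hRl hS hSR.symm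
  have hlk : l ≠ k := by rintro rfl; exact hA hAk
  have hMk : ¬ M.On k := fun e => hlk (Rim.line_eq h hM e hRl hRk)
  have e4 : ht h O A = ht h R A := e3.symm.trans he
  have hOk : Inc O k := inc_of_ht h hAk (by rw [e4]; exact ht_on h hRk hAk)
  have hRM : ht h R M = N := ht_eq h hRl hM hN hMN
  have hSM : ht h S M = N := ht_eq h hS hM hN hMN
  have hOR : R ≠ O := by
    rintro rfl
    have : (ht h R (ht h S A)).On l := by rw [← e1, hRM]; exact hN
    rw [ht_on_iff h hRl, ht_on_iff h hS] at this
    exact hA this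
  refine ⟨M, N, O, hMN, hM, hN, hMk, hOk, e1, e2, ?_⟩
  -- The equations saying that `O` determines the reflection of A in `l` through the translation RS
  -- also say that `S` determines the reflection of M in `k` through the translation RO.
  rw [refl_eq h hMk hRk hOk hOR (O := S), hSM]
  refine ⟨A, ht h R A, (ht_ne h R A).symm, hAk, ht_on h hRk hAk, ?_, ?_⟩
  · rw [e1, ht_ht]
  · rw [hRM, e2]

theorem Perp.symm (h : Axioms Inc) {l k : L} (hp : Perp Inc l k) : Perp Inc k l := by
  obtain ⟨R, hRl, hRk, hlk, hR⟩ := hp.exists_foot h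
  obtain ⟨S, hSR, hS⟩ := h.exists_ne_on l R
  obtain ⟨A, hA⟩ : ∃ A : Rim Inc, A.On k := ⟨_, rim_on h k True⟩
  obtain ⟨M, N, O, -, hM, hN, hMk, -, -, -, e⟩ :=
    perp_core h (hR A hA).1 hA hRl hRk (hR A hA).2 hS hSR
  exact (perp_iff h).2 ⟨M, hM, hMk, e ▸ hN⟩

/-- The product of the reflections in two perpendicular lines is a half-turn. -/
theorem Perp.refl_eq (h : Axioms Inc) {l k : L} (hp : Perp Inc l k) {R : Pt} (hRl : Inc R l)
    (hRk : Inc R k) : refl h k = ht h R * refl h l := by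
  ext1 X
  rw [Equiv.Perm.mul_apply]
  by_cases hX : X.On l
  · rw [refl_on h hX, (hp.symm h).refl_eq_ht h hRk hRl hX]
  by_cases hXk : X.On k
  · rw [refl_on h hXk, hp.refl_eq_ht h hRl hRk hXk, ht_ht]
  -- Choose the end B of `k` across `l` from X, so that X = B^S. With `perp_core` for the other end
  -- of `k`, X is N^O and the desired image is M^O, where σ_k interchanges M and N and commutes with
  -- the half-turn about `O` on `k`.
  obtain ⟨B, hB, hs⟩ : ∃ B : Rim Inc, B.On k ∧ ¬ (rside l B ↔ rside l X) := by
    obtain ⟨R', h1, h2, h3, h4⟩ := hp.exists_foot h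
    have hB := rim_on h k True
    have := rside_ht h hRl (h4 _ hB).1
    by_cases hc : rside l (rim h k True) ↔ rside l X
    · exact ⟨_, ht_on h hRk hB, by grind only⟩
    · exact ⟨_, hB, hc⟩
  have hBl : ¬ B.On l := by
    obtain ⟨R', h1, h2, h3, h4⟩ := hp.exists_foot h
    exact (h4 B hB).1
  obtain ⟨S, hS, e⟩ := exists_ht h hBl hX hs
  have hSR : S ≠ R := by
    rintro rfl
    exact hXk (e ▸ ht_on h hRk hB)
  have hA := ht_on h hRk hB
  obtain ⟨M, N, O, -, hM, hN, hMk, hO, e1, e2, e3⟩ :=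
    perp_core h (fun e => hBl ((ht_on_iff h hRl).1 e)) hA hRl hRk
      (hp.refl_eq_ht h hRl hRk hA) hS hSR
  rw [ht_ht, e] at e2
  rw [← e, refl_ht h hS, hp.refl_eq_ht h hRl hRk hB, ← e1, e, ← e2, refl_ht h hO, ← e3, refl_refl]

theorem Perp.unique (h : Axioms Inc) {l k k' : L} (hp : Perp Inc l k) (hp' : Perp Inc l k')
    {R : Pt} (hRl : Inc R l) (hRk : Inc R k) (hRk' : Inc R k') : k = k' :=
  refl_injective h (by rw [hp.refl_eq h hRl hRk, hp'.refl_eq h hRl hRk'])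

/-- No line meets all three sides of an ideal triangle: two sides lie on the same side of the third
because they share a rimpoint off it, so none of the three intersection points could be between the
others. -/
theorem collinear_triangle (h : Axioms Inc) {l m d k : L} {A B O : Pt} {M N N' : Rim Inc}
    (hA : Inc A l) (hB : Inc B m) (hO : Inc O d) (hAk : Inc A k) (hBk : Inc B k) (hOk : Inc O k)
    (hMl : M.On l) (hMm : M.On m) (hNl : N.On l) (hNd : N.On d) (hNm' : N'.On m) (hNd' : N'.On d)
    (hlm : l ≠ m) (hld : l ≠ d) (hmd : m ≠ d) (hMN : M ≠ N) (hMN' : M ≠ N') :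
    False := by
  have hAm : ¬ Inc A m := fun e => hlm (Rim.line_eq h hMl hMm hA e)
  have hBl : ¬ Inc B l := fun e => hlm (Rim.line_eq h hMl hMm e hB)
  have hAd : ¬ Inc A d := fun e => hld (Rim.line_eq h hNl hNd hA e)
  have hOl : ¬ Inc O l := fun e => hld (Rim.line_eq h hNl hNd e hO)
  have hBd : ¬ Inc B d := fun e => hmd (Rim.line_eq h hNm' hNd' hB e)
  have hOm : ¬ Inc O m := fun e => hmd (Rim.line_eq h hNm' hNd' e hO)
  have hNm : ¬ N.On m := fun e => hlm (Rim.join_unique h hMN hMl hNl hMm e)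
  have hNl' : ¬ N'.On l := fun e => hlm (Rim.join_unique h hMN' hMl e hMm hNm')
  have hMd : ¬ M.On d := fun e => hld (Rim.join_unique h hMN hMl hNl e hNd)
  have s1 := rside_of_miss h hNl hNm (Rim.miss h hMl hMm hlm) hA
  have s2 := rside_of_miss h hNd hNm (Rim.miss h hNd' hNm' hmd.symm) hO
  have s3 := rside_of_miss h hNm' hNl' (Rim.miss h hMm hMl hlm.symm) hB
  have s4 := rside_of_miss h hNd' hNl' (Rim.miss h hNd hNl hld.symm) hO
  have s5 := rside_of_miss h hMl hMd (Rim.miss h hNl hNd hld) hA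
  have s6 := rside_of_miss h hMm hMd (Rim.miss h hNm' hNd' hmd) hB
  have hAB : A ≠ B := by rintro rfl; exact hBl hA
  have hAO : A ≠ O := by rintro rfl; exact hOl hA
  have hBO : B ≠ O := by rintro rfl; exact hOm hB
  have t1 := btw_iff h hAm hOm hB hAk hBk hOk
  have t2 := btw_iff h hBl hOl hA hBk hAk hOk
  have t3 := btw_iff h hAd hBd hO hAk hOk hBk
  rcases h.btw_cases hAB hBO hAO hAk hBk hOk with hb | hb | hb <;> grind only

/-- If the two parallels through `O` shared a rimpoint of `l` and `m`, an ideal triangle with a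
transversal would arise. So `O` maps the ends of `l` to those of `m`; the conjugate of the half-turn
about `A` then interchanges the ends of `m` and is centred where `m` meets `k`, at `B`. -/
theorem exists_midpoint (h : Axioms Inc) {A B : Pt} {k : L} (hAk : Inc A k) (hBk : Inc B k) :
    ∃ O, Inc O k ∧ ht h O * ht h A * ht h O = ht h B := by
  by_cases hAB : A = B
  · subst hAB
    exact ⟨A, hAk, by simp⟩
  obtain ⟨l, m, k', O, hA, hB, hAk', hBk', ⟨c, d, hcd, h1, h2, h3, h4, hOc, hOd⟩, hOk⟩ :=
    h.A10 A B hAB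
  have := h.line_eq hAB hAk hBk hAk' hBk'
  subst this
  obtain ⟨hcl, M, hMc, hMl⟩ := (par_iff_rim h).1 h1
  obtain ⟨hdl, N, hNd, hNl⟩ := (par_iff_rim h).1 h3
  obtain ⟨hcm, M', hMc', hMm⟩ := (par_iff_rim h).1 h2
  obtain ⟨hdm, N', hNd', hNm⟩ := (par_iff_rim h).1 h4
  have ne : ∀ {X Y : Rim Inc}, X.On c → Y.On d → X ≠ Y := by
    rintro X Y hX hY rfl; exact hcd (Rim.line_eq h hX hY hOc hOd)
  have hOl : ¬ Inc O l := fun e => hcl (Rim.line_eq h hMc hMl hOc e)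
  have hOm : ¬ Inc O m := fun e => hcm (Rim.line_eq h hMc' hMm hOc e)
  have hlm : l ≠ m := by
    rintro rfl
    exact hOl (by rwa [h.line_eq hAB hA hB hAk hBk])
  by_cases hMM : M = M'
  · subst hMM
    exact (collinear_triangle h hA hB hOd hAk hBk hOk hMl hMm hNl hNd hNm hNd' hlm hdl.symm hdm.symm
      (ne hMc hNd) (ne hMc hNd')).elim
  by_cases hNN : N = N'
  · subst hNN
    exact (collinear_triangle h hA hB hOc hAk hBk hOk hNl hNm hMl hMc hMm hMc' hlm hcl.symm hcm.symm
      (ne hMc hNd).symm (ne hMc' hNd).symm).elim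
  have e1 : ht h O M = M' := ht_eq h hOc hMc hMc' hMM
  have e2 : ht h O N = N' := ht_eq h hOd hNd hNd' hNN
  obtain ⟨X, hX, e⟩ := exists_ht_conj h hOk hAk
  have e3 : ht h X M' = N' := by
    rw [← e, Equiv.Perm.mul_apply, Equiv.Perm.mul_apply, ← e1, ht_ht,
      ht_eq h hA hMl hNl (ne hMc hNd), e2]
  have hXm : Inc X m := inc_of_ht h hMm (e3 ▸ hNm)
  have hkm : k ≠ m := by rintro rfl; exact hOm hOk
  rw [h.pt_eq hkm hBk hB hX hXm]
  exact ⟨O, hOk, e⟩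

theorem exists_sqrt (h : Axioms Inc) {l : L} {P Q : Pt} (hP : Inc P l) (hQ : Inc Q l) :
    ∃ M, Inc M l ∧ ht h P * ht h Q = (ht h P * ht h M) * (ht h P * ht h M) := by
  obtain ⟨M, hM, e⟩ := exists_midpoint h hP hQ
  exact ⟨M, hM, by rw [← e]; simp only [mul_assoc]⟩

theorem Perp.motion (h : Axioms Inc) {g : Equiv.Perm (Rim Inc)} (hgm : g ∈ motions h)
    {l l' m m' : L} (hl : ∀ A, (g A).On l' ↔ A.On l) (hm : ∀ A, (g A).On m' ↔ A.On m)
    (hp : Perp Inc l m) : Perp Inc l' m' := by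
  obtain ⟨A, h1, h2, h3⟩ := (perp_iff h).1 hp
  refine (perp_iff h).2 ⟨g A, (hm A).2 h1, fun e => h2 ((hl A).1 e), ?_⟩
  rw [← refl_motion h hgm hl]
  simpa [hm] using h3

theorem Rim.line_ext (h : Axioms Inc) {l m : L} (he : ∀ A : Rim Inc, A.On l ↔ A.On m) : l = m := by
  obtain ⟨N, h1, h2, -⟩ := Rim.exists_other h (rim_on h l True)
  exact Rim.join_unique h h1 h2 (rim_on h l True) ((he _).1 h2) ((he _).1 (rim_on h l True))

/-- The permutation of the lines induced by a permutation of the rimpoints. -/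
theorem exists_line_perm (h : Axioms Inc) (g : Equiv.Perm (Rim Inc)) :
    ∃ ψ : Equiv.Perm L, ∀ A l, (g A).On (ψ l) ↔ A.On l := by
  have key : ∀ (g : Equiv.Perm (Rim Inc)) l, ∃ m : L, ∀ A, (g A).On m ↔ A.On l := by
    intro g l
    have h0 := rim_on h l True
    obtain ⟨N, h1, h2, h3⟩ := Rim.exists_other h h0
    obtain ⟨m, h4, h5⟩ := Rim.exists_join h (fun e => h1 (g.injective e))
    refine ⟨m, fun A => ⟨fun hA => ?_, fun hA => ?_⟩⟩
    · rcases Rim.eq_or_eq h (fun e => h1 (g.injective e)) h4 h5 hA with e | e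
      · exact g.injective e ▸ h2
      · exact g.injective e ▸ h0
    · rcases h3 A hA with rfl | rfl
      · exact h5
      · exact h4
  choose f hf using key
  refine ⟨⟨f g, f g⁻¹, fun l => Rim.line_ext h fun A => ?_, fun l => Rim.line_ext h fun A => ?_⟩,
    fun A l => hf g l A⟩
  · have := hf g⁻¹ (f g l) (g A)
    rw [show g⁻¹ (g A) = A from g.symm_apply_apply A] at this
    exact this.trans (hf g l A)
  · have := hf g (f g⁻¹ l) (g⁻¹ A)
    rw [show g (g⁻¹ A) = A from g.apply_symm_apply A] at this
    exact this.trans (hf g⁻¹ l A)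

/-- The foot `R` of any rimpoint off `l` carries some perpendicular; the half-turn about the
midpoint of `R` and `T` moves it to `T`. -/
theorem exists_perp_at (h : Axioms Inc) {l : L} {T : Pt} (hT : Inc T l) :
    ∃ k, Inc T k ∧ Perp Inc l k := by
  obtain ⟨A, hA⟩ := exists_rim_not_on h l
  obtain ⟨R, hR, e⟩ := refl_off h hA
  obtain ⟨k, hRk, hAk⟩ := A.exists_line h R
  have hp := perp_of_refl h hA hAk hRk e
  obtain ⟨M, hM, e⟩ := exists_midpoint h hR hT
  obtain ⟨ψ, hψ⟩ := exists_line_perm h (ht h M)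
  refine ⟨ψ k, ?_, hp.motion h (ht_mem_motions h M) (fun _ => ht_on_iff h hM) fun A => hψ A k⟩
  refine inc_of_ht h ((hψ A k).2 hAk) ?_
  have : ht h T (ht h M A) = ht h M (ht h R A) := by
    rw [← e]; simp
  rw [this, hψ]
  exact ht_on h hRk hAk

/-- For `P` off `l`, the half-turn about `P` takes the ends of `l` to two rimpoints on one side of
`l`. Let A be halfway along the translation from one to the other. Then `P` is the point that
determines σ_l at A, so `PA` is perpendicular to `l`. -/
theorem exists_perp (h : Axioms Inc) (P : Pt) (l : L) : ∃ k, Inc P k ∧ Perp Inc l k := by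
  by_cases hP : Inc P l
  · exact exists_perp_at h hP
  obtain ⟨N, h1, hN, -⟩ := Rim.exists_other h (rim_on h l True)
  have hM := rim_on h l True
  have off : ∀ {A : Rim Inc}, A.On l → ¬ (ht h P A).On l := fun hA e => hP (inc_of_ht h hA e)
  have sd : ∀ {A : Rim Inc}, A.On l → (rside l (ht h P A) ↔ side Inc l P) := by
    intro A hA
    obtain ⟨c, hPc, hAc⟩ := A.exists_line h P
    have hcl : c ≠ l := by rintro rfl; exact hP hPc
    exact rside_of_miss h (ht_on h hPc hAc) (off hA) (Rim.miss h hAc hA hcl) hPc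
  obtain ⟨Q, hQ⟩ := h.A2 l
  obtain ⟨X, hX, e⟩ := exists_translation h hQ (off hM) (off hN) ((sd hM).trans (sd hN).symm)
  obtain ⟨Y, hY, e'⟩ := exists_sqrt h hX hQ
  have e2 : ht h X (ht h Y (ht h X (ht h Y (ht h P (rim h l True))))) = ht h P N := by
    rw [← e, ← Equiv.Perm.mul_apply (ht h X) (ht h Q), e']; rfl
  have hXY : X ≠ Y := by
    rintro rfl
    rw [ht_ht, ht_ht] at e2
    exact h1 ((ht h P).injective e2).symm
  have hA : ¬ (ht h X (ht h Y (ht h P (rim h l True)))).On l := by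
    rw [ht_on_iff h hX, ht_on_iff h hY]; exact off hM
  obtain ⟨k, hPk, hAk⟩ := Rim.exists_line h (ht h X (ht h Y (ht h P (rim h l True)))) P
  exact ⟨k, hPk, perp_of_refl h hA hAk hPk (refl_eq h hA hX hY hXY
    ⟨N, rim h l True, h1, hN, hM, e2.symm, by rw [ht_ht, ht_ht]⟩)⟩

/-- Let `k` be the perpendicular to `a` through `X`, with foot `R`. Then σ_a is the half-turn about
`R` times σ_k, and σ_k commutes with the half-turn about `X`; so conjugating by σ_a amounts to
conjugating by `R`. -/
theorem refl_mem_motions (h : Axioms Inc) (a : L) : refl h a ∈ motions h := by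
  have key : ∀ X, ∃ Y, refl h a * ht h X * refl h a = ht h Y := fun X => by
    obtain ⟨k, hX, hp⟩ := exists_perp h X a
    obtain ⟨R, hRa, hRk, -⟩ := hp.exists_foot h
    obtain ⟨Y, -, e⟩ := exists_ht_conj h hRk hX
    refine ⟨Y, ?_⟩
    have e1 := (hp.symm h).refl_eq h hRk hRa
    calc refl h a * ht h X * refl h a
        = ht h R * (refl h k * ht h X) * refl h a := by rw [e1]; simp only [mul_assoc]
      _ = ht h R * ht h X * (refl h k * refl h a) := by
        rw [refl_mul_ht h hX]; simp only [mul_assoc]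
      _ = ht h R * ht h X * ht h R := by
        rw [hp.refl_eq h hRa hRk, mul_assoc (ht h R) (refl h a), refl_mul_self, mul_one]
      _ = ht h Y := e
  choose f hf using key
  have hff : ∀ X, f (f X) = X := fun X => by
    apply ht_injective h
    rw [← hf, ← hf]
    simp only [mul_assoc, refl_mul_self, mul_one]
    rw [← mul_assoc, refl_mul_self, one_mul]
  exact ⟨⟨f, f, hff, hff⟩, fun X => by rw [refl_inv]; exact hf X⟩

end Perpendiculars
end HypInc


namespace HypInc

/-! ### Collineations, and reflections of the metric plane. -/

section Collineations

variable {Pt L : Type*} {Inc : Pt → L → Prop} {φ : Equiv.Perm Pt} {ψ : Equiv.Perm L}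

theorem meets_map (hc : ∀ X l, Inc X l ↔ Inc (φ X) (ψ l)) (a b : L) :
    Meets Inc a b ↔ Meets Inc (ψ a) (ψ b) :=
  φ.exists_congr fun X => by rw [hc, hc X b]

theorem collinear_map (hc : ∀ X l, Inc X l ↔ Inc (φ X) (ψ l)) (A B C : Pt) :
    Collinear Inc A B C ↔ Collinear Inc (φ A) (φ B) (φ C) :=
  ψ.exists_congr fun l => by rw [hc A, hc B, hc C]

theorem pierces_map (hc : ∀ X l, Inc X l ↔ Inc (φ X) (ψ l)) (A B C : Pt) :
    Pierces Inc A B C ↔ Pierces Inc (φ A) (φ B) (φ C) :=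
  ψ.forall_congr fun a => ψ.forall_congr fun c => ψ.forall_congr fun g => by
    rw [hc A, hc B, hc C, meets_map hc, meets_map hc g, meets_map hc g]

theorem between_map (hc : ∀ X l, Inc X l ↔ Inc (φ X) (ψ l)) (A B C : Pt) :
    Between Inc A B C ↔ Between Inc (φ A) (φ B) (φ C) := by
  rw [Between, Between, φ.injective.ne_iff, φ.injective.ne_iff, φ.injective.ne_iff,
    collinear_map hc, pierces_map hc]

theorem meetsSet_ray_map (hc : ∀ X l, Inc X l ↔ Inc (φ X) (ψ l)) (g : L) (R X : Pt) :
    MeetsSet Inc g (ray Inc R X) ↔ MeetsSet Inc (ψ g) (ray Inc (φ R) (φ X)) :=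
  φ.exists_congr fun _ => and_congr (or_congr φ.injective.eq_iff.symm
    (or_congr φ.injective.eq_iff.symm (or_congr (between_map hc _ _ _) (between_map hc _ _ _))))
    (hc _ _)

theorem meetsSet_segment_map (hc : ∀ X l, Inc X l ↔ Inc (φ X) (ψ l)) (g : L) (R X : Pt) :
    MeetsSet Inc g (segment Inc R X) ↔ MeetsSet Inc (ψ g) (segment Inc (φ R) (φ X)) :=
  φ.exists_congr fun _ => and_congr (or_congr φ.injective.eq_iff.symm
    (or_congr φ.injective.eq_iff.symm (between_map hc _ _ _))) (hc _ _)

theorem parRays_map (hc : ∀ X l, Inc X l ↔ Inc (φ X) (ψ l)) (R X S Y : Pt) :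
    ParRays Inc R X S Y ↔ ParRays Inc (φ R) (φ X) (φ S) (φ Y) := by
  refine and_congr φ.injective.ne_iff.symm (and_congr φ.injective.ne_iff.symm
    (and_congr (not_congr (ψ.exists_congr fun l => by rw [hc R, hc X, hc S, hc Y]))
      (ψ.forall_congr fun g => ?_)))
  rw [meetsSet_ray_map hc g R, meetsSet_ray_map hc g S, meetsSet_segment_map hc g R]

theorem par_map (hc : ∀ X l, Inc X l ↔ Inc (φ X) (ψ l)) (a b : L) :
    Par Inc a b ↔ Par Inc (ψ a) (ψ b) :=
  φ.exists_congr fun R => φ.exists_congr fun X => φ.exists_congr fun S => φ.exists_congr fun Y => by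
    rw [hc R, hc X, hc S, hc Y, parRays_map hc]

theorem hasTransversal_map (hc : ∀ X l, Inc X l ↔ Inc (φ X) (ψ l)) (a b l : L) :
    HasTransversal Inc a b l ↔ HasTransversal Inc (ψ a) (ψ b) (ψ l) :=
  ψ.exists_congr fun t => by rw [meets_map hc, meets_map hc t, meets_map hc t]

theorem exists_map_rim (hc : ∀ X l, Inc X l ↔ Inc (φ X) (ψ l)) (A : Rim Inc) :
    ∃ B : Rim Inc, ∀ l, B.On (ψ l) ↔ A.On l := by
  obtain ⟨S, a, b, ⟨h1, l, h2, h3, h4⟩, rfl⟩ := A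
  refine ⟨⟨_, ψ a, ψ b, ⟨(par_map hc _ _).1 h1, ψ l, (par_map hc _ _).1 h2,
    (par_map hc _ _).1 h3, (hasTransversal_map hc _ _ _).1 h4⟩, rfl⟩, fun l => ?_⟩
  exact (or_congr ψ.injective.eq_iff (or_congr ψ.injective.eq_iff (and_congr (par_map hc _ _).symm
    (and_congr (par_map hc _ _).symm (hasTransversal_map hc _ _ _).symm))))

/-- The permutation of the rimpoints induced by a collineation. -/
theorem exists_rim_perm (hc : ∀ X l, Inc X l ↔ Inc (φ X) (ψ l)) :
    ∃ g : Equiv.Perm (Rim Inc), ∀ A l, (g A).On (ψ l) ↔ A.On l := by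
  have hc' : ∀ X l, Inc X l ↔ Inc (φ.symm X) (ψ.symm l) := fun X l => by
    rw [hc (φ.symm X), Equiv.apply_symm_apply, Equiv.apply_symm_apply]
  choose f hf using exists_map_rim hc
  choose f' hf' using exists_map_rim hc'
  refine ⟨⟨f, f', fun A => Subtype.ext (Set.ext fun l => ?_),
    fun A => Subtype.ext (Set.ext fun l => ?_)⟩, hf⟩
  · have := (hf' (f A) (ψ l)).trans (hf A l)
    rwa [ψ.symm_apply_apply] at this
  · have := (hf (f' A) (ψ.symm l)).trans (hf' A l)
    rwa [ψ.apply_symm_apply] at this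

theorem ht_map (h : Axioms Inc) (hc : ∀ X l, Inc X l ↔ Inc (φ X) (ψ l)) {g : Equiv.Perm (Rim Inc)}
    (hg : ∀ A l, (g A).On (ψ l) ↔ A.On l) (X : Pt) : g * ht h X * g⁻¹ = ht h (φ X) := by
  rw [mul_inv_eq_iff_eq_mul]
  ext1 A
  obtain ⟨h0, l, h1, h2, h3⟩ := ht_spec h X A
  exact (ht_eq h ((hc X l).1 h1) ((hg A l).2 h2) ((hg _ l).2 h3)
    (fun e => h0 (g.injective e).symm)).symm

theorem refl_conj_ht_ne (h : Axioms Inc) {a : L} {X : Pt} (hX : ¬ Inc X a) :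
    refl h a * ht h X * refl h a ≠ ht h X := by
  intro e
  obtain ⟨k, hXk, hp⟩ := exists_perp h X a
  obtain ⟨R, hRa, hRk, -⟩ := hp.exists_foot h
  obtain ⟨A, hA⟩ := exists_rim_not_on h k
  have hXR : X ≠ R := by rintro rfl; exact hX hRa
  rw [(hp.symm h).refl_eq h hRk hRa, mul_assoc (ht h R), refl_mul_ht h hXk, mul_assoc,
    mul_assoc (ht h X), ← refl_mul_ht h hRk, ← mul_assoc (refl h k), refl_mul_self, one_mul] at e
  have := congrArg (fun f => f (ht h R A)) e.symm
  simp only [Equiv.Perm.mul_apply, ht_ht] at this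
  exact ht_ht_ne h hXk hRk hXR hA this

/-- The reflections in a line in the sense of metric planes. -/
theorem isReflection_iff (h : Axioms Inc) {a : L} {φ : Equiv.Perm Pt} :
    IsReflection Inc (Perp Inc) a φ ↔ ∀ X, ht h (φ X) = refl h a * ht h X * refl h a := by
  constructor
  · rintro ⟨hφ, hfix, ψ, hc, hperp⟩
    obtain ⟨g, hg⟩ := exists_rim_perm hc
    have hgh := ht_map h hc hg
    have hgS : ∀ {S}, Inc S a → g * ht h S = ht h S * g := fun {S} hS => by
      have := hgh S
      rw [hfix _ hS, mul_inv_eq_iff_eq_mul] at this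
      exact this
    have hg1 : g ≠ 1 := by
      rintro rfl
      apply hφ
      ext1 X
      have := hgh X
      rw [one_mul, inv_one, mul_one] at this
      exact (ht_injective h this).symm
    have sepg : ∀ A B C D, Sep (g A) (g B) (g C) (g D) ↔ Sep A B C D := fun A B C D =>
      sep_motion h ⟨φ, hgh⟩
    have line_eq : ∀ {l X Y}, Inc X l → Inc Y l → φ X = X → φ Y = Y → X ≠ Y → ψ l = l := by
      intro l X Y hX hY eX eY hXY
      exact h.line_eq hXY (by rw [← eX]; exact (hc X l).1 hX)
        (by rw [← eY]; exact (hc Y l).1 hY) hX hY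
    have ha : ψ a = a := by
      obtain ⟨X, hX⟩ := h.A2 a
      obtain ⟨Y, hYX, hY⟩ := h.exists_ne_on a X
      exact line_eq hX hY (hfix X hX) (hfix Y hY) hYX.symm
    -- The perpendicular to `a` through A is preserved, since its foot is fixed and the
    -- perpendicular there is unique; so its two ends are fixed or interchanged.
    have two : ∀ A, ¬ A.On a → g A = A ∨ g A = refl h a A := by
      intro A hA
      obtain ⟨R, hR, e⟩ := refl_off h hA
      obtain ⟨k, hRk, hAk⟩ := A.exists_line h R
      have hp := perp_of_refl h hA hAk hRk e
      have hk : ψ k = k := by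
        have := (hperp a k).1 hp
        rw [ha] at this
        exact this.unique h hp hR (by rw [← hfix R hR]; exact (hc R k).1 hRk) hRk
      have hgA : (g A).On k := by rw [← hk]; exact (hg A k).2 hAk
      rw [e]
      exact Rim.eq_or_eq h (ht_ne h R A).symm hAk (ht_on h hRk hAk) hgA
    obtain ⟨A, hA⟩ := exists_rim_not_on h a
    obtain ⟨Q, hQ⟩ := h.A2 a
    -- Both `g` and the identity or σ_a commute with the half-turns about points of `a`, so
    -- agreement at one rimpoint off `a` carries over to all of them.
    have spread : ∀ f : Equiv.Perm (Rim Inc), (∀ {S}, Inc S a → f * ht h S = ht h S * f) →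
        g A = f A → ∀ B, ¬ B.On a → g B = f B := by
      intro f hf e B hB
      have step : ∀ {S B}, Inc S a → g B = f B → g (ht h S B) = f (ht h S B) := by
        intro S B hS e
        rw [← Equiv.Perm.mul_apply, hgS hS, Equiv.Perm.mul_apply, e, ← Equiv.Perm.mul_apply,
          ← hf hS, Equiv.Perm.mul_apply]
      by_cases hs : rside a A ↔ rside a B
      · obtain ⟨P, hP, rfl⟩ := exists_translation h hQ hA hB hs
        exact step hP (step hQ e)
      · obtain ⟨P, hP, rfl⟩ := exists_ht h hA hB hs
        exact step hP e
    rcases two A hA with e | e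
    · exact absurd (eq_of_eq_off h sepg (fun _ _ _ _ => Iff.rfl)
        (spread 1 (fun _ => by rw [one_mul, mul_one]) e)) hg1
    · have := eq_of_eq_off h sepg (fun _ _ _ _ => sep_motion h (refl_mem_motions h a))
        (spread (refl h a) (fun hS => refl_mul_ht h hS) e)
      intro X
      rw [← hgh, this, refl_inv]
  · intro hφ
    have hφ' : ∀ X, refl h a * ht h X * (refl h a)⁻¹ = ht h (φ X) := fun X => by
      rw [hφ, refl_inv]
    obtain ⟨ψ, hψ⟩ := exists_line_perm h (refl h a)
    refine ⟨?_, fun X hX => ?_, ψ, fun X l => (motion_inc h hφ' fun A => hψ A l).symm,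
      fun l m => ⟨fun hp => hp.motion h (refl_mem_motions h a) (fun A => hψ A l)
        (fun A => hψ A m), fun hp => hp.motion h (refl_mem_motions h a) (fun A => ?_)
        (fun A => ?_)⟩⟩
    · rintro rfl
      obtain ⟨X, hX⟩ := h.exists_not_on a
      exact refl_conj_ht_ne h hX (hφ X).symm
    · apply ht_injective h
      rw [hφ, refl_mul_ht h hX, mul_assoc, refl_mul_self, mul_one]
    · have := hψ (refl h a A) l
      rw [refl_refl] at this
      exact this.symm
    · have := hψ (refl h a A) m
      rw [refl_refl] at this
      exact this.symm

theorem exists_isReflection (h : Axioms Inc) (a : L) : ∃ φ, IsReflection Inc (Perp Inc) a φ := by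
  obtain ⟨φ, hφ⟩ := refl_mem_motions h a
  exact ⟨φ, (isReflection_iff h).2 fun X => by rw [← hφ, refl_inv]⟩

theorem isReflection_mul_self (h : Axioms Inc) {a : L} {φ : Equiv.Perm Pt}
    (hφ : IsReflection Inc (Perp Inc) a φ) : φ * φ = 1 := by
  rw [isReflection_iff h] at hφ
  ext1 X
  apply ht_injective h
  rw [Equiv.Perm.mul_apply, hφ, hφ]
  simp only [mul_assoc, refl_mul_self, mul_one]
  rw [← mul_assoc, refl_mul_self, one_mul]
  rfl

theorem isReflection_mul (h : Axioms Inc) {a b c d : L} (he : refl h a * refl h b * refl h c =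
    refl h d) {ρ₁ ρ₂ ρ₃ : Equiv.Perm Pt} (h1 : IsReflection Inc (Perp Inc) a ρ₁)
    (h2 : IsReflection Inc (Perp Inc) b ρ₂) (h3 : IsReflection Inc (Perp Inc) c ρ₃) :
    IsReflection Inc (Perp Inc) d (ρ₁ * ρ₂ * ρ₃) := by
  rw [isReflection_iff h] at *
  intro X
  have he' : refl h c * (refl h b * refl h a) = refl h d := by
    have := congrArg (·⁻¹) he
    simpa using this
  rw [Equiv.Perm.mul_apply, Equiv.Perm.mul_apply, h1, h2, h3]
  calc _ = refl h a * refl h b * refl h c * ht h X * (refl h c * (refl h b * refl h a)) := by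
        simp only [mul_assoc]
    _ = _ := by rw [he, he']

/-- Each factor is a half-turn about a point of `m` times σ_m, and σ_m commutes with these
half-turns, so the product is ABCσ_m = Dσ_m. -/
theorem three_refl_perp (h : Axioms Inc) {a b c m : L} (ha : Perp Inc a m) (hb : Perp Inc b m)
    (hc : Perp Inc c m) : ∃ d, Perp Inc d m ∧ refl h a * refl h b * refl h c = refl h d := by
  obtain ⟨A, hAa, hAm, -⟩ := ha.exists_foot h
  obtain ⟨B, hBb, hBm, -⟩ := hb.exists_foot h
  obtain ⟨C, hCc, hCm, -⟩ := hc.exists_foot h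
  obtain ⟨D, hD, e⟩ := exists_three_ht h hAm hBm hCm
  obtain ⟨d, hDd, hd⟩ := exists_perp_at h hD
  refine ⟨d, hd.symm h, ?_⟩
  rw [(ha.symm h).refl_eq h hAm hAa, (hb.symm h).refl_eq h hBm hBb, (hc.symm h).refl_eq h hCm hCc,
    hd.refl_eq h hD hDd, ← e]
  have e1 := refl_mul_ht h hBm
  have e2 := refl_mul_ht h hCm
  calc ht h A * refl h m * (ht h B * refl h m) * (ht h C * refl h m)
      = ht h A * (refl h m * ht h B) * (refl h m * ht h C) * refl h m := by simp only [mul_assoc]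
    _ = ht h A * ht h B * (refl h m * ht h C) * (refl h m * refl h m) := by
      rw [e1, e2]
      simp only [mul_assoc]
      rw [← mul_assoc (refl h m) (ht h C), e2, mul_assoc]
    _ = _ := by
      rw [e2]; simp only [mul_assoc, refl_mul_self, mul_one]

end Collineations
end HypInc


namespace HypInc

/-! ### The theorem of three reflections for concurrent lines. -/

section ThreeReflections

variable {Pt L : Type*} {Inc : Pt → L → Prop}

theorem dir_trans (h : Axioms Inc) {b : L} {X Y Z : Pt} (hX : Inc X b) (hY : Inc Y b)
    (hZ : Inc Z b) (hXY : X ≠ Y) (hYZ : Y ≠ Z) (h1 : dir Inc b X Y) (h2 : dir Inc b Y Z) :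
    X ≠ Z ∧ dir Inc b X Z := by
  have h3 := dir_flip h hX hY hXY.symm
  have hXZ : X ≠ Z := by rintro rfl; exact h3.1 h2 h1
  refine ⟨hXZ, ?_⟩
  obtain ⟨n, hn, hnb, -⟩ := h.exists_third_line Y b b
  have h4 := dir_iff_side h hn hnb hY hX hZ hXY hYZ.symm
  have hb : Between Inc X Y Z := (btw_iff h (h.off hnb hn hY hX hXY) (h.off hnb hn hY hZ hYZ.symm)
    hn hX hY hZ).2 (by grind only)
  exact (dir_of_btw h hb hX hY).1 h1

/-- On a line there is a point beyond finitely many given ones. -/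
theorem exists_beyond (h : Axioms Inc) {b : L} (s : List Pt) (hs : ∀ X ∈ s, Inc X b) :
    ∃ B, Inc B b ∧ ∀ X ∈ s, B ≠ X ∧ dir Inc b B X := by
  induction s with
  | nil => obtain ⟨B, hB⟩ := h.A2 b; exact ⟨B, hB, by simp⟩
  | cons Y s ih =>
    obtain ⟨B, hB, h1⟩ := ih fun X hX => hs X (List.mem_cons_of_mem Y hX)
    have hY := hs Y List.mem_cons_self
    by_cases hc : B ≠ Y ∧ dir Inc b B Y
    · refine ⟨B, hB, fun X hX => ?_⟩
      rcases List.mem_cons.1 hX with rfl | hX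
      · exact hc
      · exact h1 X hX
    obtain ⟨C, hC, hCY, hd⟩ := exists_dir h hY False
    have hCd : dir Inc b C Y := by
      have := dir_flip h hY hC hCY
      grind only
    have hCB : C ≠ B ∧ dir Inc b C B := by
      by_cases hBY : B = Y
      · subst hBY; exact ⟨hCY, hCd⟩
      · have := dir_flip h hB hY (Ne.symm hBY)
        exact dir_trans h hC hY hB hCY (Ne.symm hBY) hCd (by grind only)
    refine ⟨C, hC, fun X hX => ?_⟩
    rcases List.mem_cons.1 hX with rfl | hX
    · exact ⟨hCY, hCd⟩
    · exact dir_trans h hC hB (hs X (List.mem_cons_of_mem Y hX)) hCB.1 (h1 X hX).1 hCB.2 (h1 X hX).2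

theorem Perp.not_on (h : Axioms Inc) {b v v' : L} {B F : Pt} (hv : Perp Inc b v)
    (hv' : Perp Inc b v') (hB : Inc B b) (hBv : Inc B v) (hF : Inc F b) (hFv' : Inc F v')
    (hBF : B ≠ F) {A : Rim Inc} (hA : A.On v') : ¬ A.On v := by
  intro e
  obtain ⟨R, -, -, -, h1⟩ := hv.exists_foot h
  exact ht_ne_ht h hB hF hBF (h1 A e).1
    ((hv.refl_eq_ht h hB hBv e).symm.trans (hv'.refl_eq_ht h hF hFv' hA))

/-- Two perpendiculars to a line do not meet. -/
theorem Perp.not_meets (h : Axioms Inc) {b v v' : L} {B F : Pt} (hv : Perp Inc b v)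
    (hv' : Perp Inc b v') (hB : Inc B b) (hBv : Inc B v) (hF : Inc F b) (hFv' : Inc F v')
    (hBF : B ≠ F) : ¬ Meets Inc v' v := by
  rintro ⟨T, hT', hT⟩
  have hvv : v ≠ v' := by
    rintro rfl
    exact hv.not_on h hv' hB hBv hF hFv' hBF (rim_on h v True) (rim_on h v True)
  have hTb : ¬ Inc T b := by
    intro e
    obtain ⟨R, h1, h2, h3, -⟩ := hv.exists_foot h
    obtain ⟨R', h1', h2', h3', -⟩ := hv'.exists_foot h
    exact hBF ((h.pt_eq h3 hB hBv e hT).trans (h.pt_eq h3' e hT' hF hFv'))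
  obtain ⟨φ, hφ⟩ := refl_mem_motions h b
  have fix : ∀ {v B}, Perp Inc b v → Inc B b → Inc B v → ∀ A, (refl h b A).On v ↔ A.On v := by
    intro v B hv hB hBv
    have key : ∀ A : Rim Inc, A.On v → (refl h b A).On v := fun A hA => by
      rw [hv.refl_eq_ht h hB hBv hA]; exact ht_on h hBv hA
    exact fun A => ⟨fun e => by simpa using key _ e, key A⟩
  -- The reflection in `b` preserves both perpendiculars, so it would fix their intersection, a
  -- point off `b`.
  have e : φ T = T := h.pt_eq hvv ((motion_inc h hφ (fix hv hB hBv)).2 hT)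
    ((motion_inc h hφ (fix hv' hF hFv')).2 hT') hT hT'
  refine refl_conj_ht_ne h hTb ?_
  have := hφ T
  rwa [e, refl_inv] at this

/-- A line perpendicular to `b` far from a line `a` does not meet `a`. -/
theorem exists_far (h : Axioms Inc) {a b : L} {O : Pt} (hOa : Inc O a) (hOb : Inc O b)
    (hab : a ≠ b) : ∃ F G, Inc F b ∧ Inc G b ∧ ∀ B v, Inc B b → Inc B v → Perp Inc b v → B ≠ F →
      B ≠ G → (side Inc v F ↔ side Inc v G) → ¬ Meets Inc v a ∧ ∀ A : Rim Inc, A.On v → ¬ A.On a := by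
  obtain ⟨N, h1, hN, h3⟩ := Rim.exists_other h (rim_on h a True)
  have hM := rim_on h a True
  -- Here `F` is the foot on `b` of the perpendicular from an end of `a`. A perpendicular to `b`
  -- elsewhere misses that one, so it sees the end and `F` on the same side.
  have foot : ∀ {A : Rim Inc}, A.On a → ∃ F, Inc F b ∧ ∀ B v, Inc B b → Inc B v → Perp Inc b v →
      B ≠ F → ¬ A.On v ∧ (rside v A ↔ side Inc v F) := by
    intro A hA
    have hAb : ¬ A.On b := fun e => hab (Rim.line_eq h hA e hOa hOb)
    obtain ⟨F, hF, e⟩ := refl_off h hAb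
    obtain ⟨v', hFv', hAv'⟩ := A.exists_line h F
    have hv' := perp_of_refl h hAb hAv' hFv' e
    refine ⟨F, hF, fun B v hB hBv hv hBF => ?_⟩
    have hAv := hv.not_on h hv' hB hBv hF hFv' hBF hAv'
    exact ⟨hAv, rside_of_miss h hAv' hAv (hv.not_meets h hv' hB hBv hF hFv' hBF) hFv'⟩
  obtain ⟨F, hF, hF'⟩ := foot hM
  obtain ⟨G, hG, hG'⟩ := foot hN
  refine ⟨F, G, hF, hG, fun B v hB hBv hv hBF hBG hs => ?_⟩
  obtain ⟨e1, e2⟩ := hF' B v hB hBv hv hBF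
  obtain ⟨e3, e4⟩ := hG' B v hB hBv hv hBG
  refine ⟨fun ⟨T, h4, h5⟩ => (meets_iff_rside h h1.symm hM hN e1 e3).1 ⟨T, h5, h4⟩ (by grind only),
    fun A hA hAa => ?_⟩
  rcases h3 A hAa with rfl | rfl
  · exact e1 hA
  · exact e3 hA

theorem exists_perp_missing (h : Axioms Inc) {a b c : L} {O : Pt} (hOa : Inc O a) (hOb : Inc O b)
    (hOc : Inc O c) (hab : a ≠ b) (hcb : c ≠ b) : ∃ v, Perp Inc b v ∧
      (¬ Meets Inc v a ∧ ∀ A : Rim Inc, A.On v → ¬ A.On a) ∧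
      (¬ Meets Inc v c ∧ ∀ A : Rim Inc, A.On v → ¬ A.On c) := by
  obtain ⟨F, G, hF, hG, h1⟩ := exists_far h hOa hOb hab
  obtain ⟨F', G', hF', hG', h2⟩ := exists_far h hOc hOb hcb
  obtain ⟨B, hB, h3⟩ := exists_beyond h [F, G, F', G'] (b := b) (by simp [hF, hG, hF', hG'])
  simp only [List.mem_cons, List.not_mem_nil, or_false, forall_eq_or_imp, forall_eq] at h3
  obtain ⟨⟨n1, d1⟩, ⟨n2, d2⟩, ⟨n3, d3⟩, n4, d4⟩ := h3
  obtain ⟨v, hBv, hv⟩ := exists_perp_at h hB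
  obtain ⟨-, -, -, hbv, -⟩ := hv.exists_foot h
  refine ⟨v, hv, h1 B v hB hBv hv n1 n2 ?_, h2 B v hB hBv hv n3 n4 ?_⟩
  · rw [← dir_iff_side h hBv hbv.symm hB hF hG n1.symm n2.symm]
    exact iff_of_true d1 d2
  · rw [← dir_iff_side h hBv hbv.symm hB hF' hG' n3.symm n4.symm]
    exact iff_of_true d3 d4

/-- Lines without common points or rimpoints have a common perpendicular. -/
theorem exists_common_perp (h : Axioms Inc) {a v : L} (hm : ¬ Meets Inc v a)
    (ho : ∀ A : Rim Inc, A.On v → ¬ A.On a) : ∃ p, Perp Inc p a ∧ Perp Inc p v := by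
  have hX := rim_on h v True
  obtain ⟨Y, hYX, hY, -⟩ := Rim.exists_other h hX
  obtain ⟨X, hX'⟩ : ∃ X, X = rim h v True := ⟨_, rfl⟩
  rw [← hX'] at hX hYX
  have hXa := ho X hX
  have hYa := ho Y hY
  have hs : rside a X ↔ rside a Y := by
    by_contra hc
    exact hm ((meets_iff_rside h hYX.symm hX hY hXa hYa).2 hc)
  obtain ⟨Q, hQ⟩ := h.A2 a
  obtain ⟨P, hP, e⟩ := exists_translation h hQ hXa hYa hs
  obtain ⟨M, hM, e'⟩ := exists_sqrt h hP hQ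
  have hZ : ¬ (ht h P (ht h M X)).On a := by rwa [ht_on_iff h hP, ht_on_iff h hM]
  have e2 : ht h P (ht h M (ht h P (ht h M X))) = Y := by
    rw [← e, ← Equiv.Perm.mul_apply (ht h P) (ht h Q), e']; rfl
  obtain ⟨R, hR, e3⟩ := refl_off h hZ
  obtain ⟨p, hRp, hZp⟩ := Rim.exists_line h (ht h P (ht h M X)) R
  have hp := perp_of_refl h hZ hZp hRp e3
  have e4 := hp.refl_eq h hR hRp
  -- The rimpoint Z halfway from X to Y is an end of `p`. Reflection in the perpendicular `p`
  -- inverts translations along `a`, so it interchanges X and Y.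
  have e5 : refl h p * (ht h P * ht h M) = (ht h M * ht h P) * refl h p := by
    rw [e4, mul_assoc, ← mul_assoc (refl h a), refl_mul_ht h hP, mul_assoc, refl_mul_ht h hM,
      ← mul_assoc, ← mul_assoc, three_ht h hR hP hM, mul_assoc]
  have e6 : refl h p X = Y := by
    have := congrArg (fun f => f X) e5
    simp only [Equiv.Perm.mul_apply] at this
    rw [refl_on h hZp] at this
    have := congrArg (fun A => ht h P (ht h M A)) this
    simp only [ht_ht] at this
    rw [← this, e2]
  refine ⟨p, hp.symm h, (perp_iff h).2 ⟨X, hX, fun e => hYX ?_, e6 ▸ hY⟩⟩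
  rw [← e6, refl_on h e]

/-- This brings the product into the form of a glide reflection along `t`. Dropping perpendiculars
repeatedly, from `C` to `s`, from `A` to the result, and so on, replaces a half-turn times a
reflection by a reflection until axis and centres are on one line. -/
theorem ht_mul_refl_mul_ht (h : Axioms Inc) (A C : Pt) (s : L) :
    ∃ t T C', Inc T t ∧ Inc C' t ∧ ht h A * refl h s * ht h C = refl h t * (ht h T * ht h C') := by
  obtain ⟨w, hCw, hw⟩ := exists_perp h C s
  obtain ⟨S, hSs, hSw, -⟩ := hw.exists_foot h
  obtain ⟨e, hAe, he⟩ := exists_perp h A w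
  obtain ⟨E, hEw, hEe, -⟩ := he.exists_foot h
  obtain ⟨C', hC', e1⟩ := exists_three_ht h hEw hSw hCw
  obtain ⟨e', hAe', he'⟩ := exists_perp_at h hAe
  obtain ⟨t, hC't, hT⟩ := exists_perp h C' e'
  obtain ⟨T, hTe', hTt, -⟩ := hT.exists_foot h
  refine ⟨t, T, C', hTt, hC't, ?_⟩
  calc ht h A * refl h s * ht h C
      = ht h A * (ht h S * (refl h w * ht h C)) := by
        rw [(hw.symm h).refl_eq h hSw hSs]; simp only [mul_assoc]
    _ = ht h A * (ht h E * (ht h E * ht h S * ht h C) * refl h w) := by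
        rw [refl_mul_ht h hCw]
        simp only [mul_assoc]
        rw [← mul_assoc (ht h E) (ht h E), ht_mul_self, one_mul]
    _ = ht h A * (ht h E * refl h w) * ht h C' := by
        rw [e1, mul_assoc, ← refl_mul_ht h hC']; simp only [mul_assoc]
    _ = refl h e' * ht h C' := by
        rw [← he.refl_eq h hEw hEe, ← he'.refl_eq h hAe hAe']
    _ = ht h T * refl h t * ht h C' := by rw [(hT.symm h).refl_eq h hTt hTe']
    _ = _ := by rw [← refl_mul_ht h hTt, mul_assoc]

/-- A half-turn commuting with a nontrivial translation preserves its set of fixed rimpoints, the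
ends of `t`, so `O` is on `t`. But then it also inverts the translation, which is not an involution.
-/
theorem translation_fixed (h : Axioms Inc) {t : L} {P Q O : Pt} (hP : Inc P t) (hQ : Inc Q t)
    (hc : ht h O * (ht h P * ht h Q * (ht h P * ht h Q)) =
      ht h P * ht h Q * (ht h P * ht h Q) * ht h O) : P = Q := by
  by_contra hPQ
  obtain ⟨S, hS, e⟩ := exists_three_ht h hP hQ hP
  have e1 : ht h P * ht h Q * (ht h P * ht h Q) = ht h S * ht h Q := by
    rw [← e]; simp only [mul_assoc]
  obtain ⟨A, hA⟩ := exists_rim_not_on h t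
  have hSQ : S ≠ Q := by
    rintro rfl
    rw [ht_mul_self, mul_eq_one_iff_eq_inv] at e1
    have := congrArg (fun f => f A) e1
    simp only [mul_inv_rev, ht_inv, Equiv.Perm.mul_apply] at this
    exact ht_ht_ne h hP hQ hPQ hA this
  rw [e1] at hc
  have hO : Inc O t := by
    obtain ⟨B, hB, hB', -⟩ := Rim.exists_other h (rim_on h t True)
    have hM := rim_on h t True
    refine inc_of_ht h hM ?_
    by_contra hne
    have := congrArg (fun f => f (rim h t True)) hc
    simp only [Equiv.Perm.mul_apply] at this
    rw [ht_eq h hQ hM hB' hB.symm, ht_eq h hS hB' hM hB] at this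
    exact ht_apply_ne h hS hQ hSQ hne this.symm
  have e2 := ht_conj_translation h hS hQ hO
  rw [hc, mul_assoc, ht_mul_self, mul_one] at e2
  have := congrArg (fun f => f A) e2
  simp only [Equiv.Perm.mul_apply] at this
  exact ht_ht_ne h hS hQ hSQ hA this

theorem three_refl_concurrent (h : Axioms Inc) {a b c : L} {O : Pt} (hOa : Inc O a) (hOb : Inc O b)
    (hOc : Inc O c) : ∃ d, refl h a * refl h b * refl h c = refl h d := by
  by_cases hab : a = b
  · subst hab
    exact ⟨c, by rw [refl_mul_self, one_mul]⟩
  by_cases hcb : c = b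
  · subst hcb
    exact ⟨a, by rw [mul_assoc, refl_mul_self, mul_one]⟩
  -- The lines `p`, `b`, `q` are all perpendicular to `v`, so σ_pσ_bσ_q is a reflection σ_s. As σ_a
  -- is Aσ_p and σ_c is σ_qC, the whole product becomes Aσ_sC.
  obtain ⟨v, hv, ⟨ha, ha'⟩, hc, hc'⟩ := exists_perp_missing h hOa hOb hOc hab hcb
  obtain ⟨p, hpa, hpv⟩ := exists_common_perp h ha ha'
  obtain ⟨q, hqc, hqv⟩ := exists_common_perp h hc hc'
  obtain ⟨s, -, hs⟩ := three_refl_perp h hpv hv hqv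
  obtain ⟨A, hAp, hAa, -⟩ := hpa.exists_foot h
  obtain ⟨C, hCq, hCc, -⟩ := hqc.exists_foot h
  obtain ⟨t, T, C', hT, hC', e⟩ := ht_mul_refl_mul_ht h A C s
  have eg : refl h a * refl h b * refl h c = refl h t * (ht h T * ht h C') := by
    rw [← e, ← hs, hpa.refl_eq h hAp hAa, hqc.refl_eq h hCq hCc, ← refl_mul_ht h hCq]
    simp only [mul_assoc]
  have comm : Commute (ht h O) (refl h t * (ht h T * ht h C')) := by
    have key : ∀ {l}, Inc O l → Commute (ht h O) (refl h l) := fun hl => (refl_mul_ht h hl).symm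
    rw [← eg]
    exact ((key hOa).mul_right (key hOb)).mul_right (key hOc)
  have sq : refl h t * (ht h T * ht h C') * (refl h t * (ht h T * ht h C')) =
      ht h T * ht h C' * (ht h T * ht h C') := by
    have key : Commute (refl h t) (ht h T * ht h C') :=
      Commute.mul_right (refl_mul_ht h hT) (refl_mul_ht h hC')
    rw [← key.mul_mul_mul_comm, refl_mul_self, one_mul]
  have hTC : T = C' := translation_fixed h hT hC' (O := O) (by
    rw [← sq]
    exact comm.mul_right comm)
  exact ⟨t, by rw [eg, hTC, ht_mul_self, mul_one]⟩

end ThreeReflections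
end HypInc


theorem mainTheorem2 {P L : Type*} (Inc : P → L → Prop) (h : HypInc.Axioms Inc) :
    (∀ l : L, ∃ α : Equiv.Perm (HypInc.Rim Inc), HypInc.IsAxial α l) ∧
    (∀ l : L, ∃! σ : HypInc.Rim Inc → HypInc.Rim Inc, HypInc.IsLineReflection l σ) ∧
    HypInc.IsMetricPlane Inc (HypInc.Perp Inc) := by
  refine ⟨fun l => ?_, fun l => ⟨HypInc.refl h l, HypInc.refl_isLineReflection h l,
    fun σ hσ => (HypInc.isLineReflection_iff h).1 hσ⟩, ?_⟩
  · obtain ⟨A, hA⟩ := h.A2 l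
    obtain ⟨B, hBA, hB⟩ := h.exists_ne_on l A
    exact ⟨_, HypInc.translation_isAxial h hB hA hBA⟩
  · exact {
      perp_symm := fun a b hp => hp.symm h
      I1 := h.A1
      I2 := fun l => by
        obtain ⟨A, hA⟩ := h.A2 l
        obtain ⟨B, hBA, hB⟩ := h.exists_ne_on l A
        obtain ⟨C, hC⟩ := h.extend hBA
        exact ⟨B, A, C, hC.1, hC.2.1, hC.2.2.1, hB, hA, hC.on_right h hB hA⟩
      I3 := by
        obtain ⟨A, B, C, -, -, -, hc⟩ := h.A3_noncollinear
        exact ⟨A, B, C, hc⟩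
      P1_exists := fun X a => by
        obtain ⟨b, hb, hp⟩ := HypInc.exists_perp h X a
        exact ⟨b, hb, hp.symm h⟩
      P1_unique := fun X a hX => by
        obtain ⟨b, hb, hp⟩ := HypInc.exists_perp h X a
        exact ⟨b, ⟨hb, hp.symm h⟩, fun c hc => (hc.2.symm h).unique h hp hX hc.1 hb⟩
      P2 := fun a b hp => by
        obtain ⟨R, h1, h2, hab, -⟩ := hp.exists_foot h
        exact ⟨R, ⟨h1, h2⟩, fun S hS => h.pt_eq hab hS.1 hS.2 h1 h2⟩
      M1 := fun a => HypInc.exists_isReflection h a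
      M2 := fun a φ hφ => ⟨hφ.1, HypInc.isReflection_mul_self h hφ⟩
      M3 := fun a b c ⟨O, ha, hb, hc⟩ ρ₁ ρ₂ ρ₃ h1 h2 h3 => by
        obtain ⟨d, hd⟩ := HypInc.three_refl_concurrent h ha hb hc
        exact ⟨d, HypInc.isReflection_mul h hd h1 h2 h3⟩
      M4 := fun a b c ⟨m, ha, hb, hc⟩ ρ₁ ρ₂ ρ₃ h1 h2 h3 => by
        obtain ⟨d, -, hd⟩ := HypInc.three_refl_perp h ha hb hc
        exact ⟨d, HypInc.isReflection_mul h hd h1 h2 h3⟩ }
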